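/- Let $\Gamma\subset\mathbb R^n$ be an open cone, invariant under permutations of the coordinates and containing the positive cone $\Gamma_+=\{\lambda:\lambda_i>0\ \forall i\}$. Let $f:\Gamma\to\mathbb R$ be a smooth function that is invariant under permutations of its variables, monotone increasing (possibly not strictly) in each variable, homogeneous of degree one, and positive (an admissible underlying speed function). Let $\Psi:(0,\infty)\to\mathbb R$ be $C^2$ with $\Psi'(s)>0$ for all $s>0$. Let $M^n$ be a closed (compact, without boundary) smooth $n$-manifold, let $0<T\le\infty$, and let $X:M^n\times[0,T)\to\mathbb R^{n+1}$ be a smooth one-parameter family of smooth embeddings such that each $X(M,t)$ is the boundary of a bounded open set $\Omega_t$. Let $\nu(\cdot,t)$ be the outward unit normal, a vector field smooth on $M\times[0,T)$, and let $\kappa(\cdot,t)=(\kappa_1\le\dots\le\kappa_n)$ be the principal curvatures with respect to $\nu$ (positive for round spheres). Suppose that $\kappa(x,t)\in\Gamma$ for all $(x,t)$ and that $$\partial_tX(x,t)=-\Psi(F(x,t))\,\nu(x,t),\qquad F(x,t)=f(\kappa(x,t)).$$ Define the exscribed curvature by $$\underline k(x,t)=\inf_{y\in M\setminus\{x\}}\frac{2\langle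 X(x,t)-X(y,t),\nu(x,t)\rangle}{|X(x,t)-X(y,t)|^2}.$$ Assume that $\Gamma$ and $f$ are convex and that, for all $s>0$, $\Psi'(s)s-\Psi(s)\le 0$ and $\Psi''(s)\ge 0$. Then $X$ is exterior noncollapsing: there is a constant $\beta>0$ with $\underline k(x,0)\ge-\beta F(x,0)$ for all $x\in M$, and for every such constant $\beta$, $$\underline k(x,t)\ge-\beta F(x,t)\qquad\text{for all }(x,t)\in M\times[0,T).$$ -/

import Mathlib

open Set Filter Topology
open scoped Manifold ContDiff

noncomputable section

namespace CurvatureFlow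

/-! ### Speed functions -/

/-- An admissible underlying speed function of `n` variables: a smooth function `f` on an open,
permutation-invariant cone `Γ ⊆ ℝⁿ` containing the positive cone, which is symmetric, increasing
in each variable (in the weak sense), homogeneous of degree one and positive. -/
structure IsAdmissibleSpeed {n : ℕ} (Γ : Set (Fin n → ℝ)) (f : (Fin n → ℝ) → ℝ) : Prop where
  isOpen_cone : IsOpen Γ
  perm_mem : ∀ (σ : Equiv.Perm (Fin n)), ∀ l ∈ Γ, l ∘ σ ∈ Γ
  smul_mem : ∀ c : ℝ, 0 < c → ∀ l ∈ Γ, c • l ∈ Γ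
  pos_mem : ∀ l : Fin n → ℝ, (∀ i, 0 < l i) → l ∈ Γ
  smooth : ContDiffOn ℝ ∞ f Γ
  symmetric : ∀ (σ : Equiv.Perm (Fin n)), ∀ l ∈ Γ, f (l ∘ σ) = f l
  increasing : ∀ l ∈ Γ, ∀ (i : Fin n) (s : ℝ), l i ≤ s → Function.update l i s ∈ Γ →
    f l ≤ f (Function.update l i s)
  homogeneous : ∀ c : ℝ, 0 < c → ∀ l ∈ Γ, f (c • l) = c * f l
  positive : ∀ l ∈ Γ, 0 < f l

/-! ### Hypersurfaces in Euclidean space -/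

section Hypersurface

variable {n : ℕ} {M : Type*} [TopologicalSpace M] [ChartedSpace (EuclideanSpace ℝ (Fin n)) M]

/-- The differential at `x` of an `ℝⁿ⁺¹`-valued map on the `n`-manifold `M`. The tangent space
`TangentSpace (𝓡 n) x` is by definition `ℝⁿ` (through the preferred chart at `x`), and the tangent
spaces of `ℝⁿ⁺¹` are `ℝⁿ⁺¹`. -/
def differential (Y : M → EuclideanSpace ℝ (Fin (n + 1))) (x : M) :
    EuclideanSpace ℝ (Fin n) →L[ℝ] EuclideanSpace ℝ (Fin (n + 1)) :=
  mfderiv (𝓡 n) (𝓡 (n + 1)) Y x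

/-- `ν` is the outward unit normal of the hypersurface `Y(M)`, which is the boundary of a bounded
open set `Ω`: it is a unit vector field normal to `Y(M)`, and `-ν` points into `Ω` while `ν` points
out of `Ω`. -/
structure IsOutwardUnitNormal (Y ν : M → EuclideanSpace ℝ (Fin (n + 1))) : Prop where
  norm_eq_one : ∀ x, ‖ν x‖ = 1
  normal : ∀ x v, inner ℝ (differential Y x v) (ν x) = 0
  outward : ∃ Ω : Set (EuclideanSpace ℝ (Fin (n + 1))),
    IsOpen Ω ∧ Bornology.IsBounded Ω ∧ frontier Ω = range Y ∧
      ∀ x, ∀ᶠ s in 𝓝[>] (0 : ℝ), Y x - s • ν x ∈ Ω ∧ Y x + s • ν x ∉ Ω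

/-- The Weingarten map `W` at `x`, characterised by `dν = dY ∘ W` (for an immersion `Y` with unit
normal field `ν`, `dν` takes its values in the range of the injective map `dY`). With the outward
normal, the round sphere of radius `r` has `W = r⁻¹ • id`. -/
def weingarten (Y ν : M → EuclideanSpace ℝ (Fin (n + 1))) (x : M) :
    EuclideanSpace ℝ (Fin n) →ₗ[ℝ] EuclideanSpace ℝ (Fin n) :=
  (differential Y x : EuclideanSpace ℝ (Fin n) →ₗ[ℝ] EuclideanSpace ℝ (Fin (n + 1))).leftInverse ∘ₗ
    (differential ν x : EuclideanSpace ℝ (Fin n) →ₗ[ℝ] EuclideanSpace ℝ (Fin (n + 1)))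

/-- The principal curvatures `κ₁ ≤ … ≤ κₙ` at `x`: the eigenvalues of the Weingarten map with
multiplicity (the `n` real roots of its characteristic polynomial), in nondecreasing order. -/
def principalCurvatures (Y ν : M → EuclideanSpace ℝ (Fin (n + 1))) (x : M) : Fin n → ℝ :=
  fun i => ((weingarten Y ν x).charpoly.roots.sort (· ≤ ·)).getD i 0

/-- The extrinsic ball curvature `k(x,y) = 2⟨Y(x) - Y(y), ν(x)⟩ / |Y(x) - Y(y)|²`, for `y ≠ x`. -/
def ballCurvature (Y ν : M → EuclideanSpace ℝ (Fin (n + 1))) (x y : M) : ℝ :=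
  2 * inner ℝ (Y x - Y y) (ν x) / ‖Y x - Y y‖ ^ 2

/-- The exscribed curvature at `x`: the infimum of `k(x,y)` over `y ≠ x`, taken in the extended
reals, so that no boundedness is presupposed. -/
def exscribedCurvature (Y ν : M → EuclideanSpace ℝ (Fin (n + 1))) (x : M) : EReal :=
  ⨅ y : {y : M // y ≠ x}, (ballCurvature Y ν x y : EReal)

end Hypersurface

/-! ### The flow -/

/-- The time interval `[0,T)`, where `T` may be `∞`. -/
def timeInterval (T : EReal) : Set ℝ := {t | 0 ≤ t ∧ (t : EReal) < T}

section Flow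

variable {n : ℕ} {M : Type*} [TopologicalSpace M] [ChartedSpace (EuclideanSpace ℝ (Fin n)) M]

/-- The speed function `F(x,t) = f(κ(x,t))`. -/
def speed (f : (Fin n → ℝ) → ℝ) (X ν : ℝ → M → EuclideanSpace ℝ (Fin (n + 1))) (t : ℝ) (x : M) :
    ℝ :=
  f (principalCurvatures (X t) (ν t) x)

/-- `X` is an embedded solution on `M × [0,T)`, with outward unit normal `ν`, of the curvature flow
`∂ₜX = -Ψ(F) ν`, `F = f(κ)`. The functions `X` and `ν` are written with the time variable first. -/
structure IsEmbeddedSolution (Γ : Set (Fin n → ℝ)) (f : (Fin n → ℝ) → ℝ) (Ψ : ℝ → ℝ) (T : EReal)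
    (X ν : ℝ → M → EuclideanSpace ℝ (Fin (n + 1))) : Prop where
  smooth : ContMDiffOn ((𝓡 n).prod 𝓘(ℝ, ℝ)) (𝓡 (n + 1)) ∞
    (fun p : M × ℝ => X p.2 p.1) (univ ×ˢ timeInterval T)
  smooth_normal : ContMDiffOn ((𝓡 n).prod 𝓘(ℝ, ℝ)) (𝓡 (n + 1)) ∞
    (fun p : M × ℝ => ν p.2 p.1) (univ ×ˢ timeInterval T)
  embedding : ∀ t ∈ timeInterval T, Manifold.IsSmoothEmbedding (𝓡 n) (𝓡 (n + 1)) ∞ (X t)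
  outward_normal : ∀ t ∈ timeInterval T, IsOutwardUnitNormal (X t) (ν t)
  curvatures_mem : ∀ t ∈ timeInterval T, ∀ x, principalCurvatures (X t) (ν t) x ∈ Γ
  flow : ∀ t ∈ timeInterval T, ∀ x,
    HasDerivWithinAt (fun s => X s x) (-Ψ (speed f X ν t x) • ν t x) (timeInterval T) t

end Flow

end CurvatureFlow

end

/-! With θ constantly β, the conclusion says that Z(x,y,t) = 2⟨X(x)-X(y),ν(x)⟩ + θF(x)|X(x)-X(y)|²
is nonnegative. The proof is a two-point maximum principle for the strict barrier φ = θF with θ(t) =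
β + ε(1+t). Z vanishes on the diagonal, where its second order part is the quadratic form h + φg.
Hence at a first failure time, which is positive, either Z has an off-diagonal zero or h + φg
degenerates, that is, some principal curvature κ_m equals -φ (`exists_first_touching`, based on the
uniform expansion `twoPoint_near_diagonal`).

Both cases are excluded by writing the flow near a point as a graph w over the tangent hyperplane in
principal directions (`exists_localGraph`), so that only Taylor coefficients of w and F enter. The
function f(κ) is never differentiated along the flow. Since Ψ(F) is the normal speed and Ψ' > 0, F
is C². Let a = ∇f(κ) at the base point. By Euler's identity and convexity, a·l ≤ f(l) on Γ; by
Schur-Horn, Birkhoff and the symmetry of f, the sum ∑ aᵢ h(vᵢ,vᵢ) is at most F in every orthonormal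
frame at every nearby point (`weighted_trace_le`), with equality at the base point. Touching from
below gives equality of first derivatives and an inequality for second derivatives
(`IsGraphFlow.dd_F`), even at multiple eigenvalues. With Ψ'' ≥ 0 and Ψ ≥ Ψ'F this yields ∂ₜF ≥ Ψ' ∑
aᵢ(Fᵢᵢ + Fκᵢ²) (`IsGraphFlow.evolution`).

On the diagonal (`not_touching_diagonal`), the second variations of h + φg in the component m,
weighted by aᵢ, are compared with its time derivative. Off the diagonal
(`not_touching_offDiagonal`), the exterior ball at x touches at y, so the normal at y is the
reflection of the normal at x in the hyperplane orthogonal to D = X(x)-X(y). The points x and y are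
moved along reflected frames, the second variations are summed with the weights aᵢ, and the support
inequality at y together with convexity of Ψ compares F(y) with F(x). In both cases every remaining
term has a favourable sign, and the positive term produced by ε gives the contradiction.

A constant β exists at time 0 by compactness of M × M. -/

noncomputable section

namespace CurvatureFlow

/-! ### Second order jets of curves -/

section Jets

variable {V W : Type*} [NormedAddCommGroup V] [NormedSpace ℝ V]
  [NormedAddCommGroup W] [NormedSpace ℝ W]

/-- The curve `g` is twice differentiable at `0`, with value `a`, velocity `b` and acceleration
`c`. -/
def HasJet2 (g : ℝ → V) (a b c : V) : Prop :=
  g 0 = a ∧ ∃ g' : ℝ → V, (∀ᶠ s in 𝓝 0, HasDerivAt g (g' s) s) ∧ g' 0 = b ∧ HasDerivAt g' c 0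

namespace HasJet2

variable {g h : ℝ → V} {a b c a' b' c' : V}

lemma hasDerivAt (hg : HasJet2 g a b c) : HasDerivAt g b 0 := by
  obtain ⟨_, g', h1, h2, _⟩ := hg
  exact h2 ▸ h1.self_of_nhds

lemma congr (hg : HasJet2 g a b c) (hgh : h =ᶠ[𝓝 0] g) : HasJet2 h a b c := by
  obtain ⟨h0, g', h1, h2, h3⟩ := hg
  refine ⟨hgh.self_of_nhds.trans h0, g', ?_, h2, h3⟩
  filter_upwards [h1, hgh.eventuallyEq_nhds] with s hs hs'
  exact hs.congr_of_eventuallyEq hs'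

lemma congr_jet (hg : HasJet2 g a b c) (ha : a = a') (hb : b = b') (hc : c = c') :
    HasJet2 g a' b' c' := by
  subst ha hb hc; exact hg

lemma unique (hg : HasJet2 g a b c) (hg' : HasJet2 g a' b' c') : a = a' ∧ b = b' ∧ c = c' := by
  obtain ⟨h0, u, h1, h2, h3⟩ := hg
  obtain ⟨h0', u', h1', h2', h3'⟩ := hg'
  have huu : u =ᶠ[𝓝 0] u' := by
    filter_upwards [h1, h1'] with s hs hs' using hs.unique hs'
  refine ⟨h0.symm.trans h0', ?_, ?_⟩
  · rw [← h2, ← h2', huu.self_of_nhds]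
  · exact (h3.congr_of_eventuallyEq huu.symm).unique h3'

lemma const (a : V) : HasJet2 (fun _ => a) a 0 0 :=
  ⟨rfl, fun _ => 0, .of_forall fun s => hasDerivAt_const s a, rfl, hasDerivAt_const _ _⟩

lemma smul_id (a : V) : HasJet2 (fun s : ℝ => s • a) 0 a 0 :=
  ⟨by simp, fun _ => a, .of_forall fun s => by simpa using (hasDerivAt_id s).smul_const a, rfl,
    hasDerivAt_const _ _⟩

lemma add (hg : HasJet2 g a b c) (hh : HasJet2 h a' b' c') :
    HasJet2 (fun s => g s + h s) (a + a') (b + b') (c + c') := by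
  obtain ⟨h0, u, h1, h2, h3⟩ := hg
  obtain ⟨h0', u', h1', h2', h3'⟩ := hh
  refine ⟨by simp [h0, h0'], fun s => u s + u' s, ?_, by simp [h2, h2'], h3.add h3'⟩
  filter_upwards [h1, h1'] with s hs hs' using hs.add hs'

lemma neg (hg : HasJet2 g a b c) : HasJet2 (fun s => -g s) (-a) (-b) (-c) := by
  obtain ⟨h0, u, h1, h2, h3⟩ := hg
  refine ⟨by simp [h0], fun s => -u s, ?_, by simp [h2], h3.neg⟩
  filter_upwards [h1] with s hs using hs.neg

lemma sub (hg : HasJet2 g a b c) (hh : HasJet2 h a' b' c') :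
    HasJet2 (fun s => g s - h s) (a - a') (b - b') (c - c') := by
  simpa only [sub_eq_add_neg] using hg.add hh.neg

lemma sum {ι : Type*} (t : Finset ι) {g : ι → ℝ → V} {a b c : ι → V}
    (hg : ∀ i, HasJet2 (g i) (a i) (b i) (c i)) :
    HasJet2 (fun s => ∑ i ∈ t, g i s) (∑ i ∈ t, a i) (∑ i ∈ t, b i) (∑ i ∈ t, c i) := by
  classical
  induction t using Finset.induction_on with
  | empty => simpa using const (0 : V)
  | insert i t hi ih => simpa only [Finset.sum_insert hi] using (hg i).add ih

lemma smul {p : ℝ → ℝ} {p0 p1 p2 : ℝ} (hp : HasJet2 p p0 p1 p2) (hg : HasJet2 g a b c) :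
    HasJet2 (fun s => p s • g s) (p0 • a) (p0 • b + p1 • a)
      (p0 • c + (2 * p1) • b + p2 • a) := by
  obtain ⟨h0, u, h1, h2, h3⟩ := hg
  obtain ⟨h0', u', h1', h2', h3'⟩ := hp
  refine ⟨by simp [h0, h0'], fun s => p s • u s + u' s • g s, ?_, by simp [h0, h2, h0', h2'], ?_⟩
  · filter_upwards [h1, h1'] with s hs hs' using hs'.smul hs
  · have hd := (h1'.self_of_nhds.smul h3).add (h3'.smul h1.self_of_nhds)
    rw [h0, h2, h0', h2'] at hd
    refine hd.congr_deriv ?_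
    module

lemma mul {p q : ℝ → ℝ} {p0 p1 p2 q0 q1 q2 : ℝ} (hp : HasJet2 p p0 p1 p2)
    (hq : HasJet2 q q0 q1 q2) :
    HasJet2 (fun s => p s * q s) (p0 * q0) (p0 * q1 + p1 * q0)
      (p0 * q2 + 2 * p1 * q1 + p2 * q0) := by
  simpa only [smul_eq_mul] using hp.smul hq

lemma inner {V : Type*} [NormedAddCommGroup V] [InnerProductSpace ℝ V] {g h : ℝ → V}
    {a b c a' b' c' : V} (hg : HasJet2 g a b c) (hh : HasJet2 h a' b' c') :
    HasJet2 (fun s => Inner.inner ℝ (g s) (h s)) (Inner.inner ℝ a a')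
      (Inner.inner ℝ a b' + Inner.inner ℝ b a')
      (Inner.inner ℝ a c' + 2 * Inner.inner ℝ b b' + Inner.inner ℝ c a') := by
  obtain ⟨h0, u, h1, h2, h3⟩ := hg
  obtain ⟨h0', u', h1', h2', h3'⟩ := hh
  refine ⟨by simp [h0, h0'], fun s => Inner.inner ℝ (g s) (u' s) + Inner.inner ℝ (u s) (h s), ?_,
    by simp [h0, h2, h0', h2'], ?_⟩
  · filter_upwards [h1, h1'] with s hs hs' using hs.inner ℝ hs'
  · have hd := (h1.self_of_nhds.inner ℝ h3').add (h3.inner ℝ h1'.self_of_nhds)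
    rw [h0, h2, h0', h2'] at hd
    refine hd.congr_deriv ?_
    ring

lemma norm_sq {V : Type*} [NormedAddCommGroup V] [InnerProductSpace ℝ V] {g : ℝ → V}
    {a b c : V} (hg : HasJet2 g a b c) :
    HasJet2 (fun s => ‖g s‖ ^ 2) (‖a‖ ^ 2) (2 * Inner.inner ℝ a b)
      (2 * Inner.inner ℝ a c + 2 * ‖b‖ ^ 2) := by
  have := hg.inner hg
  simp only [real_inner_self_eq_norm_sq] at this
  refine this.congr_jet rfl ?_ ?_
  · rw [real_inner_comm b a]; ring
  · rw [real_inner_comm c a]; ring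

lemma comp {f : ℝ → ℝ} {p : ℝ → ℝ} {p0 p1 p2 : ℝ} (hp : HasJet2 p p0 p1 p2)
    (hf : ContDiffAt ℝ 2 f p0) :
    HasJet2 (fun s => f (p s)) (f p0) (deriv f p0 * p1)
      (deriv (deriv f) p0 * p1 ^ 2 + deriv f p0 * p2) := by
  obtain ⟨h0, u, h1, h2, h3⟩ := hp
  have hc : Tendsto p (𝓝 0) (𝓝 p0) := by
    rw [← h0]; exact h1.self_of_nhds.continuousAt
  have hf1 : ∀ᶠ x in 𝓝 p0, ContDiffAt ℝ 2 f x := hf.eventually (by simp)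
  have hd : HasDerivAt (deriv f) (deriv (deriv f) p0) p0 := by
    have : ContDiffAt ℝ 1 (deriv f) p0 := by
      exact (hf.fderiv_right (m := 1) (by norm_num)).clm_apply contDiffAt_const
    exact (this.differentiableAt (by simp)).hasDerivAt
  refine ⟨by simp [h0], fun s => deriv f (p s) * u s, ?_, by simp [h0, h2], ?_⟩
  · filter_upwards [h1, hc.eventually hf1] with s hs hs'
    exact (hs'.differentiableAt (by simp)).hasDerivAt.comp s hs
  · have hd' : HasDerivAt (fun s => deriv f (p s)) (deriv (deriv f) p0 * u 0) 0 := by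
      rw [← h0] at hd
      have := hd.comp 0 h1.self_of_nhds
      rw [h0] at this
      exact this
    have := hd'.mul h3
    rw [h0, h2] at this
    refine this.congr_deriv ?_
    ring

/-- Were the second derivative negative, 0 would be a local maximum as well as a local minimum, so p
would vanish near 0; uniqueness of jets then gives p2 = 0. -/
lemma nonneg_of_eventually_nonneg {p : ℝ → ℝ} {p1 p2 : ℝ} (hp : HasJet2 p 0 p1 p2)
    (hpos : ∀ᶠ s in 𝓝 0, 0 ≤ p s) : p1 = 0 ∧ 0 ≤ p2 := by
  have hmin : IsLocalMin p 0 := by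
    filter_upwards [hpos] with s hs; rwa [hp.1]
  have hp1 : p1 = 0 := hmin.hasDerivAt_eq_zero hp.hasDerivAt
  refine ⟨hp1, ?_⟩
  by_contra! hneg
  obtain ⟨h0, u, h1, h2, h3⟩ := hp
  have hu : deriv p =ᶠ[𝓝 0] u := by filter_upwards [h1] with s hs using hs.deriv
  have hmax : IsLocalMax p 0 := by
    refine isLocalMax_of_deriv_deriv_neg ?_ ?_ h1.self_of_nhds.continuousAt
    · rw [(h3.congr_of_eventuallyEq hu).deriv]; exact hneg
    · rw [hu.self_of_nhds, h2, hp1]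
  have hpz : p =ᶠ[𝓝 0] fun _ => 0 := by
    filter_upwards [hpos, hmax] with s hs hs'
    rw [h0] at hs'
    exact le_antisymm hs' hs
  have := (HasJet2.const (0:ℝ)).congr hpz
  have h4 := (unique ⟨h0, u, h1, h2, h3⟩ this).2.2
  linarith

end HasJet2

/-! ### Directional derivatives -/

/-- The directional derivative of `G` in the direction `v`, as a function of the point. -/
def dd (v : W) (G : W → V) : W → V := fun z => fderiv ℝ G z v

lemma contDiff_dd {k m : WithTop ℕ∞} (v : W) {G : W → V} (hG : ContDiff ℝ k G) (hm : m + 1 ≤ k) :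
    ContDiff ℝ m (dd v G) :=
  (hG.fderiv_right hm).clm_apply contDiff_const

lemma dd_comm_at (v u : W) {G : W → V} {z : W} (hG : ContDiffAt ℝ 2 G z) :
    dd v (dd u G) z = dd u (dd v G) z := by
  have hs : IsSymmSndFDerivAt ℝ G z := hG.isSymmSndFDerivAt (by simp)
  have hd : DifferentiableAt ℝ (fderiv ℝ G) z :=
    (hG.fderiv_right (m := 1) (by norm_num)).differentiableAt (by simp)
  have key : ∀ a b : W, dd a (dd b G) z = fderiv ℝ (fderiv ℝ G) z a b := by
    intro a b
    unfold dd
    rw [fderiv_clm_apply hd (differentiableAt_const _)]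
    simp
  rw [key, key, hs]

lemma dd_comm {k : WithTop ℕ∞} (v u : W) {G : W → V} (hG : ContDiff ℝ k G) (hk : 2 ≤ k) :
    dd v (dd u G) = dd u (dd v G) :=
  funext fun _ => dd_comm_at v u (hG.of_le hk).contDiffAt

lemma hasDerivAt_line {G : W → V} (hG : Differentiable ℝ G) (z v : W) (s : ℝ) :
    HasDerivAt (fun s : ℝ => G (z + s • v)) (dd v G (z + s • v)) s := by
  have h1 : HasDerivAt (fun s : ℝ => z + s • v) v s := by
    simpa using ((hasDerivAt_id s).smul_const v).const_add z
  exact (hG (z + s • v)).hasFDerivAt.comp_hasDerivAt s h1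

lemma HasJet2.line {k : WithTop ℕ∞} {G : W → V} (hG : ContDiff ℝ k G) (hk : 2 ≤ k) (z v : W) :
    HasJet2 (fun s : ℝ => G (z + s • v)) (G z) (dd v G z) (dd v (dd v G) z) := by
  have h2 : ContDiff ℝ 2 G := hG.of_le hk
  refine ⟨by simp, fun s => dd v G (z + s • v), .of_forall fun s =>
    hasDerivAt_line (h2.differentiable (by simp)) z v s, by simp, ?_⟩
  have := hasDerivAt_line ((contDiff_dd (m := 1) v h2 (by norm_num)).differentiable (by simp)) z v 0
  simpa using this

end Jets

/-! ### Graphs over a hyperplane -/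

section Graph

variable {n : ℕ}

/-- The area element `√(1 + |W|²)` of a graph with gradient `W`. -/
def areaElement (W : Fin n → ℝ) : ℝ := √(1 + ∑ j, W j ^ 2)

lemma areaElement_pos (W : Fin n → ℝ) : 0 < areaElement W :=
  Real.sqrt_pos.2 (by positivity)

lemma areaElement_sq (W : Fin n → ℝ) : areaElement W ^ 2 = 1 + ∑ j, W j ^ 2 :=
  Real.sq_sqrt (by positivity)

lemma areaElement_of_eq_zero {W : Fin n → ℝ} (hW : ∀ i, W i = 0) : areaElement W = 1 := by
  simp [areaElement, hW]

/-- The frame of a graph with gradient `W` which is orthonormal for the metric `1 + W ⊗ W`. -/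
def graphFrame (W : Fin n → ℝ) (i j : Fin n) : ℝ :=
  (if i = j then 1 else 0) - (areaElement W * (1 + areaElement W))⁻¹ * (W i * W j)

/-- The matrix `graphFrame W` is (1 + W ⊗ W)^(-1/2): it is the identity on the complement of W and 1
- (J²-1)/(J(1+J)) = 1/J along W, while the metric is J² there. -/
lemma graphFrame_orthonormal (W : Fin n → ℝ) (i j : Fin n) :
    ∑ k, graphFrame W i k * graphFrame W j k +
      (∑ k, graphFrame W i k * W k) * (∑ k, graphFrame W j k * W k) = if i = j then 1 else 0 := by
  set J := areaElement W with hJ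
  have hJ0 : 0 < J := areaElement_pos W
  set c := (J * (1 + J))⁻¹ with hc
  have hr : ∑ k, W k ^ 2 = J ^ 2 - 1 := by rw [hJ, areaElement_sq]; ring
  have h1 : ∀ i, ∑ k, graphFrame W i k * W k = W i - c * W i * (J ^ 2 - 1) := by
    intro i
    simp only [graphFrame, sub_mul, Finset.sum_sub_distrib, ite_mul, one_mul, zero_mul,
      Finset.sum_ite_eq, Finset.mem_univ, if_true]
    rw [← hr, Finset.mul_sum]
    congr 1
    exact Finset.sum_congr rfl fun k _ => by ring
  have h2 : ∑ k, graphFrame W i k * graphFrame W j k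
      = (if i = j then 1 else 0) - 2 * c * W i * W j + c ^ 2 * W i * W j * (J ^ 2 - 1) := by
    have : ∀ k, graphFrame W i k * graphFrame W j k = (if i = k then (if j = k then 1 else 0) else 0)
        - (if i = k then c * W j * W k else 0) - (if j = k then c * W i * W k else 0)
        + c ^ 2 * W i * W j * W k ^ 2 := by
      intro k
      simp only [graphFrame, ← hJ, ← hc]
      split_ifs <;> ring
    simp only [this, Finset.sum_add_distrib, Finset.sum_sub_distrib, Finset.sum_ite_eq,
      Finset.mem_univ, if_true, ← Finset.mul_sum, hr]
    simp only [eq_comm (a := j) (b := i)]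
    ring
  rw [h1, h1, h2]
  have : c * (J * (1 + J)) = 1 := by rw [hc]; field_simp
  clear_value c J
  linear_combination (W i * W j) * (c * J * (J - 1) - 1) * this

/-- The weighted trace `∑ aᵢ h(vᵢ,vᵢ)` of the second fundamental form of a graph with gradient `W`
and Hessian `H` with respect to the weights `a` and the orthonormal frame `graphFrame`. -/
def weightedTrace (a W : Fin n → ℝ) (H : Fin n → Fin n → ℝ) : ℝ :=
  ∑ i, a i * (-(∑ j, ∑ k, graphFrame W i j * graphFrame W i k * H j k) * (areaElement W)⁻¹)

section OneVariable

variable {a κ q r : Fin n → ℝ} {A B : Fin n → Fin n → ℝ} {W : Fin n → ℝ → ℝ}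
  {H : Fin n → Fin n → ℝ → ℝ}

lemma jet_normSq (hW : ∀ j, HasJet2 (W j) 0 (q j) (r j)) :
    HasJet2 (fun s => ∑ j, W j s ^ 2) 0 0 (2 * ∑ j, q j ^ 2) := by
  have := HasJet2.sum Finset.univ fun j => (hW j).mul (hW j)
  simp only [← pow_two] at this
  refine this.congr_jet (by simp) (by simp) ?_
  rw [Finset.mul_sum]
  exact Finset.sum_congr rfl fun j _ => by ring

lemma contDiffAt_sqrt_one_add : ContDiffAt ℝ 2 (fun x : ℝ => √(1 + x)) 0 :=
  (contDiffAt_const.add contDiffAt_id).sqrt (by norm_num)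

lemma deriv_sqrt_one_add : HasDerivAt (fun x : ℝ => √(1 + x)) (1 / 2) 0 := by
  have := ((hasDerivAt_id (0 : ℝ)).const_add 1).sqrt (by norm_num)
  simpa using this

lemma jet_areaElement (hW : ∀ j, HasJet2 (W j) 0 (q j) (r j)) :
    HasJet2 (fun s => areaElement fun j => W j s) 1 0 (∑ j, q j ^ 2) := by
  have := (jet_normSq hW).comp contDiffAt_sqrt_one_add
  rw [deriv_sqrt_one_add.deriv] at this
  exact this.congr_jet (by simp) (by simp) (by ring)

lemma jet_areaElement_inv (hW : ∀ j, HasJet2 (W j) 0 (q j) (r j)) :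
    HasJet2 (fun s => (areaElement fun j => W j s)⁻¹) 1 0 (-∑ j, q j ^ 2) := by
  have hd : HasDerivAt (fun x : ℝ => x⁻¹) (-1) 1 := by
    simpa using hasDerivAt_inv (one_ne_zero' ℝ)
  have := (jet_areaElement hW).comp (f := fun x => x⁻¹) (contDiffAt_inv ℝ one_ne_zero)
  rw [hd.deriv] at this
  exact this.congr_jet (by simp) (by simp) (by ring)

/-- The frame differs from the identity by a term quadratic in W, and W vanishes at the base point,
so there is no first order term; J(1+J) = 2 there. -/
lemma jet_graphFrame (hW : ∀ j, HasJet2 (W j) 0 (q j) (r j)) (i j : Fin n) :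
    HasJet2 (fun s => graphFrame (fun j => W j s) i j) (if i = j then 1 else 0) 0 (-(q i * q j)) := by
  have hJ := jet_areaElement hW
  have hJ1 := (HasJet2.const (1 : ℝ)).add hJ
  have hc := (hJ.mul hJ1).comp (f := fun x => x⁻¹) (contDiffAt_inv ℝ (by norm_num))
  have := (HasJet2.const (if i = j then (1 : ℝ) else 0)).sub (hc.mul ((hW i).mul (hW j)))
  exact this.congr_jet (by simp) (by simp) (by norm_num; ring)

/-- The second order corrections to the trace of the Hessian are 2qᵢ²κᵢ from the rotation of the
frame and κᵢ|q|² from the inverse area element. -/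
lemma jet_weightedTrace (hW : ∀ j, HasJet2 (W j) 0 (q j) (r j))
    (hH : ∀ i j, HasJet2 (H i j) (if i = j then -κ i else 0) (A i j) (B i j)) :
    HasJet2 (fun s => weightedTrace a (fun j => W j s) fun i j => H i j s)
      (∑ i, a i * κ i) (-∑ i, a i * A i i)
      (-∑ i, a i * (B i i + 2 * q i ^ 2 * κ i + κ i * ∑ j, q j ^ 2)) := by
  have hv := jet_graphFrame hW
  have hJ := jet_areaElement_inv hW
  have hD : ∀ i, HasJet2 (fun s => ∑ j, ∑ k, graphFrame (fun j => W j s) i j *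
      graphFrame (fun j => W j s) i k * H j k s) (-κ i) (A i i) (B i i + 2 * q i ^ 2 * κ i) := by
    intro i
    refine (HasJet2.sum Finset.univ fun j => HasJet2.sum Finset.univ fun k =>
      ((hv i j).mul (hv i k)).mul (hH j k)).congr_jet ?_ ?_ ?_
    · simp [Finset.sum_ite_eq]
    · simp [Finset.sum_ite_eq]
    · simp only [Finset.sum_add_distrib, ite_mul, mul_ite, mul_zero, zero_mul, one_mul, mul_one,
        add_mul, Finset.sum_ite_eq, Finset.mem_univ, if_true, add_zero, zero_add]
      simp
      ring
  refine (HasJet2.sum Finset.univ fun i => (HasJet2.const (a i)).mul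
    (((hD i).neg).mul hJ)).congr_jet ?_ ?_ ?_
  · simp
  · simp
  · refine Eq.trans (Finset.sum_congr rfl fun i _ => ?_) (Finset.sum_neg_distrib _)
    ring

end OneVariable

end Graph

/-! ### Evolution inequality for the speed, and the maximum principle on the diagonal -/

section Evolution

variable {n : ℕ}

/-- The spatial coordinate directions of `ℝⁿ × ℝ`. -/
def xDir (i : Fin n) : EuclideanSpace ℝ (Fin n) × ℝ := (EuclideanSpace.single i 1, 0)

/-- The time direction of `ℝⁿ × ℝ`. -/
def tDir (n : ℕ) : EuclideanSpace ℝ (Fin n) × ℝ := (0, 1)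

@[simp] lemma xDir_snd (i : Fin n) : (xDir i).2 = 0 := rfl

@[simp] lemma tDir_snd : (tDir n).2 = 1 := rfl

@[simp] lemma tDir_fst : (tDir n).1 = 0 := rfl

@[simp] lemma xDir_fst (i : Fin n) : (xDir i).1 = EuclideanSpace.single i 1 := rfl

lemma tendsto_line {P : Type*} [NormedAddCommGroup P] [NormedSpace ℝ P] (p v : P) :
    Tendsto (fun s : ℝ => p + s • v) (𝓝 0) (𝓝 p) := by
  have : Continuous fun s : ℝ => p + s • v := by fun_prop
  simpa using this.tendsto 0

/-- The spatial gradient of `w`. -/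
def grad (w : EuclideanSpace ℝ (Fin n) × ℝ → ℝ) (z : EuclideanSpace ℝ (Fin n) × ℝ) : Fin n → ℝ :=
  fun i => dd (xDir i) w z

/-- The spatial Hessian of `w`. -/
def hess (w : EuclideanSpace ℝ (Fin n) × ℝ → ℝ) (z : EuclideanSpace ℝ (Fin n) × ℝ) :
    Fin n → Fin n → ℝ :=
  fun i j => dd (xDir i) (dd (xDir j) w) z

/-- The function `w` represents near `p` a family of hypersurfaces evolving as graphs over their
tangent hyperplane at `p` in an orthonormal frame of principal directions. The function `F` is the
speed function; the weights `a` define a linear functional which touches it from below at `p`. -/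
structure IsGraphFlow (a κ : Fin n → ℝ) (Ψ : ℝ → ℝ) (w F : EuclideanSpace ℝ (Fin n) × ℝ → ℝ)
    (p : EuclideanSpace ℝ (Fin n) × ℝ) : Prop where
  contDiff_w : ContDiff ℝ 4 w
  contDiff_F : ContDiff ℝ 2 F
  F_pos : 0 < F p
  w_eq_zero : w p = 0
  grad_eq_zero : ∀ i, grad w p i = 0
  hess_eq : ∀ i j, hess w p i j = if i = j then -κ i else 0
  F_eq : F p = ∑ i, a i * κ i
  flow : ∀ᶠ z in 𝓝 p, dd (tDir n) w z = -Ψ (F z) * areaElement (grad w z)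
  support : ∀ᶠ z in 𝓝 p, weightedTrace a (grad w z) (hess w z) ≤ F z

namespace IsGraphFlow

variable {a κ : Fin n → ℝ} {Ψ : ℝ → ℝ} {w F : EuclideanSpace ℝ (Fin n) × ℝ → ℝ}
  {p : EuclideanSpace ℝ (Fin n) × ℝ}

lemma contDiff_grad (h : IsGraphFlow a κ Ψ w F p) (i : Fin n) :
    ContDiff ℝ 3 (dd (xDir i) w) := contDiff_dd _ h.contDiff_w (by norm_num)

lemma contDiff_hess (h : IsGraphFlow a κ Ψ w F p) (i j : Fin n) :
    ContDiff ℝ 2 (dd (xDir i) (dd (xDir j) w)) := contDiff_dd _ (h.contDiff_grad j) (by norm_num)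

lemma jet_grad (h : IsGraphFlow a κ Ψ w F p) (v : EuclideanSpace ℝ (Fin n) × ℝ) (j : Fin n) :
    HasJet2 (fun s : ℝ => grad w (p + s • v) j) 0 (dd v (dd (xDir j) w) p)
      (dd v (dd v (dd (xDir j) w)) p) :=
  (HasJet2.line (h.contDiff_grad j) (by norm_num) p v).congr_jet (h.grad_eq_zero j) rfl rfl

lemma jet_hess (h : IsGraphFlow a κ Ψ w F p) (v : EuclideanSpace ℝ (Fin n) × ℝ) (i j : Fin n) :
    HasJet2 (fun s : ℝ => hess w (p + s • v) i j) (if i = j then -κ i else 0)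
      (dd v (dd (xDir i) (dd (xDir j) w)) p) (dd v (dd v (dd (xDir i) (dd (xDir j) w))) p) :=
  (HasJet2.line (h.contDiff_hess i j) le_rfl p v).congr_jet (h.hess_eq i j) rfl rfl

lemma jet_F (h : IsGraphFlow a κ Ψ w F p) (v : EuclideanSpace ℝ (Fin n) × ℝ) :
    HasJet2 (fun s : ℝ => F (p + s • v)) (F p) (dd v F p) (dd v (dd v F) p) :=
  HasJet2.line h.contDiff_F le_rfl p v

/-- F minus the weighted trace is nonnegative near p and zero at p, so its derivative vanishes and
its second derivative is nonnegative. This replaces differentiation of f(κ). -/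
lemma dd_F (h : IsGraphFlow a κ Ψ w F p) (v : EuclideanSpace ℝ (Fin n) × ℝ) :
    dd v F p = -∑ i, a i * dd v (dd (xDir i) (dd (xDir i) w)) p ∧
    -∑ i, a i * (dd v (dd v (dd (xDir i) (dd (xDir i) w))) p
      + 2 * dd v (dd (xDir i) w) p ^ 2 * κ i + κ i * ∑ j, dd v (dd (xDir j) w) p ^ 2)
      ≤ dd v (dd v F) p := by
  have h1 := (h.jet_F v).sub (jet_weightedTrace (a := a) (fun j => h.jet_grad v j)
    (fun i j => h.jet_hess v i j))
  rw [← h.F_eq, sub_self] at h1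
  have h2 := h1.nonneg_of_eventually_nonneg (by
    filter_upwards [(tendsto_line p v).eventually h.support] with s hs
    exact sub_nonneg.2 hs)
  exact ⟨by linarith [h2.1], by linarith [h2.2]⟩

lemma hess_dd (h : IsGraphFlow a κ Ψ w F p) (i j : Fin n) :
    dd (xDir i) (dd (xDir j) w) p = if i = j then -κ i else 0 := h.hess_eq i j

/-- The spatial jets of the speed `Ψ(F)`. -/
lemma jet_speed (h : IsGraphFlow a κ Ψ w F p) (hΨ : ContDiffOn ℝ 2 Ψ (Ioi 0))
    (v : EuclideanSpace ℝ (Fin n) × ℝ) :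
    HasJet2 (fun s : ℝ => Ψ (F (p + s • v))) (Ψ (F p)) (deriv Ψ (F p) * dd v F p)
      (deriv (deriv Ψ) (F p) * dd v F p ^ 2 + deriv Ψ (F p) * dd v (dd v F) p) :=
  (h.jet_F v).comp (hΨ.contDiffAt (Ioi_mem_nhds h.F_pos))

/-- The graph equation is differentiated in space and the derivatives are commuted; the term Ψκᵢ² is
the second derivative of the area element. -/
lemma dd_time (h : IsGraphFlow a κ Ψ w F p) (hΨ : ContDiffOn ℝ 2 Ψ (Ioi 0)) (i : Fin n) :
    dd (tDir n) (dd (xDir i) w) p = -(deriv Ψ (F p) * dd (xDir i) F p) ∧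
    dd (tDir n) (dd (xDir i) (dd (xDir i) w)) p =
      -(deriv (deriv Ψ) (F p) * dd (xDir i) F p ^ 2 + deriv Ψ (F p) * dd (xDir i) (dd (xDir i) F) p
        + Ψ (F p) * κ i ^ 2) := by
  have c1 : dd (tDir n) (dd (xDir i) w) = dd (xDir i) (dd (tDir n) w) :=
    dd_comm _ _ h.contDiff_w (by norm_num)
  have c2 : dd (tDir n) (dd (xDir i) (dd (xDir i) w)) = dd (xDir i) (dd (xDir i) (dd (tDir n) w)) := by
    rw [dd_comm _ _ (h.contDiff_grad i) (by norm_num), c1]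
  have h1 := HasJet2.line (contDiff_dd (m := 3) (tDir n) h.contDiff_w (by norm_num)) (by norm_num) p
    (xDir i)
  have h2 := ((h.jet_speed hΨ (xDir i)).neg).mul (jet_areaElement fun j => h.jet_grad (xDir i) j)
  have h3 := h1.unique (h2.congr (by
    filter_upwards [(tendsto_line p (xDir i)).eventually h.flow] with s hs using hs))
  rw [c1, c2]
  refine ⟨by simpa using h3.2.1, ?_⟩
  rw [h3.2.2]
  simp only [h.hess_dd, ite_pow, neg_sq]
  simp

lemma dd_time_w (h : IsGraphFlow a κ Ψ w F p) : dd (tDir n) w p = -Ψ (F p) := by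
  have := h.flow.self_of_nhds
  rwa [areaElement_of_eq_zero h.grad_eq_zero, mul_one] at this

/-- The evolution inequality `∂ₜF ≥ Ψ'(F) ∑ aᵢ (Fᵢᵢ + F κᵢ²)` at the base point. -/
lemma evolution (h : IsGraphFlow a κ Ψ w F p) (hΨ : ContDiffOn ℝ 2 Ψ (Ioi 0)) (ha : ∀ i, 0 ≤ a i)
    (h1 : deriv Ψ (F p) * F p ≤ Ψ (F p)) (h2 : 0 ≤ deriv (deriv Ψ) (F p)) :
    deriv Ψ (F p) * ∑ i, a i * (dd (xDir i) (dd (xDir i) F) p + F p * κ i ^ 2)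
      ≤ dd (tDir n) F p := by
  rw [(h.dd_F (tDir n)).1, ← Finset.sum_neg_distrib, Finset.mul_sum]
  refine Finset.sum_le_sum fun i _ => ?_
  rw [(h.dd_time hΨ i).2]
  -- Two nonnegative contributions are discarded: the one with Ψ'', and (Ψ - Ψ'F)κᵢ².
  have e1 : 0 ≤ a i * (deriv (deriv Ψ) (F p) * dd (xDir i) F p ^ 2) :=
    mul_nonneg (ha i) (mul_nonneg h2 (sq_nonneg _))
  have e2 : a i * κ i ^ 2 * (deriv Ψ (F p) * F p) ≤ a i * κ i ^ 2 * Ψ (F p) :=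
    mul_le_mul_of_nonneg_left h1 (mul_nonneg (ha i) (sq_nonneg _))
  nlinarith

end IsGraphFlow

/-- At a first touching time only the past is controlled, so the sign comes from backward difference
quotients. -/
lemma HasJet2.nonpos_of_eventually_left {g : ℝ → ℝ} {b : ℝ} (hg : HasDerivAt g b 0) (h0 : g 0 = 0)
    (hpos : ∀ᶠ s in 𝓝 (0 : ℝ), s ≤ 0 → 0 ≤ g s) : b ≤ 0 := by
  have h1 : HasDerivWithinAt g b (Iio 0) 0 := hg.hasDerivWithinAt
  rw [hasDerivWithinAt_iff_tendsto_slope' (by simp)] at h1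
  refine le_of_tendsto h1 ?_
  have h2 : ∀ᶠ s in 𝓝[<] (0 : ℝ), s ≤ 0 → 0 ≤ g s := hpos.filter_mono nhdsWithin_le_nhds
  filter_upwards [h2, self_mem_nhdsWithin] with s hs hs'
  have hs'' : s < 0 := hs'
  rw [slope_def_field, h0]
  exact div_nonpos_of_nonneg_of_nonpos (by linarith [hs hs''.le]) (by linarith)

/-- The function `(β + ε (1 + t)) F`. -/
def barrier (β ε : ℝ) (F : EuclideanSpace ℝ (Fin n) × ℝ → ℝ) (z : EuclideanSpace ℝ (Fin n) × ℝ) :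
    ℝ := (β + ε * (1 + z.2)) * F z

namespace IsGraphFlow

variable {a κ : Fin n → ℝ} {Ψ : ℝ → ℝ} {w F : EuclideanSpace ℝ (Fin n) × ℝ → ℝ}
  {p : EuclideanSpace ℝ (Fin n) × ℝ} {β ε : ℝ}

lemma jet_barrier_x (h : IsGraphFlow a κ Ψ w F p) (i : Fin n) :
    HasJet2 (fun s : ℝ => barrier β ε F (p + s • xDir i)) (barrier β ε F p)
      ((β + ε * (1 + p.2)) * dd (xDir i) F p)
      ((β + ε * (1 + p.2)) * dd (xDir i) (dd (xDir i) F) p) := by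
  have := (HasJet2.const (β + ε * (1 + p.2))).mul (h.jet_F (xDir i))
  simpa [barrier] using this

lemma jet_barrier_t (h : IsGraphFlow a κ Ψ w F p) :
    HasDerivAt (fun s : ℝ => barrier β ε F (p + s • tDir n))
      (ε * F p + (β + ε * (1 + p.2)) * dd (tDir n) F p) 0 := by
  have h1 : HasDerivAt (fun s : ℝ => β + ε * (1 + (p.2 + s))) ε 0 := by
    have := (((hasDerivAt_id (0:ℝ)).const_add p.2).const_add 1).const_mul ε |>.const_add β
    simpa using this
  have h2 := h1.mul (h.jet_F (tDir n)).hasDerivAt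
  simp only [zero_smul, add_zero] at h2
  refine h2.congr_of_eventuallyEq (.of_forall fun s => ?_)
  simp [barrier]

/-- A first time at which the smallest principal curvature reaches the barrier does not exist. -/
lemma not_touching_diagonal (h : IsGraphFlow a κ Ψ w F p) (hΨ : ContDiffOn ℝ 2 Ψ (Ioi 0))
    (ha : ∀ i, 0 ≤ a i) (h0 : 0 < deriv Ψ (F p)) (h1 : deriv Ψ (F p) * F p ≤ Ψ (F p))
    (h2 : 0 ≤ deriv (deriv Ψ) (F p)) (hε : 0 < ε) (hθ : 0 < β + ε * (1 + p.2))
    (hQ : ∀ᶠ z in 𝓝 p, z.2 ≤ p.2 → ∀ m, 0 ≤ -hess w z m m * (areaElement (grad w z))⁻¹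
      + barrier β ε F z * (1 + grad w z m ^ 2))
    {m : Fin n} (hm : κ m = -barrier β ε F p) : False := by
  set θ := β + ε * (1 + p.2) with hθ'
  set φ := barrier β ε F p with hφ
  have hφ' : φ = θ * F p := rfl
  -- second variation in the direction `xDir i`
  have hx : ∀ i, 0 ≤ -dd (xDir i) (dd (xDir i) (dd (xDir m) (dd (xDir m) w))) p - κ m * κ i ^ 2
      + θ * dd (xDir i) (dd (xDir i) F) p + (if i = m then 2 * φ * κ m ^ 2 else 0) := by
    intro i
    have hg := h.jet_grad (xDir i) m
    have hJ := (((h.jet_hess (xDir i) m m).neg).mul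
      (jet_areaElement_inv fun j => h.jet_grad (xDir i) j)).add
      ((h.jet_barrier_x (β := β) (ε := ε) i).mul ((HasJet2.const 1).add (hg.mul hg)))
    have hz := (hJ.congr_jet (a' := 0) (by simp [hm, hφ]) rfl rfl).nonneg_of_eventually_nonneg (by
      filter_upwards [(tendsto_line p (xDir i)).eventually hQ] with s hs
      have := hs (by simp) m
      rw [pow_two] at this
      exact this)
    have h3 := hz.2
    simp only [h.hess_dd] at h3
    have h4 : ∑ j : Fin n, (if i = j then -κ i else 0) ^ 2 = κ i ^ 2 := by
      simp [ite_pow]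
    rw [h4] at h3
    -- For i = m the metric coefficient 1 + w_m² contributes the extra term 2φκ_m².
    by_cases him : i = m
    · subst him
      simp at h3 ⊢
      linarith
    · simp [him] at h3 ⊢
      linarith
  -- first variation in time
  have ht : -dd (tDir n) (dd (xDir m) (dd (xDir m) w)) p + (ε * F p + θ * dd (tDir n) F p) ≤ 0 := by
    have hg := (h.jet_grad (tDir n) m)
    have hd := ((((h.jet_hess (tDir n) m m).neg).mul
      (jet_areaElement_inv fun j => h.jet_grad (tDir n) j)).hasDerivAt).add
      ((h.jet_barrier_t (β := β) (ε := ε)).mul ((HasJet2.const 1).add (hg.mul hg)).hasDerivAt)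
    have hz := HasJet2.nonpos_of_eventually_left hd ?_ ?_
    · simp [h.grad_eq_zero] at hz
      linarith
    · simp [h.grad_eq_zero, h.hess_eq, hm, areaElement, hφ]
    · filter_upwards [(tendsto_line p (tDir n)).eventually hQ] with s hs hs'
      have := hs (by simpa using hs') m
      rw [pow_two] at this
      exact this
  rw [(h.dd_time hΨ m).2] at ht
  have hF := (h.dd_F (xDir m)).2
  have hev := h.evolution hΨ ha h1 h2
  -- the second derivatives of the Hessian commute
  have hc : ∀ i, dd (xDir m) (dd (xDir m) (dd (xDir i) (dd (xDir i) w))) p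
      = dd (xDir i) (dd (xDir i) (dd (xDir m) (dd (xDir m) w))) p := by
    intro i
    have e1 : dd (xDir m) (dd (xDir i) w) = dd (xDir i) (dd (xDir m) w) :=
      dd_comm _ _ h.contDiff_w (by norm_num)
    rw [dd_comm (xDir m) (xDir i) (h.contDiff_grad i) (by norm_num), e1,
      dd_comm (xDir m) (xDir i) (h.contDiff_hess i m) le_rfl,
      dd_comm (xDir m) (xDir i) (h.contDiff_grad m) (by norm_num)]
  -- The second variations bound the fourth derivatives of w in `hF`. For i = m the frame correction
  -- 2κ_m³ cancels the metric term 2φκ_m², because κ_m = -φ.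
  have hF2 : -∑ i, a i * (θ * dd (xDir i) (dd (xDir i) F) p + φ * κ i ^ 2)
      - κ m ^ 2 * F p ≤ dd (xDir m) (dd (xDir m) F) p := by
    refine le_trans ?_ hF
    rw [h.F_eq, Finset.mul_sum, ← Finset.sum_neg_distrib, ← Finset.sum_neg_distrib,
      ← Finset.sum_sub_distrib]
    refine Finset.sum_le_sum fun i _ => ?_
    have e1 := mul_le_mul_of_nonneg_left (hx i) (ha i)
    have h4 : ∑ j : Fin n, (if m = j then -κ m else 0) ^ 2 = κ m ^ 2 := by
      simp [ite_pow]
    rw [hc]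
    simp only [h.hess_dd, h4]
    by_cases him : i = m
    · subst him
      simp at e1 ⊢
      rw [hm] at e1 ⊢
      linarith
    · have him' : ¬ m = i := fun h => him h.symm
      simp [him, him'] at e1 ⊢
      rw [hm] at e1 ⊢
      linarith
  -- After multiplication by Ψ' and θ the sums over i cancel, leaving Ψ''F_m² + κ_m²(Ψ - Ψ'F) + εF ≤
  -- 0, although the last term is positive and the others are nonnegative.
  have e3 := mul_le_mul_of_nonneg_left hF2 h0.le
  have e4 := mul_le_mul_of_nonneg_left hev hθ.le
  have e5 : 0 ≤ deriv (deriv Ψ) (F p) * dd (xDir m) F p ^ 2 := mul_nonneg h2 (sq_nonneg _)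
  have e6 : 0 < ε * F p := mul_pos hε h.F_pos
  have e7 : 0 ≤ κ m ^ 2 * (Ψ (F p) - deriv Ψ (F p) * F p) :=
    mul_nonneg (sq_nonneg _) (by linarith)
  have e8 : θ * ∑ i, a i * (dd (xDir i) (dd (xDir i) F) p + F p * κ i ^ 2)
      = ∑ i, a i * (θ * dd (xDir i) (dd (xDir i) F) p + φ * κ i ^ 2) := by
    rw [Finset.mul_sum, hφ']
    exact Finset.sum_congr rfl fun i _ => by ring
  rw [show θ * (deriv Ψ (F p) * ∑ i, a i * (dd (xDir i) (dd (xDir i) F) p + F p * κ i ^ 2))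
    = deriv Ψ (F p) * (θ * ∑ i, a i * (dd (xDir i) (dd (xDir i) F) p + F p * κ i ^ 2)) by ring,
    e8] at e4
  nlinarith

end IsGraphFlow

end Evolution

/-! ### The two-point maximum principle off the diagonal -/

section TwoPoint

variable {n : ℕ} {V : Type*} [NormedAddCommGroup V] [InnerProductSpace ℝ V]

/-- The displacement `∑ zᵢ bᵢ + w(z) ν` of a point of a graph from its base point. -/
def graphPoint (b : Fin n → V) (ν : V) (w : EuclideanSpace ℝ (Fin n) × ℝ → ℝ)
    (z : EuclideanSpace ℝ (Fin n) × ℝ) : V := ∑ j, z.1 j • b j + w z • ν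

/-- The upward unit normal of a graph. -/
def graphNormal (b : Fin n → V) (ν : V) (w : EuclideanSpace ℝ (Fin n) × ℝ → ℝ)
    (z : EuclideanSpace ℝ (Fin n) × ℝ) : V :=
  (areaElement (grad w z))⁻¹ • (ν - ∑ j, grad w z j • b j)

lemma jet_graphPoint (b : Fin n → V) (ν : V) {w : EuclideanSpace ℝ (Fin n) × ℝ → ℝ}
    (hw : ContDiff ℝ 4 w) {p : EuclideanSpace ℝ (Fin n) × ℝ} (hp : p.1 = 0) (hwp : w p = 0)
    (v : EuclideanSpace ℝ (Fin n) × ℝ) :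
    HasJet2 (fun s : ℝ => graphPoint b ν w (p + s • v)) 0 (∑ j, v.1 j • b j + dd v w p • ν)
      (dd v (dd v w) p • ν) := by
  have h1 := HasJet2.smul_id (∑ j, v.1 j • b j)
  have h2 := (HasJet2.line hw (by norm_num) p v).smul (HasJet2.const ν)
  refine ((h1.add h2).congr (.of_forall fun s => ?_)).congr_jet ?_ ?_ ?_
  · simp [graphPoint, hp, Finset.smul_sum, mul_smul]
  · simp [hwp]
  · simp
  · simp

lemma jet_graphNormal (b : Fin n → V) (ν : V) {w : EuclideanSpace ℝ (Fin n) × ℝ → ℝ}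
    (hw : ContDiff ℝ 4 w) {p : EuclideanSpace ℝ (Fin n) × ℝ} (hg : ∀ i, grad w p i = 0)
    (v : EuclideanSpace ℝ (Fin n) × ℝ) :
    HasJet2 (fun s : ℝ => graphNormal b ν w (p + s • v)) ν (-∑ j, dd v (dd (xDir j) w) p • b j)
      (-(∑ j, dd v (dd (xDir j) w) p ^ 2) • ν - ∑ j, dd v (dd v (dd (xDir j) w)) p • b j) := by
  have hj : ∀ j, HasJet2 (fun s : ℝ => grad w (p + s • v) j) 0 (dd v (dd (xDir j) w) p)
      (dd v (dd v (dd (xDir j) w)) p) := fun j =>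
    (HasJet2.line (contDiff_dd (m := 3) (xDir j) hw (by norm_num)) (by norm_num) p v).congr_jet
      (hg j) rfl rfl
  refine ((jet_areaElement_inv hj).smul ((HasJet2.const ν).sub (HasJet2.sum Finset.univ fun j =>
    (hj j).smul (HasJet2.const (b j))))).congr_jet ?_ ?_ ?_
  · simp
  · simp
  · simp
    abel

/-- The two-point function `2⟨D,N⟩ + φ|D|²`. -/
def twoPoint (φ : ℝ) (D N : V) : ℝ := 2 * inner ℝ D N + φ * ‖D‖ ^ 2

lemma jet_twoPoint {φ : ℝ → ℝ} {D N : ℝ → V} {φ0 φ1 φ2 : ℝ} {D0 D1 D2 N0 N1 N2 : V}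
    (hφ : HasJet2 φ φ0 φ1 φ2) (hD : HasJet2 D D0 D1 D2) (hN : HasJet2 N N0 N1 N2) :
    HasJet2 (fun s => twoPoint (φ s) (D s) (N s)) (twoPoint φ0 D0 N0)
      (2 * (inner ℝ D0 N1 + inner ℝ D1 N0) + (φ0 * (2 * inner ℝ D0 D1) + φ1 * ‖D0‖ ^ 2))
      (2 * (inner ℝ D0 N2 + 2 * inner ℝ D1 N1 + inner ℝ D2 N0) +
        (φ0 * (2 * inner ℝ D0 D2 + 2 * ‖D1‖ ^ 2) + 2 * φ1 * (2 * inner ℝ D0 D1)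
          + φ2 * ‖D0‖ ^ 2)) := by
  refine (((HasJet2.const (2 : ℝ)).mul (hD.inner hN)).add (hφ.mul hD.norm_sq)).congr_jet rfl ?_ ?_
  · simp
  · simp

lemma hasDerivAt_twoPoint {φ : ℝ → ℝ} {D N : ℝ → V} {φ0 φ1 : ℝ} {D0 D1 N0 N1 : V}
    (hφ : HasDerivAt φ φ1 0) (hD : HasDerivAt D D1 0) (hN : HasDerivAt N N1 0)
    (hφ0 : φ 0 = φ0) (hD0 : D 0 = D0) (hN0 : N 0 = N0) :
    HasDerivAt (fun s => twoPoint (φ s) (D s) (N s))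
      (2 * (inner ℝ D0 N1 + inner ℝ D1 N0) + (φ0 * (2 * inner ℝ D0 D1) + φ1 * ‖D0‖ ^ 2)) 0 := by
  subst hφ0 hD0 hN0
  refine (((hD.inner ℝ hN).const_mul 2).add (hφ.mul hD.norm_sq)).congr_deriv ?_
  ring

variable {a κ : Fin n → ℝ} {Ψ : ℝ → ℝ} {w F w' : EuclideanSpace ℝ (Fin n) × ℝ → ℝ}
  {p : EuclideanSpace ℝ (Fin n) × ℝ} {β ε F' : ℝ} {b b' : Fin n → V} {ν ν' D : V}

/-- A first time at which the two-point function vanishes off the diagonal does not exist. -/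
lemma IsGraphFlow.not_touching_offDiagonal (h : IsGraphFlow a κ Ψ w F p) (hp : p.1 = 0)
    (hΨ : ContDiffOn ℝ 2 Ψ (Ioi 0)) (ha : ∀ i, 0 ≤ a i) (h0 : 0 < deriv Ψ (F p))
    (h1 : deriv Ψ (F p) * F p ≤ Ψ (F p)) (h2 : 0 ≤ deriv (deriv Ψ) (F p)) (hε : 0 < ε)
    (hθ : 0 < β + ε * (1 + p.2))
    (hbν : ∀ i, inner ℝ (b i) ν = (0 : ℝ)) (hν : ‖ν‖ = 1) (hD : D ≠ 0)
    (hν' : ν' = ν + barrier β ε F p • D)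
    (hb' : ∀ i, b' i = b i - (2 * inner ℝ D (b i) / ‖D‖ ^ 2) • D)
    (hw' : ContDiff ℝ 4 w') (hw'0 : w' p = 0) (hw'1 : ∀ i, grad w' p i = 0)
    (hsupp : ∑ i, a i * -hess w' p i i ≤ F') (hflow : dd (tDir n) w' p = -Ψ F')
    (hconv : deriv Ψ (F p) * (F' - F p) ≤ Ψ F' - Ψ (F p))
    (hκ : ∀ i, -barrier β ε F p ≤ κ i)
    (hZ0 : twoPoint (barrier β ε F p) D ν = 0)
    (hZ : ∀ᶠ q in 𝓝 (p, p), q.1.2 = q.2.2 → q.1.2 ≤ p.2 →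
      0 ≤ twoPoint (barrier β ε F q.1) (D + graphPoint b ν w q.1 - graphPoint b' ν' w' q.2)
        (graphNormal b ν w q.1)) : False := by
  set θ := β + ε * (1 + p.2) with hθ'
  set φ := barrier β ε F p with hφ
  have hφ' : φ = θ * F p := rfl
  set d := ‖D‖ ^ 2 with hd
  have hd0 : 0 < d := by positivity
  set c : Fin n → ℝ := fun i => inner ℝ D (b i) with hc
  have hνν : inner ℝ ν ν = (1 : ℝ) := by rw [real_inner_self_eq_norm_sq, hν]; norm_num
  have hDν : inner ℝ D ν = -φ * d / 2 := by
    simp only [twoPoint] at hZ0; linarith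
  have hDD : inner ℝ D D = d := real_inner_self_eq_norm_sq D
  have hDν' : inner ℝ D ν' = φ * d / 2 := by
    rw [hν', inner_add_right, inner_smul_right, hDν, hDD]; ring
  have hν'ν : inner ℝ ν' ν = 1 - φ ^ 2 * d / 2 := by
    rw [hν', inner_add_left, inner_smul_left, hDν, hνν]; simp; ring
  have hDc : ∀ i, inner ℝ D (b i) = c i := fun i => rfl
  -- the curves
  have hX : ∀ i, HasJet2 (fun s : ℝ => graphPoint b ν w (p + s • xDir i)) 0 (b i) (-κ i • ν) := by
    intro i
    refine (jet_graphPoint b ν h.contDiff_w hp h.w_eq_zero (xDir i)).congr_jet rfl ?_ ?_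
    · have : dd (xDir i) w p = 0 := h.grad_eq_zero i
      simp [this]
    · rw [h.hess_dd, if_pos rfl]
  have hY : ∀ i, HasJet2 (fun s : ℝ => graphPoint b' ν' w' (p + s • xDir i)) 0 (b' i)
      (hess w' p i i • ν') := by
    intro i
    refine (jet_graphPoint b' ν' hw' hp hw'0 (xDir i)).congr_jet rfl ?_ rfl
    have : dd (xDir i) w' p = 0 := hw'1 i
    simp [this]
  have hN : ∀ i, HasJet2 (fun s : ℝ => graphNormal b ν w (p + s • xDir i)) ν (κ i • b i)
      (-κ i ^ 2 • ν - ∑ j, dd (xDir i) (dd (xDir i) (dd (xDir j) w)) p • b j) := by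
    intro i
    refine (jet_graphNormal b ν h.contDiff_w h.grad_eq_zero (xDir i)).congr_jet rfl ?_ ?_
    · simp [h.hess_dd]
    · simp [h.hess_dd, ite_pow]
  have htq : ∀ v v' : EuclideanSpace ℝ (Fin n) × ℝ,
      Tendsto (fun s : ℝ => (p + s • v, p + s • v')) (𝓝 0) (𝓝 (p, p)) := fun v v' =>
    (tendsto_line p v).prodMk_nhds (tendsto_line p v')
  have hZ0' : twoPoint φ (D + 0 - 0) ν = 0 := by simpa using hZ0
  -- first variation of `x`
  have hx1 : ∀ i, θ * dd (xDir i) F p * d = -2 * (κ i + φ) * c i := by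
    intro i
    have hj := (jet_twoPoint (h.jet_barrier_x (β := β) (ε := ε) i)
      (((HasJet2.const D).add (hX i)).sub (HasJet2.const 0)) (hN i))
    have := ((hj.congr_jet hZ0' rfl rfl).nonneg_of_eventually_nonneg (by
      filter_upwards [(htq (xDir i) 0).eventually hZ] with s hs
      have := hs (by simp) (by simp)
      simpa [graphPoint, hp, hw'0] using this)).1
    simp only [add_zero, zero_add, sub_zero, inner_smul_right, hbν, hDc] at this
    linarith
  -- second variation
  have hx2 : ∀ i, 0 ≤ κ i ^ 2 * φ * d
      - 2 * ∑ j, dd (xDir i) (dd (xDir i) (dd (xDir j) w)) p * c j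
      - 2 * κ i + 2 * (-hess w' p i i) + κ i * φ ^ 2 * d
      + θ * dd (xDir i) (dd (xDir i) F) p * d := by
    intro i
    have hj := (jet_twoPoint (h.jet_barrier_x (β := β) (ε := ε) i)
      (((HasJet2.const D).add (hX i)).sub (hY i)) (hN i))
    have h3 := ((hj.congr_jet hZ0' rfl rfl).nonneg_of_eventually_nonneg (by
      filter_upwards [(htq (xDir i) (xDir i)).eventually hZ] with s hs
      exact hs (by simp) (by simp))).2
    -- Now x moves along bᵢ and y along its reflection; the velocity of the displacement is then
    -- parallel to D, which is the reason for the choice of b'.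
    have hD1 : (0 : V) + b i - b' i = (2 * c i / d) • D := by rw [hb', zero_add, sub_sub_cancel]
    have hnD : ‖(2 * c i / d) • D‖ ^ 2 = (2 * c i / d) ^ 2 * d := by
      rw [norm_smul, mul_pow, ← hd, Real.norm_eq_abs, sq_abs]
    rw [hD1, hnD] at h3
    have i1 : inner ℝ D (-κ i ^ 2 • ν - ∑ j, dd (xDir i) (dd (xDir i) (dd (xDir j) w)) p • b j)
        = κ i ^ 2 * (φ * d / 2) - ∑ j, dd (xDir i) (dd (xDir i) (dd (xDir j) w)) p * c j := by
      simp only [inner_sub_right, inner_smul_right, inner_sum, hDν, hDc]; ring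
    have i2 : inner ℝ ((2 * c i / d) • D) (κ i • b i) = κ i * (2 * c i / d) * c i := by
      rw [real_inner_smul_left, inner_smul_right, hDc]; ring
    have i3 : inner ℝ (-κ i • ν - hess w' p i i • ν') ν
        = -κ i - hess w' p i i * (1 - φ ^ 2 * d / 2) := by
      rw [inner_sub_left, real_inner_smul_left, real_inner_smul_left, hνν, hν'ν]; ring
    have i4 : inner ℝ D (-κ i • ν - hess w' p i i • ν')
        = κ i * (φ * d / 2) - hess w' p i i * (φ * d / 2) := by
      rw [inner_sub_right, inner_smul_right, inner_smul_right, hDν, hDν']; ring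
    have i5 : inner ℝ D ((2 * c i / d) • D) = 2 * c i / d * d := by
      rw [inner_smul_right, hDD]
    simp only [add_zero, zero_add, sub_zero] at h3
    rw [i1, i2, i3, i4, i5, ← hd, ← hφ, ← hθ'] at h3
    have e1 : (2 * c i / d) * d = 2 * c i := by field_simp
    -- By the first variation, the terms quadratic in cᵢ add up to -2(κᵢ+φ)(2cᵢ/d)²d. They may be
    -- dropped since κᵢ ≥ -φ.
    have e2 : 0 ≤ (κ i + φ) * (2 * c i / d) * (2 * c i / d) * d := by
      have : 0 ≤ (κ i + φ) := by linarith [hκ i]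
      have : 0 ≤ (κ i + φ) * ((2 * c i / d) ^ 2 * d) := by positivity
      linarith
    have e3 := hx1 i
    set y := 2 * c i / d with hy
    have e4 : c i = y * d / 2 := by linarith
    have e5 : θ * dd (xDir i) F p = -(κ i + φ) * y := by
      rw [e4] at e3
      have : (θ * dd (xDir i) F p + (κ i + φ) * y) * d = 0 := by linarith
      have := (mul_eq_zero.1 this).resolve_right hd0.ne'
      linarith
    have e6 : κ i * y * c i = κ i * y * y * d / 2 := by rw [e4]; ring
    rw [e5, e6] at h3
    linarith
  -- first variation in time
  have ht : 2 * deriv Ψ (F p) * ∑ j, dd (xDir j) F p * c j - 2 * Ψ (F p) + 2 * Ψ F'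
      + (ε * F p + θ * dd (tDir n) F p) * d + φ ^ 2 * d * Ψ (F p) ≤ 0 := by
    have hXt : HasDerivAt (fun s : ℝ => D + graphPoint b ν w (p + s • tDir n)
        - graphPoint b' ν' w' (p + s • tDir n)) (-Ψ (F p) • ν - -Ψ F' • ν') 0 := by
      refine (((jet_graphPoint b ν h.contDiff_w hp h.w_eq_zero (tDir n)).hasDerivAt.const_add D).sub
        (jet_graphPoint b' ν' hw' hp hw'0 (tDir n)).hasDerivAt).congr_deriv ?_
      rw [hflow, h.dd_time_w]
      simp
    have hNt : HasDerivAt (fun s : ℝ => graphNormal b ν w (p + s • tDir n))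
        (deriv Ψ (F p) • ∑ j, dd (xDir j) F p • b j) 0 := by
      refine (jet_graphNormal b ν h.contDiff_w h.grad_eq_zero (tDir n)).hasDerivAt.congr_deriv ?_
      rw [Finset.smul_sum, ← Finset.sum_neg_distrib]
      refine Finset.sum_congr rfl fun j _ => ?_
      rw [(h.dd_time hΨ j).1, neg_smul, neg_neg, mul_smul]
    have hd1 := hasDerivAt_twoPoint (h.jet_barrier_t (β := β) (ε := ε)) hXt hNt (φ0 := φ) (D0 := D)
      (N0 := ν) (by simp [hφ]) (by simp [graphPoint, hp, h.w_eq_zero, hw'0])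
      (by simp [graphNormal, areaElement, h.grad_eq_zero])
    have hz := HasJet2.nonpos_of_eventually_left hd1 ?_ ?_
    · have i1 : inner ℝ D (deriv Ψ (F p) • ∑ j, dd (xDir j) F p • b j)
          = deriv Ψ (F p) * ∑ j, dd (xDir j) F p * c j := by
        simp only [inner_smul_right, inner_sum, hDc]
      have i2 : inner ℝ (-Ψ (F p) • ν - -Ψ F' • ν') ν
          = -Ψ (F p) + Ψ F' * (1 - φ ^ 2 * d / 2) := by
        rw [inner_sub_left, real_inner_smul_left, real_inner_smul_left, hνν, hν'ν]; ring
      have i3 : inner ℝ D (-Ψ (F p) • ν - -Ψ F' • ν')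
          = Ψ (F p) * (φ * d / 2) + Ψ F' * (φ * d / 2) := by
        rw [inner_sub_right, inner_smul_right, inner_smul_right, hDν, hDν']; ring
      rw [i1, i2, i3, ← hd] at hz
      linarith
    · simp [graphPoint, hp, h.w_eq_zero, hw'0, graphNormal, areaElement, h.grad_eq_zero, ← hφ, hZ0]
    · filter_upwards [(htq (tDir n) (tDir n)).eventually hZ] with s hs hs'
      exact hs rfl (by simpa using hs')
  -- summation
  have hsum : 0 ≤ d * ∑ i, a i * (θ * dd (xDir i) (dd (xDir i) F) p + φ * κ i ^ 2)
      + 2 * ∑ j, dd (xDir j) F p * c j - 2 * F p + 2 * F' + φ ^ 2 * d * F p := by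
    have e1 : 0 ≤ ∑ i, a i * (κ i ^ 2 * φ * d
      - 2 * ∑ j, dd (xDir i) (dd (xDir i) (dd (xDir j) w)) p * c j
      - 2 * κ i + 2 * (-hess w' p i i) + κ i * φ ^ 2 * d
      + θ * dd (xDir i) (dd (xDir i) F) p * d) :=
      Finset.sum_nonneg fun i _ => mul_nonneg (ha i) (hx2 i)
    -- Commuting derivatives plays the part of the Codazzi equation: the weighted third derivatives
    -- of w form the gradient of F.
    have e2 : ∀ j, dd (xDir j) F p = -∑ i, a i * dd (xDir i) (dd (xDir i) (dd (xDir j) w)) p := by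
      intro j
      rw [(h.dd_F (xDir j)).1]
      congr 1
      refine Finset.sum_congr rfl fun i _ => ?_
      rw [dd_comm (xDir j) (xDir i) (h.contDiff_grad i) (by norm_num),
        dd_comm (xDir j) (xDir i) h.contDiff_w (by norm_num)]
    have e3 : ∑ j, dd (xDir j) F p * c j
        = -∑ i, a i * ∑ j, dd (xDir i) (dd (xDir i) (dd (xDir j) w)) p * c j := by
      simp only [e2, Finset.mul_sum, neg_mul, Finset.sum_neg_distrib, Finset.sum_mul]
      rw [Finset.sum_comm]
      simp only [mul_assoc]
    have e4 : ∑ i, a i * (κ i ^ 2 * φ * d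
      - 2 * ∑ j, dd (xDir i) (dd (xDir i) (dd (xDir j) w)) p * c j
      - 2 * κ i + 2 * (-hess w' p i i) + κ i * φ ^ 2 * d
      + θ * dd (xDir i) (dd (xDir i) F) p * d)
      = d * ∑ i, a i * (θ * dd (xDir i) (dd (xDir i) F) p + φ * κ i ^ 2)
      - 2 * ∑ i, a i * ∑ j, dd (xDir i) (dd (xDir i) (dd (xDir j) w)) p * c j
      - 2 * ∑ i, a i * κ i + 2 * ∑ i, a i * (-hess w' p i i) + φ ^ 2 * d * ∑ i, a i * κ i := by
      simp only [Finset.mul_sum (s := Finset.univ) (a := d), Finset.mul_sum (s := Finset.univ) (a := (2:ℝ)),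
        Finset.mul_sum (s := Finset.univ) (a := φ ^ 2 * d), ← Finset.sum_add_distrib,
        ← Finset.sum_sub_distrib]
      exact Finset.sum_congr rfl fun i _ => by simp only [← Finset.mul_sum]; ring
    rw [e4, ← h.F_eq] at e1
    linarith
  have hev := mul_le_mul_of_nonneg_left (h.evolution hΨ ha h1 h2) hθ.le
  have e8 : θ * ∑ i, a i * (dd (xDir i) (dd (xDir i) F) p + F p * κ i ^ 2)
      = ∑ i, a i * (θ * dd (xDir i) (dd (xDir i) F) p + φ * κ i ^ 2) := by
    rw [Finset.mul_sum, hφ']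
    exact Finset.sum_congr rfl fun i _ => by ring
  rw [show θ * (deriv Ψ (F p) * ∑ i, a i * (dd (xDir i) (dd (xDir i) F) p + F p * κ i ^ 2))
    = deriv Ψ (F p) * (θ * ∑ i, a i * (dd (xDir i) (dd (xDir i) F) p + F p * κ i ^ 2)) by ring,
    e8] at hev
  set S := ∑ i, a i * (θ * dd (xDir i) (dd (xDir i) F) p + φ * κ i ^ 2)
  set G := ∑ j, dd (xDir j) F p * c j
  -- The time inequality dominates Ψ' times the summed second variation, up to the gain from
  -- convexity of Ψ at F' and F, the gain φ²d(Ψ - Ψ'F), and the strictly positive term εFd.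
  have f1 := mul_le_mul_of_nonneg_left hev hd0.le
  have f2 := mul_nonneg h0.le hsum
  have f3 : 0 ≤ φ ^ 2 * d * (Ψ (F p) - deriv Ψ (F p) * F p) :=
    mul_nonneg (by positivity) (by linarith)
  have f4 : 0 < ε * F p * d := mul_pos (mul_pos hε h.F_pos) hd0
  linarith

end TwoPoint

/-! ### Convex speed functions -/

section Speed

variable {n : ℕ} {Γ : Set (Fin n → ℝ)} {f : (Fin n → ℝ) → ℝ}

lemma hasDerivAt_nonneg_of_eventually_right {g : ℝ → ℝ} {b : ℝ} (hg : HasDerivAt g b 0)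
    (h0 : g 0 = 0) (hpos : ∀ᶠ s in 𝓝[>] (0 : ℝ), 0 ≤ g s) : 0 ≤ b := by
  have h1 : HasDerivWithinAt g b (Ioi 0) 0 := hg.hasDerivWithinAt
  rw [hasDerivWithinAt_iff_tendsto_slope' (by simp)] at h1
  refine ge_of_tendsto h1 ?_
  filter_upwards [hpos, self_mem_nhdsWithin] with s hs hs'
  rw [slope_def_field, h0]
  exact div_nonneg (by simpa using hs) (by simpa using (le_of_lt hs' : (0:ℝ) ≤ s))

lemma IsAdmissibleSpeed.differentiableAt (hf : IsAdmissibleSpeed Γ f) {l : Fin n → ℝ}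
    (hl : l ∈ Γ) : DifferentiableAt ℝ f l :=
  (hf.smooth.contDiffAt (hf.isOpen_cone.mem_nhds hl)).differentiableAt (by simp)

/-- A convex speed function has at every point a supporting linear functional with nonnegative
coefficients. -/
lemma IsAdmissibleSpeed.exists_weights (hf : IsAdmissibleSpeed Γ f) (hc : ConvexOn ℝ Γ f)
    {k : Fin n → ℝ} (hk : k ∈ Γ) :
    ∃ a : Fin n → ℝ, (∀ i, 0 ≤ a i) ∧ f k = ∑ i, a i * k i ∧ ∀ l ∈ Γ, ∑ i, a i * l i ≤ f l := by
  set L := fderiv ℝ f k with hL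
  have hd : HasFDerivAt f L k := (hf.differentiableAt hk).hasFDerivAt
  have hLsum : ∀ l : Fin n → ℝ, L l = ∑ i, L (Pi.single i 1) * l i := by
    intro l
    conv_lhs => rw [← Finset.univ_sum_single l, map_sum]
    refine Finset.sum_congr rfl fun i _ => ?_
    rw [show Pi.single i (l i) = l i • (Pi.single i 1 : Fin n → ℝ) by
      rw [← Pi.single_smul]; simp, map_smul, smul_eq_mul, mul_comm]
  have hline : ∀ v : Fin n → ℝ, HasDerivAt (fun s : ℝ => f (k + s • v)) (L v) 0 := by
    intro v
    have h1 : HasDerivAt (fun s : ℝ => k + s • v) v 0 := by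
      simpa using ((hasDerivAt_id (0:ℝ)).smul_const v).const_add k
    have hd' : HasFDerivAt f L (k + (0:ℝ) • v) := by simpa using hd
    exact hd'.comp_hasDerivAt 0 h1
  -- Euler's identity: by homogeneity the tangent hyperplane of f at k passes through the origin, so
  -- the supporting functional has no constant term.
  have heuler : L k = f k := by
    have h1 := hline k
    have h2 : HasDerivAt (fun s : ℝ => (1 + s) * f k) (f k) 0 := by
      simpa using ((hasDerivAt_id (0:ℝ)).const_add 1).mul_const (f k)
    refine h1.unique (h2.congr_of_eventuallyEq ?_)
    filter_upwards [eventually_gt_nhds (show (-1 : ℝ) < 0 by norm_num)] with s hs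
    rw [← hf.homogeneous (1 + s) (by linarith) k hk, add_smul, one_smul]
  refine ⟨fun i => L (Pi.single i 1), fun i => ?_, ?_, fun l hl => ?_⟩
  · have h1 := (hline (Pi.single i 1)).sub_const (f k)
    refine hasDerivAt_nonneg_of_eventually_right h1 (by simp) ?_
    have hopen : ∀ᶠ s in 𝓝[>] (0:ℝ), k + s • (Pi.single i 1 : Fin n → ℝ) ∈ Γ :=
      ((tendsto_line k _).eventually (hf.isOpen_cone.mem_nhds hk)).filter_mono nhdsWithin_le_nhds
    filter_upwards [hopen, self_mem_nhdsWithin] with s hs hs'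
    have hs'' : (0:ℝ) < s := hs'
    have he : k + s • (Pi.single i 1 : Fin n → ℝ) = Function.update k i (k i + s) := by
      ext j
      by_cases hj : j = i
      · subst hj; simp
      · simp [hj]
    rw [he] at hs ⊢
    exact sub_nonneg.2 (hf.increasing k hk i _ (by linarith) hs)
  · rw [← heuler, hLsum]
  · rw [← hLsum]
    have h1 := hline (l - k)
    have h2 : HasDerivAt (fun s : ℝ => (1 - s) * f k + s * f l - f (k + s • (l - k)))
        (-1 * f k + 1 * f l - L (l - k)) 0 :=
      ((((hasDerivAt_id (0:ℝ)).const_sub 1).mul_const (f k)).add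
        ((hasDerivAt_id (0:ℝ)).mul_const (f l))).sub h1
    have h3 := hasDerivAt_nonneg_of_eventually_right h2 (by simp) (by
      filter_upwards [Ioo_mem_nhdsGT (show (0:ℝ) < 1 by norm_num)] with s hs
      have := hc.2 hk hl (show 0 ≤ 1 - s by linarith [hs.2]) hs.1.le (by ring)
      rw [show (1 - s) • k + s • l = k + s • (l - k) by module] at this
      simp only [smul_eq_mul] at this
      linarith)
    rw [map_sub, heuler] at h3
    linarith

/-- Birkhoff's theorem: a doubly stochastic matrix is a convex combination of permutation matrices.
-/
lemma exists_perm_combination {κ μ : Fin n → ℝ} {S : Matrix (Fin n) (Fin n) ℝ}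
    (hS : S ∈ doublyStochastic ℝ (Fin n)) (hμ : ∀ i, μ i = ∑ j, S i j * κ j) :
    ∃ c : Equiv.Perm (Fin n) → ℝ, (∀ σ, 0 ≤ c σ) ∧ ∑ σ, c σ = 1 ∧ μ = ∑ σ, c σ • (κ ∘ σ) := by
  obtain ⟨c, h0, h1, h2⟩ := exists_eq_sum_perm_of_mem_doublyStochastic hS
  refine ⟨c, h0, h1, ?_⟩
  ext i
  rw [hμ, ← h2]
  simp [Matrix.sum_apply, Finset.sum_mul, Equiv.Perm.permMatrix, PEquiv.toMatrix_apply]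
  rw [Finset.sum_comm]
  simp [eq_comm]

/-- Averaging the arguments by a doubly stochastic matrix does not increase a convex speed. -/
lemma IsAdmissibleSpeed.comp_doublyStochastic_le (hf : IsAdmissibleSpeed Γ f)
    (hc : ConvexOn ℝ Γ f) {κ μ : Fin n → ℝ} (hκ : κ ∈ Γ) {S : Matrix (Fin n) (Fin n) ℝ}
    (hS : S ∈ doublyStochastic ℝ (Fin n)) (hμ : ∀ i, μ i = ∑ j, S i j * κ j) :
    μ ∈ Γ ∧ f μ ≤ f κ := by
  obtain ⟨c, h0, h1, rfl⟩ := exists_perm_combination hS hμ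
  have hm : ∀ σ ∈ (Finset.univ : Finset (Equiv.Perm (Fin n))), κ ∘ ⇑σ ∈ Γ := fun σ _ => hf.perm_mem σ κ hκ
  -- Convexity of Γ gives membership; Jensen's inequality applies with all the values f(κ ∘ σ) equal
  -- to f(κ).
  refine ⟨hc.1.sum_mem (fun σ _ => h0 σ) h1 hm, ?_⟩
  refine (hc.map_sum_le (fun σ _ => h0 σ) h1 hm).trans ?_
  simp only [hf.symmetric _ κ hκ, smul_eq_mul, ← Finset.sum_mul, h1, one_mul, le_refl]

end Speed

/-! ### Principal frames -/

section Frames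

variable {n : ℕ} {V : Type*} [NormedAddCommGroup V] [InnerProductSpace ℝ V]
  {B N : EuclideanSpace ℝ (Fin n) →ₗ[ℝ] V}

/-- The vectors `vᵢ` form an orthonormal frame of principal directions. -/
structure IsPrincipalFrame (B N : EuclideanSpace ℝ (Fin n) →ₗ[ℝ] V) (κ : Fin n → ℝ)
    (v : Fin n → EuclideanSpace ℝ (Fin n)) : Prop where
  orthonormal : ∀ i j, inner ℝ (B (v i)) (B (v j)) = if i = j then (1 : ℝ) else 0
  eigen : ∀ i, N (v i) = κ i • B (v i)

/-- Two sorted lists that are permutations of each other agree. The list has length n, so the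
default value of `getD` is never used. -/
lemma eq_comp_sort {e : Fin n → ℝ} {l : List ℝ} (hl : l.Pairwise (· ≤ ·))
    (he : l.Perm (List.ofFn e)) : (fun i : Fin n => l.getD i 0) = e ∘ Tuple.sort e := by
  have h1 : (List.ofFn (e ∘ Tuple.sort e)).Pairwise (· ≤ ·) :=
    (Tuple.monotone_sort e).sortedLE_ofFn.pairwise
  have h2 : (List.ofFn (e ∘ Tuple.sort e)).Perm (List.ofFn e) := Equiv.Perm.ofFn_comp_perm _ e
  have h3 : l = List.ofFn (e ∘ Tuple.sort e) := (he.trans h2.symm).eq_of_pairwise' hl h1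
  ext i
  simp [h3]

/-- The Weingarten map is symmetric for the first fundamental form, not for the Euclidean product of
the chart. Conjugating it to the range of B, with the ambient inner product, makes the spectral
theorem available and preserves the characteristic polynomial. -/
lemma exists_isPrincipalFrame (hB : Function.Injective B)
    (hsymm : ∀ u v, inner ℝ (N u) (B v) = inner ℝ (B u) (N v))
    (hrange : ∀ u, N u ∈ LinearMap.range B) :
    ∃ v, IsPrincipalFrame B N
      (fun i => ((B.leftInverse ∘ₗ N).charpoly.roots.sort (· ≤ ·)).getD i 0) v := by
  set W := B.leftInverse ∘ₗ N with hW
  have hBW : ∀ u, B (W u) = N u := by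
    intro u
    obtain ⟨v, hv⟩ := hrange u
    rw [hW, LinearMap.comp_apply, ← hv, LinearMap.leftInverse_apply_of_inj (LinearMap.ker_eq_bot.2 hB)]
  set e := LinearEquiv.ofInjective B hB with he
  have hbe : ∀ y : LinearMap.range B, B (e.symm y) = y := fun y => by
    rw [← LinearEquiv.ofInjective_apply (h := hB)]; simp [he]
  have hfin : Module.finrank ℝ (LinearMap.range B) = n := by
    rw [← e.finrank_eq]; simp
  set T : LinearMap.range B →ₗ[ℝ] LinearMap.range B := e.conj W with hT'
  have hTc : ∀ y, (T y : V) = N (e.symm y) := by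
    intro y
    rw [hT', LinearEquiv.conj_apply, ← hBW]
    simp [he]
  have hT : T.IsSymmetric := by
    intro y z
    rw [Submodule.coe_inner, Submodule.coe_inner, hTc, hTc, ← hbe y, ← hbe z, hbe z]
    have := hsymm (e.symm y) (e.symm z)
    rw [hbe z] at this
    rw [this]
  have hchar : W.charpoly = T.charpoly := (LinearEquiv.charpoly_conj e W).symm
  set ev := hT.eigenvalues hfin with hev
  have hperm : (W.charpoly.roots.sort (· ≤ ·)).Perm (List.ofFn ev) := by
    rw [← Multiset.coe_eq_coe, Multiset.sort_eq, hchar, hT.roots_charpoly_eq_eigenvalues hfin,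
      Fin.univ_val_map]
    rfl
  have hκ := eq_comp_sort (Multiset.pairwise_sort _ _) hperm
  rw [hκ]
  set bas := hT.eigenvectorBasis hfin
  refine ⟨fun i => e.symm (bas (Tuple.sort ev i)), fun i j => ?_, fun i => ?_⟩
  · rw [hbe, hbe, ← Submodule.coe_inner, orthonormal_iff_ite.1 bas.orthonormal]
    simp
  · rw [← hTc, hbe, hT.apply_eigenvectorBasis]
    rfl

namespace IsPrincipalFrame

variable {κ : Fin n → ℝ} {v : Fin n → EuclideanSpace ℝ (Fin n)}

lemma linearIndependent (h : IsPrincipalFrame B N κ v) : LinearIndependent ℝ v := by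
  refine LinearIndependent.of_comp B (Orthonormal.linearIndependent ?_)
  rw [orthonormal_iff_ite]
  exact h.orthonormal

lemma eq_sum (h : IsPrincipalFrame B N κ v) (u : EuclideanSpace ℝ (Fin n)) :
    u = ∑ j, (inner ℝ (B (v j)) (B u) : ℝ) • v j := by
  have hspan : ⊤ ≤ Submodule.span ℝ (Set.range v) := by
    rw [h.linearIndependent.span_eq_top_of_card_eq_finrank' (by simp)]
  have hu : u ∈ Submodule.span ℝ (Set.range v) := hspan trivial
  obtain ⟨c, hc⟩ := (Submodule.mem_span_range_iff_exists_fun ℝ).1 hu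
  have : ∀ j, inner ℝ (B (v j)) (B u) = c j := by
    intro j
    rw [← hc, map_sum, inner_sum]
    simp [inner_smul_right, h.orthonormal]
  simp only [this, hc]

lemma inner_map (h : IsPrincipalFrame B N κ v) (u u' : EuclideanSpace ℝ (Fin n)) :
    inner ℝ (B u) (B u') = ∑ j, inner ℝ (B (v j)) (B u) * inner ℝ (B (v j)) (B u') := by
  conv_lhs => rw [h.eq_sum u, map_sum, sum_inner]
  exact Finset.sum_congr rfl fun j _ => by rw [map_smul, real_inner_smul_left]

lemma inner_second (h : IsPrincipalFrame B N κ v) (u u' : EuclideanSpace ℝ (Fin n)) :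
    inner ℝ (N u) (B u') = ∑ j, κ j * (inner ℝ (B (v j)) (B u) * inner ℝ (B (v j)) (B u')) := by
  conv_lhs => rw [h.eq_sum u, map_sum, sum_inner]
  refine Finset.sum_congr rfl fun j _ => ?_
  rw [map_smul, h.eigen, real_inner_smul_left, real_inner_smul_left]; ring

/-- The Schur-Horn inequality for a convex speed function. -/
lemma weighted_trace_le (h : IsPrincipalFrame B N κ v) {Γ : Set (Fin n → ℝ)}
    {f : (Fin n → ℝ) → ℝ} (hf : IsAdmissibleSpeed Γ f) (hc : ConvexOn ℝ Γ f) (hκ : κ ∈ Γ)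
    {a : Fin n → ℝ} (ha : ∀ l ∈ Γ, ∑ i, a i * l i ≤ f l) {u : Fin n → EuclideanSpace ℝ (Fin n)}
    (hu : ∀ i j, inner ℝ (B (u i)) (B (u j)) = if i = j then (1 : ℝ) else 0) :
    ∑ i, a i * inner ℝ (N (u i)) (B (u i)) ≤ f κ := by
  -- With zero second form every orthonormal frame is principal, so the Parseval identity
  -- `inner_map` also applies to u and gives the column sums.
  have hu' : IsPrincipalFrame B 0 0 u := ⟨hu, by simp⟩
  -- Squared entries of the orthogonal change of frame: the diagonal entries of the second form are
  -- S applied to κ.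
  set S : Matrix (Fin n) (Fin n) ℝ := fun i j => inner ℝ (B (v j)) (B (u i)) ^ 2 with hS
  have hSd : S ∈ doublyStochastic ℝ (Fin n) := by
    rw [mem_doublyStochastic_iff_sum]
    refine ⟨fun i j => sq_nonneg _, fun i => ?_, fun j => ?_⟩
    · have := h.inner_map (u i) (u i)
      rw [hu, if_pos rfl] at this
      simp only [hS, pow_two, ← this]
    · have := hu'.inner_map (v j) (v j)
      rw [h.orthonormal, if_pos rfl] at this
      simp only [hS, pow_two]
      rw [this]
      exact Finset.sum_congr rfl fun i _ => by rw [real_inner_comm]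
  obtain ⟨hm, hle⟩ := hf.comp_doublyStochastic_le hc (μ := fun i => inner ℝ (N (u i)) (B (u i)))
    hκ hSd fun i => by
      rw [h.inner_second]
      exact Finset.sum_congr rfl fun j _ => by simp only [hS]; ring
  exact (ha _ hm).trans hle

end IsPrincipalFrame

end Frames

/-! ### Immersions and time dependent maps in charts -/

section Charts

variable {n : ℕ} {M : Type*} [TopologicalSpace M] [ChartedSpace (EuclideanSpace ℝ (Fin n)) M]
  [IsManifold (𝓡 n) ∞ M]

omit [IsManifold (𝓡 n) ∞ M] in
-- In the normal form of an immersion, the projection g onto the first factor satisfies g ∘ Y =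
-- chart, so the inverse chart composed with g is a differentiable local left inverse of Y.
lemma differential_injective {Y : M → EuclideanSpace ℝ (Fin (n + 1))} {x : M}
    (h : Manifold.IsImmersionAt (𝓡 n) (𝓡 (n + 1)) ∞ Y x) :
    Function.Injective (differential Y x) := by
  set φ := h.domChart.extend (𝓡 n) with hφ
  set g : EuclideanSpace ℝ (Fin (n + 1)) → EuclideanSpace ℝ (Fin n) :=
    fun z => (h.equiv.symm (h.codChart.extend (𝓡 (n + 1)) z)).1 with hg
  have hgd : MDifferentiableAt (𝓡 (n + 1)) 𝓘(ℝ, EuclideanSpace ℝ (Fin n)) g (Y x) := by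
    have h1 : MDifferentiableAt (𝓡 (n + 1)) 𝓘(ℝ, EuclideanSpace ℝ (Fin (n + 1)))
        (h.codChart.extend (𝓡 (n + 1))) (Y x) :=
      ((OpenPartialHomeomorph.contMDiffOn_extend h.codChart_mem_maximalAtlas).contMDiffAt
        (h.codChart.open_source.mem_nhds h.mem_codChart_source)).mdifferentiableAt (by simp)
    have h2 : DifferentiableAt ℝ (fun z => (h.equiv.symm z).1) (h.codChart.extend (𝓡 (n + 1)) (Y x)) := by
      fun_prop
    exact h2.mdifferentiableAt.comp (Y x) h1
  have hφd : MDifferentiableAt 𝓘(ℝ, EuclideanSpace ℝ (Fin n)) (𝓡 n) φ.symm (φ x) := by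
    have h1 := contMDiffOn_extend_symm (I := 𝓡 n) (n := ∞) h.domChart_mem_maximalAtlas
    refine (h1.contMDiffAt ?_).mdifferentiableAt (by simp)
    simpa [hφ] using h.domChart.open_target.mem_nhds (h.domChart.map_source h.mem_domChart_source)
  have hYd : MDifferentiableAt (𝓡 n) (𝓡 (n + 1)) Y x := h.contMDiffAt.mdifferentiableAt (by simp)
  have hgY : ∀ y ∈ h.domChart.source, g (Y y) = φ y := by
    intro y hy
    have hy' : φ y ∈ φ.target := φ.map_source (by simpa [hφ] using hy)
    have := h.writtenInCharts hy'
    simp only [Function.comp_apply] at this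
    rw [← hφ, φ.left_inv (by simpa [hφ] using hy)] at this
    simp only [hg]
    rw [this, ContinuousLinearEquiv.symm_apply_apply]
  have hgx : g (Y x) = φ x := hgY x h.mem_domChart_source
  have hid : (φ.symm ∘ (g ∘ Y)) =ᶠ[𝓝 x] id := by
    filter_upwards [h.domChart.open_source.mem_nhds h.mem_domChart_source] with y hy
    simp only [Function.comp_apply, id]
    rw [hgY y hy, φ.left_inv (by simpa [hφ] using hy)]
  have hm := hid.mfderiv_eq (I := 𝓡 n) (I' := 𝓡 n)
  rw [mfderiv_id, mfderiv_comp x (by rw [Function.comp_apply, hgx]; exact hφd)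
    (hgd.comp x hYd), mfderiv_comp x hgd hYd] at hm
  intro u v huv
  have huv' : mfderiv (𝓡 n) (𝓡 (n + 1)) Y x u = mfderiv (𝓡 n) (𝓡 (n + 1)) Y x v := huv
  have e1 : mfderiv 𝓘(ℝ, EuclideanSpace ℝ (Fin n)) (𝓡 n) φ.symm ((g ∘ Y) x)
      (mfderiv (𝓡 (n + 1)) 𝓘(ℝ, EuclideanSpace ℝ (Fin n)) g (Y x)
        (mfderiv (𝓡 n) (𝓡 (n + 1)) Y x u)) = u := DFunLike.congr_fun hm u
  have e2 : mfderiv 𝓘(ℝ, EuclideanSpace ℝ (Fin n)) (𝓡 n) φ.symm ((g ∘ Y) x)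
      (mfderiv (𝓡 (n + 1)) 𝓘(ℝ, EuclideanSpace ℝ (Fin n)) g (Y x)
        (mfderiv (𝓡 n) (𝓡 (n + 1)) Y x v)) = v := DFunLike.congr_fun hm v
  rw [← e1, ← e2, huv']

/-- The representation of a time dependent map in the chart at `x₀`. -/
def chartRep (x₀ : M) {V : Type*} (X : ℝ → M → V) : EuclideanSpace ℝ (Fin n) × ℝ → V :=
  fun z => X z.2 ((extChartAt (𝓡 n) x₀).symm z.1)

lemma contDiffOn_chartRep {X : ℝ → M → EuclideanSpace ℝ (Fin (n + 1))} {I : Set ℝ}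
    (hX : ContMDiffOn ((𝓡 n).prod 𝓘(ℝ, ℝ)) (𝓡 (n + 1)) ∞ (fun p : M × ℝ => X p.2 p.1) (univ ×ˢ I))
    (x₀ : M) : ContDiffOn ℝ ∞ (chartRep x₀ X) ((extChartAt (𝓡 n) x₀).target ×ˢ I) := by
  rw [← contMDiffOn_iff_contDiffOn, modelWithCornersSelf_prod, ← chartedSpaceSelf_prod]
  have h1 : ContMDiffOn ((𝓡 n).prod 𝓘(ℝ, ℝ)) ((𝓡 n).prod 𝓘(ℝ, ℝ)) ∞
      (Prod.map (extChartAt (𝓡 n) x₀).symm (id : ℝ → ℝ)) ((extChartAt (𝓡 n) x₀).target ×ˢ I) :=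
    (contMDiffOn_extChartAt_symm x₀).prodMap contMDiffOn_id
  exact hX.comp h1 fun z hz => ⟨trivial, hz.2⟩

omit [IsManifold (𝓡 n) ∞ M] in
lemma fderiv_chartRep_center {X : ℝ → M → EuclideanSpace ℝ (Fin (n + 1))} {x₀ : M} {t : ℝ}
    (hX : MDifferentiableAt (𝓡 n) (𝓡 (n + 1)) (X t) x₀) :
    fderiv ℝ (fun p => chartRep x₀ X (p, t)) (extChartAt (𝓡 n) x₀ x₀) = differential (X t) x₀ := by
  rw [differential, hX.mfderiv]
  simp only [writtenInExtChartAt, extChartAt_model_space_eq_id, PartialEquiv.refl_coe,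
    modelWithCornersSelf_coe, range_id, fderivWithin_univ, Function.id_comp]
  rfl

omit [IsManifold (𝓡 n) ∞ M] in
lemma fderiv_comp_differential {Y : M → EuclideanSpace ℝ (Fin (n + 1))}
    {g : EuclideanSpace ℝ (Fin n) → M} {p : EuclideanSpace ℝ (Fin n)}
    (hY : MDifferentiableAt (𝓡 n) (𝓡 (n + 1)) Y (g p))
    (hg : MDifferentiableAt 𝓘(ℝ, EuclideanSpace ℝ (Fin n)) (𝓡 n) g p)
    (u : EuclideanSpace ℝ (Fin n)) :
    fderiv ℝ (Y ∘ g) p u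
      = differential Y (g p) (mfderiv 𝓘(ℝ, EuclideanSpace ℝ (Fin n)) (𝓡 n) g p u) := by
  rw [← mfderiv_eq_fderiv, mfderiv_comp p hY hg]
  rfl

end Charts

/-! ### Second fundamental form and principal frames of the evolving hypersurface -/

section Hypersurfaces

variable {n : ℕ}

/-- The range of B lies in the orthogonal complement of ν, and both have dimension n. -/
lemma mem_range_of_inner_eq_zero
    {B : EuclideanSpace ℝ (Fin n) →ₗ[ℝ] EuclideanSpace ℝ (Fin (n + 1))}
    {ν : EuclideanSpace ℝ (Fin (n + 1))} (hB : Function.Injective B) (hν : ‖ν‖ = 1)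
    (hBν : ∀ v, inner ℝ (B v) ν = (0 : ℝ)) {y : EuclideanSpace ℝ (Fin (n + 1))}
    (hy : inner ℝ y ν = (0 : ℝ)) : y ∈ LinearMap.range B := by
  have hν0 : ν ≠ 0 := by rintro rfl; simp at hν
  have : Fact (Module.finrank ℝ (EuclideanSpace ℝ (Fin (n + 1))) = n + 1) := ⟨by simp⟩
  have hle : LinearMap.range B ≤ (ℝ ∙ ν)ᗮ := by
    rintro _ ⟨v, rfl⟩
    rw [Submodule.mem_orthogonal_singleton_iff_inner_left]
    exact hBν v
  have heq : LinearMap.range B = (ℝ ∙ ν)ᗮ := by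
    refine Submodule.eq_of_le_of_finrank_eq hle ?_
    rw [Submodule.finrank_orthogonal_span_singleton (n := n) hν0, LinearMap.finrank_range_of_inj hB]
    simp
  rw [heq, Submodule.mem_orthogonal_singleton_iff_inner_left]
  exact hy

variable {M : Type*} [TopologicalSpace M] [ChartedSpace (EuclideanSpace ℝ (Fin n)) M]
  [IsManifold (𝓡 n) ∞ M] {Γ : Set (Fin n → ℝ)} {f : (Fin n → ℝ) → ℝ} {Ψ : ℝ → ℝ} {T : EReal}
  {X ν : ℝ → M → EuclideanSpace ℝ (Fin (n + 1))} {t : ℝ}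

namespace IsEmbeddedSolution

omit [IsManifold (𝓡 n) ∞ M] in
lemma mdifferentiableAt (hX : IsEmbeddedSolution Γ f Ψ T X ν) (ht : t ∈ timeInterval T) (x : M) :
    MDifferentiableAt (𝓡 n) (𝓡 (n + 1)) (X t) x :=
  ((hX.embedding t ht).isImmersion.contMDiff x).mdifferentiableAt (by simp)

omit [IsManifold (𝓡 n) ∞ M] in
lemma mdifferentiableAt_normal (hX : IsEmbeddedSolution Γ f Ψ T X ν) (ht : t ∈ timeInterval T)
    (x : M) : MDifferentiableAt (𝓡 n) (𝓡 (n + 1)) (ν t) x := by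
  have h1 : ContMDiff (𝓡 n) ((𝓡 n).prod 𝓘(ℝ, ℝ)) ∞ (fun y : M => (y, t)) :=
    contMDiff_id.prodMk contMDiff_const
  have h2 : ContMDiff (𝓡 n) (𝓡 (n + 1)) ∞ (ν t) := by
    rw [← contMDiffOn_univ]
    exact hX.smooth_normal.comp h1.contMDiffOn fun y _ => ⟨trivial, ht⟩
  exact (h2 x).mdifferentiableAt (by simp)

omit [IsManifold (𝓡 n) ∞ M] in
lemma differential_injective (hX : IsEmbeddedSolution Γ f Ψ T X ν) (ht : t ∈ timeInterval T)
    (x : M) : Function.Injective (differential (X t) x) :=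
  CurvatureFlow.differential_injective ((hX.embedding t ht).isImmersion.isImmersionAt x)

omit [IsManifold (𝓡 n) ∞ M] in
lemma mem_range_differential (hX : IsEmbeddedSolution Γ f Ψ T X ν) (ht : t ∈ timeInterval T)
    (x : M) {y : EuclideanSpace ℝ (Fin (n + 1))} (hy : inner ℝ y (ν t x) = (0 : ℝ)) :
    y ∈ LinearMap.range (differential (X t) x : EuclideanSpace ℝ (Fin n) →ₗ[ℝ] EuclideanSpace ℝ (Fin (n + 1))) :=
  mem_range_of_inner_eq_zero (hX.differential_injective ht x)
    ((hX.outward_normal t ht).norm_eq_one x) (fun v => (hX.outward_normal t ht).normal x v) hy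

lemma contDiffAt_chartRep {X : ℝ → M → EuclideanSpace ℝ (Fin (n + 1))}
    (hX : ContMDiffOn ((𝓡 n).prod 𝓘(ℝ, ℝ)) (𝓡 (n + 1)) ∞ (fun p : M × ℝ => X p.2 p.1)
      (univ ×ˢ timeInterval T)) (ht : t ∈ timeInterval T) (x : M) :
    ContDiffOn ℝ ∞ (fun p => chartRep x X (p, t)) (extChartAt (𝓡 n) x).target :=
  (contDiffOn_chartRep hX x).comp (contDiff_id.prodMk contDiff_const).contDiffOn
    fun _ hp => ⟨hp, ht⟩

/-- The second fundamental form is symmetric. -/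
lemma second_symm (hX : IsEmbeddedSolution Γ f Ψ T X ν) (ht : t ∈ timeInterval T) (x : M)
    (u v : EuclideanSpace ℝ (Fin n)) :
    inner ℝ (differential (ν t) x u) (differential (X t) x v)
      = (inner ℝ (differential (X t) x u) (differential (ν t) x v) : ℝ) := by
  set ψ := extChartAt (𝓡 n) x
  set Y : EuclideanSpace ℝ (Fin n) → EuclideanSpace ℝ (Fin (n + 1)) :=
    fun p => chartRep x X (p, t) with hY
  set N : EuclideanSpace ℝ (Fin n) → EuclideanSpace ℝ (Fin (n + 1)) :=
    fun p => chartRep x ν (p, t) with hN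
  have ho : IsOpen ψ.target := isOpen_extChartAt_target x
  have hp0 : ψ.target ∈ 𝓝 (ψ x) := ho.mem_nhds (mem_extChartAt_target x)
  have hYs := contDiffAt_chartRep hX.smooth ht x
  have hNs := contDiffAt_chartRep hX.smooth_normal ht x
  have hYc : ContDiffAt ℝ ∞ Y (ψ x) := hYs.contDiffAt hp0
  have hNd : DifferentiableAt ℝ N (ψ x) := (hNs.contDiffAt hp0).differentiableAt (by simp)
  have hperp : ∀ w, ∀ p ∈ ψ.target, inner ℝ (dd w Y p) (N p) = (0 : ℝ) := by
    intro w p hp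
    have hd : MDifferentiableAt 𝓘(ℝ, EuclideanSpace ℝ (Fin n)) (𝓡 n) ψ.symm p :=
      ((contMDiffOn_extChartAt_symm (n := ∞) x).contMDiffAt (ho.mem_nhds hp)).mdifferentiableAt
        (by simp)
    have := fderiv_comp_differential (hX.mdifferentiableAt ht (ψ.symm p)) hd w
    rw [show dd w Y p = fderiv ℝ (X t ∘ ψ.symm) p w from rfl, this]
    exact (hX.outward_normal t ht).normal _ _
  -- Differentiating ⟨∂ₐY, N⟩ = 0 expresses the second form through the mixed second derivatives of
  -- Y, which commute.
  have key : ∀ a b, inner ℝ (dd a Y (ψ x)) (dd b N (ψ x)) = (-inner ℝ (dd b (dd a Y) (ψ x)) (N (ψ x)) : ℝ) := by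
    intro a b
    have hdY : DifferentiableAt ℝ (dd a Y) (ψ x) :=
      ((hYc.fderiv_right (m := 1) (by norm_cast)).clm_apply contDiffAt_const).differentiableAt
        (by simp)
    have h1 : fderiv ℝ (fun p => inner ℝ (dd a Y p) (N p) : _ → ℝ) (ψ x) b = 0 := by
      have : (fun p => inner ℝ (dd a Y p) (N p) : _ → ℝ) =ᶠ[𝓝 (ψ x)] fun _ => 0 := by
        filter_upwards [hp0] with p hp using hperp a p hp
      rw [this.fderiv_eq]; simp
    rw [fderiv_inner_apply ℝ hdY hNd] at h1
    have : inner ℝ (dd a Y (ψ x)) (dd b N (ψ x)) + inner ℝ (dd b (dd a Y) (ψ x)) (N (ψ x)) = (0:ℝ) := h1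
    linarith
  have e1 : ∀ a, dd a Y (ψ x) = differential (X t) x a := fun a => by
    rw [← fderiv_chartRep_center (hX.mdifferentiableAt ht x)]; rfl
  have e2 : ∀ a, dd a N (ψ x) = differential (ν t) x a := fun a => by
    rw [← fderiv_chartRep_center (hX.mdifferentiableAt_normal ht x)]; rfl
  rw [← e1, ← e1, ← e2, ← e2, key, real_inner_comm, key,
    dd_comm_at _ _ (hYc.of_le (by norm_cast))]

lemma inner_differential_normal (hX : IsEmbeddedSolution Γ f Ψ T X ν) (ht : t ∈ timeInterval T)
    (x : M) (u : EuclideanSpace ℝ (Fin n)) :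
    inner ℝ (differential (ν t) x u) (ν t x) = (0 : ℝ) := by
  set N : EuclideanSpace ℝ (Fin n) → EuclideanSpace ℝ (Fin (n + 1)) :=
    fun p => chartRep x ν (p, t) with hN
  set ψ := extChartAt (𝓡 n) x with hψ
  have hp0 : ψ.target ∈ 𝓝 (ψ x) :=
    (isOpen_extChartAt_target x).mem_nhds (mem_extChartAt_target x)
  have hNd : DifferentiableAt ℝ N (ψ x) :=
    ((contDiffAt_chartRep hX.smooth_normal ht x).contDiffAt hp0).differentiableAt (by simp)
  have h1 : fderiv ℝ (fun p => inner ℝ (N p) (N p) : _ → ℝ) (ψ x) u = 0 := by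
    have : (fun p => inner ℝ (N p) (N p) : _ → ℝ) = fun _ => 1 := by
      funext p
      rw [real_inner_self_eq_norm_sq]
      simp [hN, chartRep, (hX.outward_normal t ht).norm_eq_one]
    rw [this]; simp
  rw [fderiv_inner_apply ℝ hNd hNd, real_inner_comm, fderiv_chartRep_center
    (hX.mdifferentiableAt_normal ht x)] at h1
  have e : N (ψ x) = ν t x := by simp [hN, chartRep, hψ]
  rw [e] at h1
  linarith

/-- At every point there is an orthonormal frame of principal directions. -/
lemma exists_principalFrame (hX : IsEmbeddedSolution Γ f Ψ T X ν) (ht : t ∈ timeInterval T)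
    (x : M) : ∃ v, IsPrincipalFrame (differential (X t) x : EuclideanSpace ℝ (Fin n) →ₗ[ℝ] EuclideanSpace ℝ (Fin (n + 1)))
      (differential (ν t) x : EuclideanSpace ℝ (Fin n) →ₗ[ℝ] EuclideanSpace ℝ (Fin (n + 1)))
      (principalCurvatures (X t) (ν t) x) v :=
  exists_isPrincipalFrame (hX.differential_injective ht x) (hX.second_symm ht x)
    fun u => hX.mem_range_differential ht x (hX.inner_differential_normal ht x u)

omit [IsManifold (𝓡 n) ∞ M] in
lemma speed_pos (hX : IsEmbeddedSolution Γ f Ψ T X ν) (hf : IsAdmissibleSpeed Γ f)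
    (ht : t ∈ timeInterval T) (x : M) : 0 < speed f X ν t x :=
  hf.positive _ (hX.curvatures_mem t ht x)

end IsEmbeddedSolution

end Hypersurfaces

/-! ### The time interval -/

section TimeInterval

variable {T : EReal} {t : ℝ}

lemma zero_mem_timeInterval (hT : 0 < T) : (0 : ℝ) ∈ timeInterval T := ⟨le_rfl, by simpa using hT⟩

lemma exists_Ico_subset_timeInterval (ht : t ∈ timeInterval T) :
    ∃ τ, t < τ ∧ Ico 0 τ ⊆ timeInterval T := by
  obtain ⟨τ, h1, h2⟩ := EReal.lt_iff_exists_real_btwn.1 ht.2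
  exact ⟨τ, by exact_mod_cast h1, fun s hs => ⟨hs.1, lt_trans (by exact_mod_cast hs.2) h2⟩⟩

lemma timeInterval_mem_nhds (ht : t ∈ timeInterval T) (h0 : 0 < t) : timeInterval T ∈ 𝓝 t := by
  obtain ⟨τ, h1, h2⟩ := exists_Ico_subset_timeInterval ht
  exact mem_of_superset (Ioo_mem_nhds h0 h1) (Ioo_subset_Ico_self.trans h2)

lemma Icc_subset_timeInterval (ht : t ∈ timeInterval T) : Icc 0 t ⊆ timeInterval T :=
  fun _ hs => ⟨hs.1, lt_of_le_of_lt (by exact_mod_cast hs.2) ht.2⟩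

lemma uniqueDiffOn_timeInterval (hT : 0 < T) : UniqueDiffOn ℝ (timeInterval T) := by
  refine uniqueDiffOn_convex (OrdConnected.convex ⟨fun a ha b hb c hc => ?_⟩) ?_
  · exact ⟨ha.1.trans hc.1, lt_of_le_of_lt (by exact_mod_cast hc.2) hb.2⟩
  · obtain ⟨τ, h1, h2⟩ := exists_Ico_subset_timeInterval (zero_mem_timeInterval hT)
    refine ⟨τ / 2, ?_⟩
    rw [mem_interior_iff_mem_nhds]
    exact mem_of_superset (Ioo_mem_nhds (half_pos h1) (half_lt_self h1))
      (Ioo_subset_Ico_self.trans h2)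

end TimeInterval

/-! ### The two-point function near the diagonal -/

section NearDiagonal

variable {E V : Type*} [NormedAddCommGroup E] [NormedSpace ℝ E] [NormedAddCommGroup V]
  [InnerProductSpace ℝ V]

/-- Time 0 is an endpoint of I, so G is differentiated only within U × I; in the spatial directions
this is an ordinary derivative because U is open. -/
lemma hasFDerivAt_slice {G : E × ℝ → V} {U : Set E} {I : Set ℝ} (hU : IsOpen U)
    (hG : ContDiffOn ℝ ∞ G (U ×ˢ I)) {z : E × ℝ} (hz : z ∈ U ×ˢ I) :
    HasFDerivAt (fun p => G (p, z.2))
      ((fderivWithin ℝ G (U ×ˢ I) z).comp (ContinuousLinearMap.inl ℝ E ℝ)) z.1 := by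
  have h1 : HasFDerivWithinAt G (fderivWithin ℝ G (U ×ˢ I) z) (U ×ˢ I) (z.1, z.2) :=
    ((hG.differentiableOn (by simp)) z hz).hasFDerivWithinAt
  have h2 : HasFDerivWithinAt (fun p : E => (p, z.2)) (ContinuousLinearMap.inl ℝ E ℝ) U z.1 :=
    (hasFDerivAt_prodMk_left z.1 z.2).hasFDerivWithinAt
  have h3 : MapsTo (fun p : E => (p, z.2)) U (U ×ˢ I) := fun p hp => ⟨hp, hz.2⟩
  exact (h1.comp z.1 h2 h3).hasFDerivAt (hU.mem_nhds hz.1)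

lemma continuousOn_slice_fderiv {G : E × ℝ → V} {U : Set E} {I : Set ℝ} (hU : IsOpen U)
    (hI : UniqueDiffOn ℝ I) (hG : ContDiffOn ℝ ∞ G (U ×ˢ I)) :
    ContinuousOn (fun z => (fderivWithin ℝ G (U ×ˢ I) z).comp (ContinuousLinearMap.inl ℝ E ℝ))
      (U ×ˢ I) :=
  (hG.continuousOn_fderivWithin (hU.uniqueDiffOn.prod hI) (by simp)).clm_comp continuousOn_const

/-- A and B stand for the frozen derivatives of position and normal in the direction v, and a, b, c,
φ1 for their perturbations along a segment. The expression is half the derivative of the two-point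
function minus its quadratic model, up to one term which vanishes by normality; the constant 20 is
not sharp. -/
lemma two_point_error {A a B b c : V} {τ φ0 φ1 δ K m : ℝ} (hm : 0 ≤ m) (hτ : 0 ≤ τ) (hδ : 0 ≤ δ)
    (hδ1 : δ ≤ 1) (hK : 1 ≤ K)
    (hA : ‖A‖ ≤ K * m) (hB : ‖B‖ ≤ K * m) (hφ0 : |φ0| ≤ K) (ha : ‖a‖ ≤ δ * m)
    (hb : ‖b‖ ≤ δ * (τ * m)) (hc : ‖c‖ ≤ δ * (τ * m)) (hφ : |φ1| ≤ δ) :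
    |inner ℝ (A + a) (τ • B + b) + (φ0 + φ1) * inner ℝ (τ • A + c) (A + a)
      - τ * (inner ℝ B A + φ0 * ‖A‖ ^ 2)| ≤ 20 * K ^ 2 * δ * (τ * m ^ 2) := by
  have hK0 : 0 ≤ K := by linarith
  have bd : ∀ {x y : V} {r s : ℝ}, ‖x‖ ≤ r → ‖y‖ ≤ s → 0 ≤ r → |inner ℝ x y| ≤ r * s :=
    fun hx hy hr => (abs_real_inner_le_norm _ _).trans
      (mul_le_mul hx hy (norm_nonneg _) hr)
  have e : inner ℝ (A + a) (τ • B + b) + (φ0 + φ1) * inner ℝ (τ • A + c) (A + a)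
      - τ * (inner ℝ B A + φ0 * ‖A‖ ^ 2)
      = inner ℝ A b + τ * inner ℝ a B + inner ℝ a b + φ1 * (τ * inner ℝ A A)
        + (φ0 + φ1) * (τ * inner ℝ A a + inner ℝ c A + inner ℝ c a) := by
    simp only [inner_add_left, inner_add_right, inner_smul_left, inner_smul_right,
      ← real_inner_self_eq_norm_sq, RCLike.conj_to_real]
    rw [real_inner_comm A B]
    ring
  have hKm : 0 ≤ K * m := by positivity
  have hdm : 0 ≤ δ * m := by positivity
  have hdt : 0 ≤ δ * (τ * m) := by positivity
  have h1 := bd hA hb hKm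
  have h2 := bd ha hB hdm
  have h3 := bd ha hb hdm
  have h4 := bd hA hA hKm
  have h5 := bd hA ha hKm
  have h6 := bd hc hA hdt
  have h7 := bd hc ha hdt
  have h8 : |φ0 + φ1| ≤ 2 * K := (abs_add_le _ _).trans (by linarith)
  have g2 : |τ * inner ℝ a B| ≤ τ * (δ * m * (K * m)) := by
    rw [abs_mul, abs_of_nonneg hτ]; exact mul_le_mul_of_nonneg_left h2 hτ
  have g4 : |φ1 * (τ * inner ℝ A A)| ≤ δ * (τ * (K * m * (K * m))) := by
    rw [abs_mul, abs_mul, abs_of_nonneg hτ]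
    exact mul_le_mul hφ (mul_le_mul_of_nonneg_left h4 hτ) (by positivity) hδ
  have g5 : |τ * inner ℝ A a| ≤ τ * (K * m * (δ * m)) := by
    rw [abs_mul, abs_of_nonneg hτ]; exact mul_le_mul_of_nonneg_left h5 hτ
  have g8 : |(φ0 + φ1) * (τ * inner ℝ A a + inner ℝ c A + inner ℝ c a)|
      ≤ 2 * K * (τ * (K * m * (δ * m)) + δ * (τ * m) * (K * m) + δ * (τ * m) * (δ * m)) := by
    rw [abs_mul]
    refine mul_le_mul h8 ?_ (abs_nonneg _) (by positivity)
    exact (abs_add_three _ _ _).trans (by linarith)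
  rw [e]
  have tri : ∀ x1 x2 x3 x4 x5 : ℝ, |x1 + x2 + x3 + x4 + x5| ≤ |x1| + |x2| + |x3| + |x4| + |x5| := by
    intro x1 x2 x3 x4 x5
    have := abs_add_le (x1 + x2 + x3 + x4) x5
    have := abs_add_le (x1 + x2 + x3) x4
    have := abs_add_three x1 x2 x3
    linarith
  refine (tri _ _ _ _ _).trans ?_
  set w := τ * m ^ 2 with hw
  have hw0 : 0 ≤ w := by positivity
  have k1 : K ≤ K ^ 2 := le_self_pow₀ hK two_ne_zero
  have k2 : δ * δ ≤ δ := mul_le_of_le_one_left hδ hδ1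
  have k3 : (1:ℝ) ≤ K ^ 2 := one_le_pow₀ hK
  have hdw : 0 ≤ δ * w := by positivity
  have q0 : δ * δ * w ≤ δ * w := mul_le_mul_of_nonneg_right k2 hw0
  have q1 : K * (δ * w) ≤ K ^ 2 * (δ * w) := mul_le_mul_of_nonneg_right k1 hdw
  have q2 : δ * δ * w ≤ K ^ 2 * (δ * w) := q0.trans (le_mul_of_one_le_left hdw k3)
  have q3 : K * (δ * δ * w) ≤ K ^ 2 * (δ * w) := (mul_le_mul_of_nonneg_left q0 hK0).trans q1
  have s1 : K * m * (δ * (τ * m)) = K * (δ * w) := by rw [hw]; ring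
  have s2 : τ * (δ * m * (K * m)) = K * (δ * w) := by rw [hw]; ring
  have s3 : δ * m * (δ * (τ * m)) = δ * δ * w := by rw [hw]; ring
  have s4 : δ * (τ * (K * m * (K * m))) = K ^ 2 * (δ * w) := by rw [hw]; ring
  have s5 : 2 * K * (τ * (K * m * (δ * m)) + δ * (τ * m) * (K * m) + δ * (τ * m) * (δ * m))
      = 4 * (K ^ 2 * (δ * w)) + 2 * (K * (δ * δ * w)) := by rw [hw]; ring
  rw [s2] at g2
  rw [s1] at h1
  rw [s3] at h3
  rw [s4] at g4
  rw [s5] at g8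
  have : 20 * K ^ 2 * δ * w = 20 * (K ^ 2 * (δ * w)) := by ring
  rw [this]
  have : 0 ≤ K ^ 2 * (δ * w) := by positivity
  linarith

/-- Near the diagonal the two-point function is given to second order by the second fundamental
form. -/
lemma twoPoint_near_diagonal {G H : E × ℝ → V} {φ : E × ℝ → ℝ} {U : Set E} {I : Set ℝ}
    (hU : IsOpen U) {G' H' : E × ℝ → E →L[ℝ] V}
    (hG : ∀ z ∈ U ×ˢ I, HasFDerivAt (fun p => G (p, z.2)) (G' z) z.1)
    (hH : ∀ z ∈ U ×ˢ I, HasFDerivAt (fun p => H (p, z.2)) (H' z) z.1)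
    (hperp : ∀ z ∈ U ×ˢ I, ∀ v, inner ℝ (G' z v) (H z) = (0 : ℝ))
    {p₀ : E} {t₀ : ℝ} (hp₀ : p₀ ∈ U)
    (hGc : ContinuousWithinAt G' (U ×ˢ I) (p₀, t₀)) (hHc : ContinuousWithinAt H' (U ×ˢ I) (p₀, t₀))
    (hφc : ContinuousWithinAt φ (U ×ˢ I) (p₀, t₀)) {η : ℝ} (hη : 0 < η) :
    ∃ r > 0, ∀ p ∈ Metric.ball p₀ r, ∀ q ∈ Metric.ball p₀ r, ∀ t ∈ I, |t - t₀| < r →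
      |twoPoint (φ (p, t)) (G (p, t) - G (q, t)) (H (p, t))
        - (inner ℝ (H' (p₀, t₀) (q - p)) (G' (p₀, t₀) (q - p))
          + φ (p₀, t₀) * ‖G' (p₀, t₀) (q - p)‖ ^ 2)| ≤ η * ‖q - p‖ ^ 2 := by
  set G₀ := G' (p₀, t₀)
  set H₀ := H' (p₀, t₀)
  set φ₀ := φ (p₀, t₀)
  obtain ⟨K, hK1, hKG, hKH, hKφ⟩ : ∃ K : ℝ, 1 ≤ K ∧ ‖G₀‖ ≤ K ∧ ‖H₀‖ ≤ K ∧ |φ₀| ≤ K :=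
    ⟨1 + ‖G₀‖ + ‖H₀‖ + |φ₀|, by
      have := norm_nonneg G₀; have := norm_nonneg H₀; have := abs_nonneg φ₀
      refine ⟨?_, ?_, ?_, ?_⟩ <;> linarith⟩
  obtain ⟨δ, hδ0, hδ1, hδη⟩ : ∃ δ : ℝ, 0 < δ ∧ δ ≤ 1 ∧ 2 * (20 * K ^ 2 * δ) ≤ η := by
    -- The derivative of g below is twice the quantity bounded by `two_point_error`; hence 40 = 2 ·
    -- 20.
    refine ⟨min 1 (η / (40 * K ^ 2)), by positivity, min_le_left _ _, ?_⟩
    have : min 1 (η / (40 * K ^ 2)) ≤ η / (40 * K ^ 2) := min_le_right _ _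
    rw [le_div_iff₀ (by positivity)] at this
    linarith
  have hev : ∀ᶠ z in 𝓝[U ×ˢ I] (p₀, t₀), ‖G' z - G₀‖ ≤ δ ∧ ‖H' z - H₀‖ ≤ δ ∧ |φ z - φ₀| ≤ δ := by
    filter_upwards [Metric.tendsto_nhds.1 hGc δ hδ0, Metric.tendsto_nhds.1 hHc δ hδ0,
      Metric.tendsto_nhds.1 hφc δ hδ0] with z h1 h2 h3
    rw [dist_eq_norm] at h1 h2 h3
    exact ⟨h1.le, h2.le, h3.le⟩
  rw [eventually_nhdsWithin_iff, Metric.eventually_nhds_iff_ball] at hev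
  obtain ⟨r1, hr1, hev⟩ := hev
  obtain ⟨r2, hr2, hUr⟩ := Metric.isOpen_iff.1 hU p₀ hp₀
  refine ⟨min r1 r2, lt_min hr1 hr2, fun p hp q hq t ht htt => ?_⟩
  have hin : ∀ x ∈ Metric.ball p₀ (min r1 r2), (x, t) ∈ U ×ˢ I := fun x hx =>
    ⟨hUr (Metric.ball_subset_ball (min_le_right _ _) hx), ht⟩
  have hbd : ∀ x ∈ Metric.ball p₀ (min r1 r2),
      ‖G' (x, t) - G₀‖ ≤ δ ∧ ‖H' (x, t) - H₀‖ ≤ δ ∧ |φ (x, t) - φ₀| ≤ δ := fun x hx => by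
    refine hev (x, t) ?_ (hin x hx)
    rw [← ball_prod_same]
    exact ⟨Metric.ball_subset_ball (min_le_left _ _) hx,
      by rw [Metric.mem_ball, Real.dist_eq]; exact htt.trans_le (min_le_left _ _)⟩
  set v := q - p with hv
  have hcv := convex_ball p₀ (min r1 r2)
  have hseg : ∀ τ ∈ Icc (0:ℝ) 1, p + τ • v ∈ Metric.ball p₀ (min r1 r2) := fun τ hτ =>
    hcv.add_smul_sub_mem hp hq hτ
  have mvG : ∀ τ ∈ Icc (0:ℝ) 1, ‖G (p + τ • v, t) - G (p, t) - τ • G₀ v‖ ≤ δ * (τ * ‖v‖) := by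
    intro τ hτ
    have := hcv.norm_image_sub_le_of_norm_hasFDerivWithin_le' (𝕜 := ℝ) (φ := G₀)
      (f := fun x => G (x, t)) (f' := fun x => G' (x, t))
      (fun x hx => (hG (x, t) (hin x hx)).hasFDerivWithinAt) (fun x hx => (hbd x hx).1) hp (hseg τ hτ)
    simpa [norm_smul, abs_of_nonneg hτ.1] using this
  have mvH : ∀ τ ∈ Icc (0:ℝ) 1, ‖H (p + τ • v, t) - H (p, t) - τ • H₀ v‖ ≤ δ * (τ * ‖v‖) := by
    intro τ hτ
    have := hcv.norm_image_sub_le_of_norm_hasFDerivWithin_le' (𝕜 := ℝ) (φ := H₀)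
      (f := fun x => H (x, t)) (f' := fun x => H' (x, t))
      (fun x hx => (hH (x, t) (hin x hx)).hasFDerivWithinAt) (fun x hx => (hbd x hx).2.1) hp
      (hseg τ hτ)
    simpa [norm_smul, abs_of_nonneg hτ.1] using this
  set Q := inner ℝ (H₀ v) (G₀ v) + φ₀ * ‖G₀ v‖ ^ 2 with hQ
  -- The function g vanishes at τ = 0, so a bound on its derivative over [0,1] controls the
  -- remainder at q. Only first derivatives of G and H are needed, and φ need only be continuous.
  set g : ℝ → ℝ := fun τ => twoPoint (φ (p, t)) (G (p, t) - G (p + τ • v, t)) (H (p, t)) - τ ^ 2 * Q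
  have hder : ∀ τ ∈ Icc (0:ℝ) 1, HasDerivWithinAt g
      (-2 * inner ℝ (G' (p + τ • v, t) v) (H (p, t))
        - 2 * φ (p, t) * inner ℝ (G (p, t) - G (p + τ • v, t)) (G' (p + τ • v, t) v)
        - 2 * τ * Q) (Icc 0 1) τ := by
    intro τ hτ
    have h1 : HasDerivAt (fun s : ℝ => p + s • v) v τ := by
      simpa using ((hasDerivAt_id τ).smul_const v).const_add p
    have h2 : HasDerivAt (fun s : ℝ => G (p, t) - G (p + s • v, t)) (-(G' (p + τ • v, t) v)) τ :=
      ((hG _ (hin _ (hseg τ hτ))).comp_hasDerivAt τ h1).const_sub _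
    have h3 := (((h2.inner ℝ (hasDerivAt_const τ (H (p, t)))).const_mul 2).add
      (h2.norm_sq.const_mul (φ (p, t)))).sub ((hasDerivAt_pow 2 τ).mul_const Q)
    refine (h3.congr_deriv ?_).hasDerivWithinAt
    simp only [inner_zero_right, inner_neg_left, inner_neg_right]
    push_cast
    ring
  have hle : ∀ τ ∈ Icc (0:ℝ) 1, ‖-2 * inner ℝ (G' (p + τ • v, t) v) (H (p, t))
        - 2 * φ (p, t) * inner ℝ (G (p, t) - G (p + τ • v, t)) (G' (p + τ • v, t) v)
        - 2 * τ * Q‖ ≤ η * ‖v‖ ^ 2 := by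
    intro τ hτ
    have hx := hseg τ hτ
    -- Normality at the moving point turns the pairing with H(p) into one with H(p) - H(p + τv),
    -- which is of order τ‖v‖.
    have e0 := hperp _ (hin _ hx) v
    have ha : ‖G' (p + τ • v, t) v - G₀ v‖ ≤ δ * ‖v‖ := by
      rw [← sub_apply]
      exact (ContinuousLinearMap.le_opNorm _ _).trans
        (mul_le_mul_of_nonneg_right (hbd _ hx).1 (norm_nonneg _))
    have hA : ‖G₀ v‖ ≤ K * ‖v‖ := (G₀.le_opNorm v).trans
      (mul_le_mul_of_nonneg_right hKG (norm_nonneg _))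
    have hB : ‖H₀ v‖ ≤ K * ‖v‖ := (H₀.le_opNorm v).trans
      (mul_le_mul_of_nonneg_right hKH (norm_nonneg _))
    have := two_point_error (norm_nonneg v) hτ.1 hδ0.le hδ1 hK1 hA hB hKφ ha (mvH τ hτ) (mvG τ hτ)
      (hbd p hp).2.2
    have e1 : G₀ v + (G' (p + τ • v, t) v - G₀ v) = G' (p + τ • v, t) v := by abel
    have e2 : τ • H₀ v + (H (p + τ • v, t) - H (p, t) - τ • H₀ v) = H (p + τ • v, t) - H (p, t) := by
      abel
    have e3 : τ • G₀ v + (G (p + τ • v, t) - G (p, t) - τ • G₀ v) = G (p + τ • v, t) - G (p, t) := by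
      abel
    rw [e1, e2, e3, ← hQ, add_sub_cancel, inner_sub_right, e0] at this
    have e4 : -2 * inner ℝ (G' (p + τ • v, t) v) (H (p, t))
        - 2 * φ (p, t) * inner ℝ (G (p, t) - G (p + τ • v, t)) (G' (p + τ • v, t) v)
        - 2 * τ * Q = 2 * (0 - inner ℝ (G' (p + τ • v, t) v) (H (p, t)) +
          φ (p, t) * inner ℝ (G (p + τ • v, t) - G (p, t)) (G' (p + τ • v, t) v) - τ * Q) := by
      rw [inner_sub_left, inner_sub_left]; ring
    rw [e4, Real.norm_eq_abs, abs_mul, abs_two]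
    have h5 : 20 * K ^ 2 * δ * (τ * ‖v‖ ^ 2) ≤ 20 * K ^ 2 * δ * ‖v‖ ^ 2 := by
      refine mul_le_mul_of_nonneg_left ?_ (by positivity)
      nlinarith [hτ.2, sq_nonneg ‖v‖]
    nlinarith [sq_nonneg ‖v‖]
  have hmv := (convex_Icc (0:ℝ) 1).norm_image_sub_le_of_norm_hasDerivWithin_le hder hle
    (left_mem_Icc.2 zero_le_one) (right_mem_Icc.2 zero_le_one)
  have e5 : p + v = q := by rw [hv]; abel
  simpa [g, twoPoint, e5] using hmv

end NearDiagonal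

/-! ### The two-point function of the flow and its quadratic form on the diagonal -/

section TwoPointFunction

variable {n : ℕ} {M : Type*} [TopologicalSpace M] [ChartedSpace (EuclideanSpace ℝ (Fin n)) M]

/-- The two-point function `2⟨X(x) - X(y), ν(x)⟩ + θ F(x) |X(x) - X(y)|²`, whose nonnegativity means
that the ball of curvature `θ F(x)` touching at `x` from outside does not contain `X(y)`. -/
def pairFn (θ : ℝ → ℝ) (f : (Fin n → ℝ) → ℝ) (X ν : ℝ → M → EuclideanSpace ℝ (Fin (n + 1)))
    (t : ℝ) (x y : M) : ℝ :=
  twoPoint (θ t * speed f X ν t x) (X t x - X t y) (ν t x)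

/-- The quadratic form `h + θ F g`. -/
def diagForm (θ : ℝ → ℝ) (f : (Fin n → ℝ) → ℝ) (X ν : ℝ → M → EuclideanSpace ℝ (Fin (n + 1)))
    (t : ℝ) (x : M) (v : EuclideanSpace ℝ (Fin n)) : ℝ :=
  inner ℝ (differential (ν t) x v) (differential (X t) x v)
    + θ t * speed f X ν t x * ‖differential (X t) x v‖ ^ 2

variable [IsManifold (𝓡 n) ∞ M] {Γ : Set (Fin n → ℝ)} {f : (Fin n → ℝ) → ℝ} {Ψ : ℝ → ℝ} {T : EReal}
  {X ν : ℝ → M → EuclideanSpace ℝ (Fin (n + 1))} {t : ℝ} {θ : ℝ → ℝ}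

omit [IsManifold (𝓡 n) ∞ M] in
lemma pairFn_self (t : ℝ) (x : M) : pairFn θ f X ν t x x = 0 := by simp [pairFn, twoPoint]

omit [IsManifold (𝓡 n) ∞ M] in
lemma diagForm_smul (c : ℝ) (x : M) (v : EuclideanSpace ℝ (Fin n)) :
    diagForm θ f X ν t x (c • v) = c ^ 2 * diagForm θ f X ν t x v := by
  simp only [diagForm, map_smul, real_inner_smul_left, inner_smul_right, norm_smul, mul_pow,
    Real.norm_eq_abs, sq_abs]
  ring

omit [IsManifold (𝓡 n) ∞ M] in
lemma exists_diagForm_ge {x : M} (h : ∀ v, v ≠ 0 → 0 < diagForm θ f X ν t x v) :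
    ∃ c > 0, ∀ v, c * ‖v‖ ^ 2 ≤ diagForm θ f X ν t x v := by
  have hc : Continuous (diagForm θ f X ν t x) := by unfold diagForm; fun_prop
  obtain ⟨c, hc0, hc⟩ := (isCompact_sphere (0 : EuclideanSpace ℝ (Fin n)) 1).exists_forall_le'
    hc.continuousOn (a := 0) (fun v hv => h v (by rintro rfl; simp at hv))
  refine ⟨c, hc0, fun v => ?_⟩
  rcases eq_or_ne v 0 with rfl | hv
  · simp [diagForm]
  · have h1 := hc ((‖v‖)⁻¹ • v) (by simp [norm_smul, hv])
    rw [diagForm_smul] at h1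
    have h2 : 0 < ‖v‖ := norm_pos_iff.2 hv
    rw [inv_pow, ← div_eq_inv_mul, le_div_iff₀ (by positivity)] at h1
    exact h1

lemma continuousWithinAt_of_strictMonoOn {α : Type*} [TopologicalSpace α] {s : Set α} {F : α → ℝ}
    {z : α} (hΨ : StrictMonoOn Ψ (Ioi 0)) (hF : ∀ᶠ y in 𝓝[s] z, 0 < F y) (hz : 0 < F z)
    (h : ContinuousWithinAt (fun y => Ψ (F y)) s z) : ContinuousWithinAt F s z := by
  rw [ContinuousWithinAt, tendsto_order]
  constructor
  · intro a ha
    have hb : max a (F z / 2) < F z := max_lt ha (by linarith)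
    have hb0 : 0 < max a (F z / 2) := lt_max_of_lt_right (by linarith)
    filter_upwards [hF, h.eventually (lt_mem_nhds (hΨ hb0 hz hb))] with y hy hy'
    exact (le_max_left _ _).trans_lt ((hΨ.lt_iff_lt hb0 hy).1 hy')
  · intro a ha
    filter_upwards [hF, h.eventually (gt_mem_nhds (hΨ hz (hz.trans ha) ha))] with y hy hy'
    exact (hΨ.lt_iff_lt hy (hz.trans ha)).1 hy'

namespace IsEmbeddedSolution

/-- The velocity of the flow in a chart. -/
lemma fderivWithin_time (hX : IsEmbeddedSolution Γ f Ψ T X ν) (hT : 0 < T) (x₀ : M)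
    {z : EuclideanSpace ℝ (Fin n) × ℝ}
    (hz : z ∈ (extChartAt (𝓡 n) x₀).target ×ˢ timeInterval T) :
    fderivWithin ℝ (chartRep x₀ X) ((extChartAt (𝓡 n) x₀).target ×ˢ timeInterval T) z (tDir n)
      = -Ψ (chartRep x₀ (speed f X ν) z) • chartRep x₀ ν z := by
  have hd : HasFDerivWithinAt (chartRep x₀ X) _ _ (z.1, z.2) :=
    ((contDiffOn_chartRep hX.smooth x₀).differentiableOn (by simp) z hz).hasFDerivWithinAt
  have h1 : HasDerivWithinAt (fun s : ℝ => (z.1, s)) (tDir n) (timeInterval T) z.2 :=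
    ((hasDerivAt_const z.2 z.1).prodMk (hasDerivAt_id z.2)).hasDerivWithinAt
  have h3 : MapsTo (fun s : ℝ => (z.1, s)) (timeInterval T)
    ((extChartAt (𝓡 n) x₀).target ×ˢ timeInterval T) := fun s hs => ⟨hz.1, hs⟩
  have h2 := hd.comp_hasDerivWithinAt z.2 h1 h3
  exact (uniqueDiffOn_timeInterval hT z.2 hz.2).eq_deriv _ h2
    (hX.flow z.2 hz.2 ((extChartAt (𝓡 n) x₀).symm z.1))

omit [IsManifold (𝓡 n) ∞ M] in
lemma norm_chartRep_normal (hX : IsEmbeddedSolution Γ f Ψ T X ν) (x₀ : M)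
    {z : EuclideanSpace ℝ (Fin n) × ℝ} (hz : z.2 ∈ timeInterval T) : ‖chartRep x₀ ν z‖ = 1 :=
  (hX.outward_normal z.2 hz).norm_eq_one _

/-- Continuity of F is read off from the flow rather than from the eigenvalues: Ψ(F) = -⟨∂ₜX, ν⟩ is
continuous and Ψ is strictly increasing. -/
lemma continuousOn_chartRep_speed (hX : IsEmbeddedSolution Γ f Ψ T X ν)
    (hf : IsAdmissibleSpeed Γ f) (hΨ : StrictMonoOn Ψ (Ioi 0)) (hT : 0 < T) (x₀ : M) :
    ContinuousOn (chartRep x₀ (speed f X ν)) ((extChartAt (𝓡 n) x₀).target ×ˢ timeInterval T) := by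
  set S := (extChartAt (𝓡 n) x₀).target ×ˢ timeInterval T with hS
  have hG := contDiffOn_chartRep hX.smooth x₀
  have hN := (contDiffOn_chartRep hX.smooth_normal x₀).continuousOn
  have hu : UniqueDiffOn ℝ S :=
    (isOpen_extChartAt_target x₀).uniqueDiffOn.prod (uniqueDiffOn_timeInterval hT)
  have hc : ContinuousOn (fun z => Ψ (chartRep x₀ (speed f X ν) z)) S := by
    have h1 : ContinuousOn (fun z => -inner ℝ (fderivWithin ℝ (chartRep x₀ X) S z (tDir n))
        (chartRep x₀ ν z) : _ → ℝ) S :=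
      (((hG.continuousOn_fderivWithin hu (by simp)).clm_apply continuousOn_const).inner hN).neg
    refine h1.congr fun z hz => ?_
    show Ψ _ = -inner ℝ (fderivWithin ℝ (chartRep x₀ X) S z (tDir n)) (chartRep x₀ ν z)
    rw [hS, hX.fderivWithin_time hT x₀ hz, real_inner_smul_left, real_inner_self_eq_norm_sq,
      hX.norm_chartRep_normal x₀ hz.2]
    ring
  intro z hz
  exact continuousWithinAt_of_strictMonoOn hΨ
    (eventually_nhdsWithin_of_forall fun y hy => hX.speed_pos hf hy.2 _)
    (hX.speed_pos hf hz.2 _) (hc z hz)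

lemma continuousOn_speed (hX : IsEmbeddedSolution Γ f Ψ T X ν)
    (hf : IsAdmissibleSpeed Γ f) (hΨ : StrictMonoOn Ψ (Ioi 0)) (hT : 0 < T) :
    ContinuousOn (fun q : M × ℝ => speed f X ν q.2 q.1) (univ ×ˢ timeInterval T) := by
  rintro ⟨x, t⟩ ⟨-, ht⟩
  have h1 := hX.continuousOn_chartRep_speed hf hΨ hT x (extChartAt (𝓡 n) x x, t)
    ⟨mem_extChartAt_target x, ht⟩
  have hsrc : (extChartAt (𝓡 n) x).source ∈ 𝓝 x := extChartAt_source_mem_nhds x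
  have h2 : ContinuousWithinAt (fun q : M × ℝ => (extChartAt (𝓡 n) x q.1, q.2))
      ((extChartAt (𝓡 n) x).source ×ˢ timeInterval T) (x, t) :=
    (ContinuousAt.prodMk (ContinuousAt.comp (f := Prod.fst) (x := (x, t))
      (g := extChartAt (𝓡 n) x) (continuousAt_extChartAt x) continuousAt_fst)
      continuousAt_snd).continuousWithinAt
  have h3 := ContinuousWithinAt.comp (t := (extChartAt (𝓡 n) x).target ×ˢ timeInterval T)
    (x := (x, t)) h1 h2 fun q hq => ⟨(extChartAt (𝓡 n) x).map_source hq.1, hq.2⟩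
  have h4 : ContinuousWithinAt (fun q : M × ℝ => speed f X ν q.2 q.1)
      ((extChartAt (𝓡 n) x).source ×ˢ timeInterval T) (x, t) := by
    refine h3.congr (fun q hq => ?_) ?_
    · simp only [chartRep, Function.comp_apply]
      rw [(extChartAt (𝓡 n) x).left_inv hq.1]
    · simp [chartRep]
  refine h4.mono_of_mem_nhdsWithin ?_
  rw [nhdsWithin_prod_eq, nhdsWithin_univ]
  exact prod_mem_prod hsrc self_mem_nhdsWithin

lemma continuousOn_pairFn (hX : IsEmbeddedSolution Γ f Ψ T X ν)
    (hf : IsAdmissibleSpeed Γ f) (hΨ : StrictMonoOn Ψ (Ioi 0)) (hT : 0 < T) (hθ : Continuous θ) :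
    ContinuousOn (fun q : (M × M) × ℝ => pairFn θ f X ν q.2 q.1.1 q.1.2)
      (univ ×ˢ timeInterval T) := by
  have m1 : MapsTo (fun q : (M × M) × ℝ => (q.1.1, q.2)) (univ ×ˢ timeInterval T)
    (univ ×ˢ timeInterval T) := fun q hq => ⟨trivial, hq.2⟩
  have m2 : MapsTo (fun q : (M × M) × ℝ => (q.1.2, q.2)) (univ ×ˢ timeInterval T)
    (univ ×ˢ timeInterval T) := fun q hq => ⟨trivial, hq.2⟩
  have c1 : Continuous (fun q : (M × M) × ℝ => (q.1.1, q.2)) := by fun_prop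
  have c2 : Continuous (fun q : (M × M) × ℝ => (q.1.2, q.2)) := by fun_prop
  have hx := hX.smooth.continuousOn.comp c1.continuousOn m1
  have hy := hX.smooth.continuousOn.comp c2.continuousOn m2
  have hn := hX.smooth_normal.continuousOn.comp c1.continuousOn m1
  have hs := (hX.continuousOn_speed hf hΨ hT).comp c1.continuousOn m1
  have hd := hx.sub hy
  unfold pairFn twoPoint
  exact ((hd.inner hn).const_mul 2).add
    ((((hθ.comp continuous_snd).continuousOn).mul hs).mul (hd.norm.pow 2))

/-- Near the diagonal the two-point function is given to second order by `diagForm`. -/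
lemma pairFn_near_diagonal (hX : IsEmbeddedSolution Γ f Ψ T X ν)
    (hf : IsAdmissibleSpeed Γ f) (hΨ : StrictMonoOn Ψ (Ioi 0)) (hT : 0 < T) (hθ : Continuous θ)
    (x₀ : M) {t₀ : ℝ} (ht₀ : t₀ ∈ timeInterval T) {η : ℝ} (hη : 0 < η) :
    ∃ r > 0, ∀ p ∈ Metric.ball (extChartAt (𝓡 n) x₀ x₀) r,
      ∀ q ∈ Metric.ball (extChartAt (𝓡 n) x₀ x₀) r, ∀ t ∈ timeInterval T, |t - t₀| < r →
      |pairFn θ f X ν t ((extChartAt (𝓡 n) x₀).symm p) ((extChartAt (𝓡 n) x₀).symm q)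
        - diagForm θ f X ν t₀ x₀ (q - p)| ≤ η * ‖q - p‖ ^ 2 := by
  set ψ := extChartAt (𝓡 n) x₀ with hψ
  have hU : IsOpen ψ.target := isOpen_extChartAt_target x₀
  have hp₀ : ψ x₀ ∈ ψ.target := mem_extChartAt_target x₀
  have hG := contDiffOn_chartRep hX.smooth x₀
  have hN := contDiffOn_chartRep hX.smooth_normal x₀
  have hI := uniqueDiffOn_timeInterval hT
  have hz₀ : (ψ x₀, t₀) ∈ ψ.target ×ˢ timeInterval T := ⟨hp₀, ht₀⟩
  have hφ : ContinuousOn (fun z : EuclideanSpace ℝ (Fin n) × ℝ =>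
      θ z.2 * chartRep x₀ (speed f X ν) z) (ψ.target ×ˢ timeInterval T) :=
    ((hθ.comp continuous_snd).continuousOn).mul (hX.continuousOn_chartRep_speed hf hΨ hT x₀)
  have hperp : ∀ z ∈ ψ.target ×ˢ timeInterval T, ∀ v,
      inner ℝ (((fderivWithin ℝ (chartRep x₀ X) (ψ.target ×ˢ timeInterval T) z).comp
        (ContinuousLinearMap.inl ℝ _ ℝ)) v) (chartRep x₀ ν z) = (0 : ℝ) := by
    intro z hz v
    have hd : MDifferentiableAt 𝓘(ℝ, EuclideanSpace ℝ (Fin n)) (𝓡 n) ψ.symm z.1 :=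
      ((contMDiffOn_extChartAt_symm (n := ∞) x₀).contMDiffAt
        (hU.mem_nhds hz.1)).mdifferentiableAt (by simp)
    have h1 := fderiv_comp_differential (hX.mdifferentiableAt hz.2 (ψ.symm z.1)) hd v
    rw [← (hasFDerivAt_slice hU hG hz).fderiv]
    rw [show fderiv ℝ (fun p => chartRep x₀ X (p, z.2)) z.1 v
      = fderiv ℝ (X z.2 ∘ ψ.symm) z.1 v from rfl, h1]
    exact (hX.outward_normal z.2 hz.2).normal _ _
  obtain ⟨r, hr, h⟩ := twoPoint_near_diagonal hU (fun z hz => hasFDerivAt_slice hU hG hz)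
    (fun z hz => hasFDerivAt_slice hU hN hz) hperp hp₀
    (continuousOn_slice_fderiv hU hI hG _ hz₀) (continuousOn_slice_fderiv hU hI hN _ hz₀)
    (hφ _ hz₀) hη
  refine ⟨r, hr, fun p hp q hq t ht htt => ?_⟩
  have := h p hp q hq t ht htt
  have eG := (hasFDerivAt_slice hU hG hz₀).fderiv
  have eN := (hasFDerivAt_slice hU hN hz₀).fderiv
  rw [fderiv_chartRep_center (hX.mdifferentiableAt ht₀ x₀)] at eG
  rw [fderiv_chartRep_center (hX.mdifferentiableAt_normal ht₀ x₀)] at eN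
  rw [← eG, ← eN] at this
  have e0 : chartRep x₀ (speed f X ν) (ψ x₀, t₀) = speed f X ν t₀ x₀ := by simp [chartRep, hψ]
  simp only [e0] at this
  exact this

lemma diagForm_nonneg (hX : IsEmbeddedSolution Γ f Ψ T X ν)
    (hf : IsAdmissibleSpeed Γ f) (hΨ : StrictMonoOn Ψ (Ioi 0)) (hT : 0 < T) (hθ : Continuous θ)
    (ht : t ∈ timeInterval T) (h : ∀ x y, 0 ≤ pairFn θ f X ν t x y) (x : M)
    (v : EuclideanSpace ℝ (Fin n)) : 0 ≤ diagForm θ f X ν t x v := by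
  by_contra! hneg
  have hv : v ≠ 0 := by rintro rfl; simp [diagForm] at hneg
  have hv0 : 0 < ‖v‖ := norm_pos_iff.2 hv
  -- With this η the error is half of the negative quadratic term along v, so the two-point function
  -- would be negative at a nearby pair.
  set η := -diagForm θ f X ν t x v / (2 * ‖v‖ ^ 2) with hη
  have hη0 : 0 < η := div_pos (by linarith) (by positivity)
  obtain ⟨r, hr, hb⟩ := hX.pairFn_near_diagonal hf hΨ hT hθ x ht hη0
  set s := r / (2 * ‖v‖) with hs
  have hs0 : 0 < s := by positivity
  have h1 := hb _ (Metric.mem_ball_self hr) (extChartAt (𝓡 n) x x + s • v) (by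
    rw [mem_ball_iff_norm, add_sub_cancel_left, norm_smul, Real.norm_eq_abs, abs_of_pos hs0, hs,
      show r / (2 * ‖v‖) * ‖v‖ = r / 2 by field_simp]
    linarith) t ht (by simpa using hr)
  rw [add_sub_cancel_left, diagForm_smul, norm_smul, mul_pow, Real.norm_eq_abs, sq_abs] at h1
  have h2 := (abs_le.1 h1).2
  have h3 := h ((extChartAt (𝓡 n) x).symm (extChartAt (𝓡 n) x x))
    ((extChartAt (𝓡 n) x).symm (extChartAt (𝓡 n) x x + s • v))
  have h4 : η * (s ^ 2 * ‖v‖ ^ 2) = s ^ 2 * (-diagForm θ f X ν t x v / 2) := by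
    rw [hη]; field_simp
  rw [h4] at h2
  have : 0 < s ^ 2 * (-diagForm θ f X ν t x v / 2) := mul_pos (by positivity) (by linarith)
  linarith

/-- Where `diagForm` is positive, the two-point function is positive near the diagonal. -/
lemma eventually_pairFn_pos (hX : IsEmbeddedSolution Γ f Ψ T X ν)
    (hf : IsAdmissibleSpeed Γ f) (hΨ : StrictMonoOn Ψ (Ioi 0)) (hT : 0 < T) (hθ : Continuous θ)
    (ht : t ∈ timeInterval T) {x : M} (h : ∀ v, v ≠ 0 → 0 < diagForm θ f X ν t x v) :
    ∀ᶠ q in 𝓝 ((x, x), t), q.2 ∈ timeInterval T → q.1.1 ≠ q.1.2 →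
      0 < pairFn θ f X ν q.2 q.1.1 q.1.2 := by
  obtain ⟨c, hc, hcv⟩ := exists_diagForm_ge h
  obtain ⟨r, hr, hb⟩ := hX.pairFn_near_diagonal hf hΨ hT hθ x ht (half_pos hc)
  set ψ := extChartAt (𝓡 n) x
  have hN : ψ.source ∩ ψ ⁻¹' Metric.ball (ψ x) r ∈ 𝓝 x :=
    inter_mem (extChartAt_source_mem_nhds x)
      ((continuousAt_extChartAt x).preimage_mem_nhds (Metric.ball_mem_nhds _ hr))
  have hmem : ((ψ.source ∩ ψ ⁻¹' Metric.ball (ψ x) r) ×ˢ (ψ.source ∩ ψ ⁻¹' Metric.ball (ψ x) r))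
      ×ˢ Metric.ball t r ∈ 𝓝 ((x, x), t) :=
    prod_mem_nhds (prod_mem_nhds hN hN) (Metric.ball_mem_nhds _ hr)
  filter_upwards [hmem] with q hq hqt hne
  have h1 := hb _ hq.1.1.2 _ hq.1.2.2 q.2 hqt (by simpa [Real.dist_eq] using hq.2)
  rw [ψ.left_inv hq.1.1.1, ψ.left_inv hq.1.2.1] at h1
  have h2 := hcv (ψ q.1.2 - ψ q.1.1)
  have h3 : 0 < ‖ψ q.1.2 - ψ q.1.1‖ := by
    rw [norm_pos_iff, sub_ne_zero]
    exact fun he => hne (ψ.injOn hq.1.2.1 hq.1.1.1 he).symm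
  have h4 := (abs_le.1 h1).1
  have : 0 < c / 2 * ‖ψ q.1.2 - ψ q.1.1‖ ^ 2 := by positivity
  linarith

end IsEmbeddedSolution

end TwoPointFunction

/-! ### Initial noncollapsing and the first touching time -/

section FirstTouching

variable {n : ℕ} {M : Type*} [TopologicalSpace M] [ChartedSpace (EuclideanSpace ℝ (Fin n)) M]
  {Γ : Set (Fin n → ℝ)} {f : (Fin n → ℝ) → ℝ} {Ψ : ℝ → ℝ} {T : EReal}
  {X ν : ℝ → M → EuclideanSpace ℝ (Fin (n + 1))} {t : ℝ} {θ : ℝ → ℝ}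

lemma pairFn_add (θ' : ℝ → ℝ) (t : ℝ) (x y : M) :
    pairFn (fun s => θ s + θ' s) f X ν t x y
      = pairFn θ f X ν t x y + θ' t * speed f X ν t x * ‖X t x - X t y‖ ^ 2 := by
  simp only [pairFn, twoPoint]
  ring

lemma diagForm_add (θ' : ℝ → ℝ) (t : ℝ) (x : M) (v : EuclideanSpace ℝ (Fin n)) :
    diagForm (fun s => θ s + θ' s) f X ν t x v
      = diagForm θ f X ν t x v + θ' t * speed f X ν t x * ‖differential (X t) x v‖ ^ 2 := by
  simp only [diagForm]
  ring

lemma diagForm_eq_sum {x : M} {κ : Fin n → ℝ} {e : Fin n → EuclideanSpace ℝ (Fin n)}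
    (h : IsPrincipalFrame
      (differential (X t) x : EuclideanSpace ℝ (Fin n) →ₗ[ℝ] EuclideanSpace ℝ (Fin (n + 1)))
      (differential (ν t) x : EuclideanSpace ℝ (Fin n) →ₗ[ℝ] EuclideanSpace ℝ (Fin (n + 1))) κ e)
    (v : EuclideanSpace ℝ (Fin n)) :
    diagForm θ f X ν t x v = ∑ j, (κ j + θ t * speed f X ν t x)
      * inner ℝ (differential (X t) x (e j)) (differential (X t) x v) ^ 2 := by
  have h1 := h.inner_second v v
  have h2 := h.inner_map v v
  rw [real_inner_self_eq_norm_sq] at h2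
  simp only [ContinuousLinearMap.coe_coe] at h1 h2
  rw [diagForm, h1, h2, Finset.mul_sum, ← Finset.sum_add_distrib]
  exact Finset.sum_congr rfl fun j _ => by ring

namespace IsEmbeddedSolution

lemma injective (hX : IsEmbeddedSolution Γ f Ψ T X ν) (ht : t ∈ timeInterval T) :
    Function.Injective (X t) := (hX.embedding t ht).isEmbedding.injective

lemma norm_sub_pos (hX : IsEmbeddedSolution Γ f Ψ T X ν) (ht : t ∈ timeInterval T) {x y : M}
    (hxy : x ≠ y) : 0 < ‖X t x - X t y‖ :=
  norm_pos_iff.2 (sub_ne_zero.2 ((hX.injective ht).ne hxy))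

lemma le_exscribedCurvature_iff (hX : IsEmbeddedSolution Γ f Ψ T X ν) (ht : t ∈ timeInterval T)
    (β : ℝ) (x : M) :
    ((-β * speed f X ν t x : ℝ) : EReal) ≤ exscribedCurvature (X t) (ν t) x
      ↔ ∀ y, 0 ≤ pairFn (fun _ => β) f X ν t x y := by
  rw [exscribedCurvature, le_iInf_iff]
  constructor
  · intro h y
    rcases eq_or_ne x y with rfl | hxy
    · exact (pairFn_self t x).ge
    · have h1 := EReal.coe_le_coe_iff.1 (h ⟨y, hxy.symm⟩)
      have := hX.norm_sub_pos ht hxy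
      rw [ballCurvature, le_div_iff₀ (by positivity)] at h1
      rw [pairFn, twoPoint]
      linarith
  · rintro h ⟨y, hy⟩
    have h1 := h y
    have := hX.norm_sub_pos ht hy.symm
    rw [EReal.coe_le_coe_iff, ballCurvature, le_div_iff₀ (by positivity)]
    rw [pairFn, twoPoint] at h1
    linarith

variable [IsManifold (𝓡 n) ∞ M] [CompactSpace M]

omit [CompactSpace M] in
lemma exists_diagForm_pos (hX : IsEmbeddedSolution Γ f Ψ T X ν) (hf : IsAdmissibleSpeed Γ f)
    (ht : t ∈ timeInterval T) (x : M) :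
    ∃ b > 0, ∀ v, v ≠ 0 → 0 < diagForm (fun _ => b) f X ν t x v := by
  obtain ⟨e, he⟩ := hX.exists_principalFrame ht x
  set κ := principalCurvatures (X t) (ν t) x
  have hF := hX.speed_pos hf ht x
  have hs : 0 ≤ ∑ i, |κ i| := Finset.sum_nonneg fun _ _ => abs_nonneg _
  -- This choice makes every κⱼ + bF at least 1, so the form dominates the metric.
  refine ⟨(∑ i, |κ i| + 1) / speed f X ν t x, by positivity, fun v hv => ?_⟩
  rw [diagForm_eq_sum he, div_mul_cancel₀ _ hF.ne']
  have h2 := he.inner_map v v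
  rw [real_inner_self_eq_norm_sq] at h2
  simp only [ContinuousLinearMap.coe_coe] at h2
  have h3 : 0 < ‖differential (X t) x v‖ :=
    norm_pos_iff.2 fun h => hv (hX.differential_injective ht x (by rw [h, map_zero]))
  refine lt_of_lt_of_le (by positivity : 0 < ‖differential (X t) x v‖ ^ 2) ?_
  rw [h2]
  refine Finset.sum_le_sum fun j _ => ?_
  have h4 : |κ j| ≤ ∑ i, |κ i| :=
    Finset.single_le_sum (f := fun i => |κ i|) (fun _ _ => abs_nonneg _) (Finset.mem_univ j)
  have h5 := neg_abs_le (κ j)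
  rw [← sq]
  exact le_mul_of_one_le_left (sq_nonneg _) (by linarith)

/-- A compact embedded hypersurface is exterior noncollapsed for some constant. -/
lemma exists_pairFn_nonneg (hX : IsEmbeddedSolution Γ f Ψ T X ν) (hf : IsAdmissibleSpeed Γ f)
    (hΨ : StrictMonoOn Ψ (Ioi 0)) (hT : 0 < T) :
    ∃ b > 0, ∀ x y, 0 ≤ pairFn (fun _ => b) f X ν 0 x y := by
  have h0 := zero_mem_timeInterval hT
  have hmono : ∀ {b b' : ℝ} (x y : M), b ≤ b' →
      pairFn (fun _ => b) f X ν 0 x y ≤ pairFn (fun _ => b') f X ν 0 x y := by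
    intro b b' x y hb
    have h1 := pairFn_add (θ := fun _ => b) (f := f) (X := X) (ν := ν) (fun _ => b' - b) 0 x y
    simp only [add_sub_cancel] at h1
    rw [h1]
    have := hX.speed_pos hf h0 x
    have := sub_nonneg.2 hb
    have : 0 ≤ (b' - b) * speed f X ν 0 x * ‖X 0 x - X 0 y‖ ^ 2 := by positivity
    linarith
  suffices h : ∃ b > 0, ∀ q ∈ (univ : Set (M × M)), 0 ≤ pairFn (fun _ => b) f X ν 0 q.1 q.2 by
    obtain ⟨b, hb, h⟩ := h
    exact ⟨b, hb, fun x y => h (x, y) trivial⟩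
  -- Z is monotone in b, so constants valid on finitely many sets can be replaced by their maximum;
  -- it remains to find one near each pair, on and off the diagonal.
  refine isCompact_univ.induction_on (p := fun S : Set (M × M) =>
    ∃ b > 0, ∀ q ∈ S, 0 ≤ pairFn (fun _ => b) f X ν 0 q.1 q.2) ⟨1, one_pos, by simp⟩ ?_ ?_ ?_
  · rintro S S' hS ⟨b, hb, h⟩
    exact ⟨b, hb, fun q hq => h q (hS hq)⟩
  · rintro S S' ⟨b, hb, h⟩ ⟨b', hb', h'⟩
    refine ⟨max b b', lt_max_of_lt_left hb, fun q hq => ?_⟩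
    rcases hq with hq | hq
    · exact (h q hq).trans (hmono _ _ (le_max_left _ _))
    · exact (h' q hq).trans (hmono _ _ (le_max_right _ _))
  · rintro ⟨x, y⟩ -
    simp only [nhdsWithin_univ]
    have hlift : Tendsto (fun q : M × M => (q, (0 : ℝ))) (𝓝 (x, y)) (𝓝 ((x, y), 0)) :=
      (continuous_id.prodMk continuous_const).tendsto _
    rcases eq_or_ne x y with rfl | hxy
    · obtain ⟨b, hb, h⟩ := hX.exists_diagForm_pos hf h0 x
      refine ⟨_, hlift.eventually
        (hX.eventually_pairFn_pos hf hΨ hT continuous_const h0 h), b, hb, fun q hq => ?_⟩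
      by_cases hne : q.1 = q.2
      · rw [hne, pairFn_self]
      · exact (hq h0 hne).le
    · have hd := hX.norm_sub_pos h0 hxy
      have hF := hX.speed_pos hf h0 x
      set A := 2 * inner ℝ (X 0 x - X 0 y) (ν 0 x) with hA
      have hA0 : 0 ≤ |A| := abs_nonneg A
      -- For this b the value of Z at (x,y) is A + |A| + 1.
      set b := (|A| + 1) / (speed f X ν 0 x * ‖X 0 x - X 0 y‖ ^ 2) with hb
      have hb0 : 0 < b := by positivity
      have hpos : 0 < pairFn (fun _ => b) f X ν 0 x y := by
        rw [pairFn, twoPoint, mul_assoc b, hb, div_mul_cancel₀ _ (by positivity), ← hA]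
        linarith [neg_abs_le A]
      have hc := hX.continuousOn_pairFn hf hΨ hT (θ := fun _ => b) continuous_const ((x, y), 0)
        ⟨trivial, h0⟩
      have hlift' : Tendsto (fun q : M × M => (q, (0 : ℝ))) (𝓝 (x, y))
          (𝓝[univ ×ˢ timeInterval T] ((x, y), 0)) :=
        tendsto_nhdsWithin_iff.2 ⟨hlift, Eventually.of_forall fun q => ⟨trivial, h0⟩⟩
      exact ⟨_, (hc.tendsto.comp hlift').eventually (lt_mem_nhds hpos), b, hb0,
        fun q hq => le_of_lt hq⟩

/-- If the two-point function becomes negative, then there is a first time at which it either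
vanishes off the diagonal or degenerates to second order on the diagonal. -/
lemma exists_first_touching (hX : IsEmbeddedSolution Γ f Ψ T X ν) (hf : IsAdmissibleSpeed Γ f)
    (hΨ : StrictMonoOn Ψ (Ioi 0)) (hT : 0 < T) (hθ : Continuous θ) {t₁ : ℝ}
    (ht₁ : t₁ ∈ timeInterval T)
    (h0 : ∀ x y, x ≠ y → 0 < pairFn θ f X ν 0 x y)
    (h0' : ∀ x v, v ≠ 0 → 0 < diagForm θ f X ν 0 x v)
    {x₁ y₁ : M} (hneg : pairFn θ f X ν t₁ x₁ y₁ < 0) :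
    ∃ t₀ ∈ timeInterval T, 0 < t₀ ∧
      (∀ t ∈ timeInterval T, t ≤ t₀ → ∀ x y, 0 ≤ pairFn θ f X ν t x y) ∧
      ((∃ x y, x ≠ y ∧ pairFn θ f X ν t₀ x y = 0) ∨
        ∃ x v, v ≠ 0 ∧ diagForm θ f X ν t₀ x v ≤ 0) := by
  -- The diagonal, where Z vanishes identically, is removed; S need not be closed, so time is
  -- minimised over its closure.
  set S : Set ((M × M) × ℝ) :=
    {q | q.1.1 ≠ q.1.2 ∧ q.2 ∈ Icc 0 t₁ ∧ pairFn θ f X ν q.2 q.1.1 q.1.2 ≤ 0} with hS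
  have hI := Icc_subset_timeInterval ht₁
  have hSne : (closure S).Nonempty := by
    refine ⟨((x₁, y₁), t₁), subset_closure ⟨?_, ⟨ht₁.1, le_rfl⟩, hneg.le⟩⟩
    rintro h
    simp only at h
    rw [h, pairFn_self] at hneg
    exact lt_irrefl _ hneg
  have hSub : closure S ⊆ univ ×ˢ Icc 0 t₁ :=
    closure_minimal (fun q hq => ⟨trivial, hq.2.1⟩) (isClosed_univ.prod isClosed_Icc)
  have hSc : IsCompact (closure S) :=
    (isCompact_univ.prod isCompact_Icc).of_isClosed_subset isClosed_closure hSub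
  obtain ⟨⟨⟨x, y⟩, t₀⟩, hq, hmin⟩ := hSc.exists_isMinOn hSne continuous_snd.continuousOn
  have ht₀ : t₀ ∈ timeInterval T := hI (hSub hq).2
  have hbot : (𝓝[S] ((x, y), t₀)).NeBot := mem_closure_iff_nhdsWithin_neBot.1 hq
  have hcont := hX.continuousOn_pairFn hf hΨ hT hθ
  have hSI : S ⊆ univ ×ˢ timeInterval T := fun q hq => ⟨trivial, hI hq.2.1⟩
  have hle : pairFn θ f X ν t₀ x y ≤ 0 :=
    le_of_tendsto ((hcont ((x, y), t₀) ⟨trivial, ht₀⟩).mono hSI)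
      (eventually_nhdsWithin_of_forall fun q (hq : q ∈ S) => hq.2.2)
  -- If points of S accumulate at the diagonal, the quadratic form cannot be positive definite
  -- there, since then Z would be positive at all nearby off-diagonal pairs.
  have hdeg : x = y → ∃ x v, v ≠ 0 ∧ diagForm θ f X ν t₀ x v ≤ 0 := by
    rintro rfl
    by_contra! h
    obtain ⟨q, hq1, hq2⟩ := ((eventually_nhdsWithin_of_forall (s := S) fun q hq => hq).and
      ((hX.eventually_pairFn_pos hf hΨ hT hθ ht₀ (h x)).filter_mono nhdsWithin_le_nhds)).exists
    exact (hq2 (hI hq1.2.1) hq1.1).not_ge hq1.2.2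
  have hpos : 0 < t₀ := by
    refine lt_of_le_of_ne ht₀.1 fun h => ?_
    subst h
    by_cases hxy : x = y
    · obtain ⟨x, v, hv, h⟩ := hdeg hxy
      exact (h0' x v hv).not_ge h
    · exact (h0 x y hxy).not_ge hle
  have hlt : ∀ t ∈ timeInterval T, t < t₀ → ∀ x y, 0 ≤ pairFn θ f X ν t x y := by
    intro t ht htt x' y'
    by_contra! h
    have hne : x' ≠ y' := by rintro rfl; rw [pairFn_self] at h; exact lt_irrefl _ h
    have : t₀ ≤ t := hmin (subset_closure
      (⟨hne, ⟨ht.1, htt.le.trans (hSub hq).2.2⟩, h.le⟩ : ((x', y'), t) ∈ S))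
    linarith
  -- At t₀ itself nonnegativity follows by continuity from earlier times.
  have hall : ∀ t ∈ timeInterval T, t ≤ t₀ → ∀ x y, 0 ≤ pairFn θ f X ν t x y := by
    intro t ht htt x' y'
    rcases htt.lt_or_eq with h | rfl
    · exact hlt t ht h x' y'
    · have hsub : Ioo 0 t ⊆ timeInterval T := Ioo_subset_Icc_self.trans (Icc_subset_timeInterval ht)
      have : (𝓝[Ioo 0 t] t).NeBot := by
        rw [← mem_closure_iff_nhdsWithin_neBot, closure_Ioo hpos.ne]
        exact ⟨hpos.le, le_rfl⟩
      have hlift : Tendsto (fun s : ℝ => ((x', y'), s)) (𝓝[Ioo 0 t] t)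
          (𝓝[univ ×ˢ timeInterval T] ((x', y'), t)) :=
        tendsto_nhdsWithin_iff.2 ⟨((continuous_const.prodMk continuous_id).tendsto _).mono_left
          nhdsWithin_le_nhds, eventually_nhdsWithin_of_forall fun s hs => ⟨trivial, hsub hs⟩⟩
      exact ge_of_tendsto ((hcont ((x', y'), t) ⟨trivial, ht⟩).tendsto.comp hlift)
        (eventually_nhdsWithin_of_forall fun s hs => hlt s (hsub hs) hs.2 x' y')
  refine ⟨t₀, ht₀, hpos, hall, ?_⟩
  by_cases hxy : x = y
  · exact Or.inr (hdeg hxy)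
  · exact Or.inl ⟨x, y, hxy, le_antisymm hle (hall t₀ ht₀ le_rfl x y)⟩

end IsEmbeddedSolution

end FirstTouching

/-! ### Linear algebra and calculus of graphs over a hyperplane -/

section LocalGraph

variable {n : ℕ}

/-- Multiplication by a bump function; it lets the local graph functions be treated as globally
smooth. -/
lemma exists_contDiff_eventuallyEq {W V : Type*} [NormedAddCommGroup W] [NormedSpace ℝ W]
    [FiniteDimensional ℝ W] [NormedAddCommGroup V] [NormedSpace ℝ V] {k : ℕ} {g : W → V} {p : W}
    (hg : ContDiffAt ℝ k g p) : ∃ g' : W → V, ContDiff ℝ k g' ∧ g' =ᶠ[𝓝 p] g := by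
  have hev : ∀ᶠ z in 𝓝 p, ContDiffAt ℝ k g z := hg.eventually (by simp)
  obtain ⟨r, hr, h⟩ := Metric.eventually_nhds_iff_ball.1 hev
  let φ : ContDiffBump p := ⟨r / 3, r / 2, by positivity, by linarith⟩
  refine ⟨fun z => φ z • g z, contDiff_iff_contDiffAt.2 fun z => ?_, ?_⟩
  · by_cases hz : z ∈ Metric.ball p r
    · exact φ.contDiffAt.smul (h z hz)
    · have hz' : z ∉ tsupport φ := by
        rw [φ.tsupport_eq]
        intro hz'
        refine hz (Metric.closedBall_subset_ball ?_ hz')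
        change r / 2 < r
        linarith
      have : (fun z => φ z • g z) =ᶠ[𝓝 z] fun _ => 0 := by
        filter_upwards [notMem_tsupport_iff_eventuallyEq.1 hz'] with y hy
        rw [hy, Pi.zero_apply, zero_smul]
      exact contDiffAt_const.congr_of_eventuallyEq this
  · filter_upwards [φ.eventuallyEq_one] with z hz
    rw [hz, Pi.one_apply, one_smul]

variable {b : Fin n → EuclideanSpace ℝ (Fin (n + 1))} {ν : EuclideanSpace ℝ (Fin (n + 1))}

lemma eq_sum_frame (hb : ∀ i j, inner ℝ (b i) (b j) = if i = j then (1 : ℝ) else 0)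
    (hν : ‖ν‖ = 1) (hbν : ∀ i, inner ℝ (b i) ν = (0 : ℝ)) (y : EuclideanSpace ℝ (Fin (n + 1))) :
    y = ∑ i, (inner ℝ (b i) y : ℝ) • b i + (inner ℝ y ν : ℝ) • ν := by
  have hlin : LinearIndependent ℝ b := Orthonormal.linearIndependent (orthonormal_iff_ite.2 hb)
  set B : EuclideanSpace ℝ (Fin n) →ₗ[ℝ] EuclideanSpace ℝ (Fin (n + 1)) :=
    Fintype.linearCombination ℝ b ∘ₗ (WithLp.linearEquiv 2 ℝ (Fin n → ℝ)).toLinearMap with hB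
  have hBv : ∀ v, B v = ∑ i, v i • b i := fun v => by
    simp [hB, Fintype.linearCombination_apply]
  have hinj : Function.Injective B :=
    (linearIndependent_iff_injective_fintypeLinearCombination.1 hlin).comp (LinearEquiv.injective _)
  obtain ⟨v, hv⟩ := mem_range_of_inner_eq_zero hinj hν
    (fun v => by rw [hBv, sum_inner]; simp [real_inner_smul_left, hbν])
    (y := y - (inner ℝ y ν : ℝ) • ν) (by
      rw [inner_sub_left, real_inner_smul_left, real_inner_self_eq_norm_sq, hν]; ring)
  have hy : y = ∑ i, v i • b i + (inner ℝ y ν : ℝ) • ν := by rw [← hBv, hv, sub_add_cancel]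
  have hvi : ∀ i, inner ℝ (b i) y = v i := fun i => by
    rw [hy, inner_add_right, inner_sum]
    simp [inner_smul_right, hb, hbν]
  simp only [hvi]
  exact hy

/-- Orthogonality to the tangent vectors bᵢ + Wᵢν makes N a multiple of ν - ∑ Wⱼbⱼ; its norm and the
sign of ⟨N,ν⟩ fix the factor. -/
lemma eq_normal_of_inner_eq_zero
    (hb : ∀ i j, inner ℝ (b i) (b j) = if i = j then (1 : ℝ) else 0)
    (hν : ‖ν‖ = 1) (hbν : ∀ i, inner ℝ (b i) ν = (0 : ℝ)) {N : EuclideanSpace ℝ (Fin (n + 1))}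
    (hN : ‖N‖ = 1) {W : Fin n → ℝ} (hW : ∀ i, inner ℝ (b i + W i • ν) N = (0 : ℝ))
    (hpos : 0 < (inner ℝ N ν : ℝ)) :
    N = (areaElement W)⁻¹ • (ν - ∑ j, W j • b j) ∧ inner ℝ N ν = (areaElement W)⁻¹ := by
  set c : ℝ := inner ℝ N ν with hc
  have h1 : ∀ i, inner ℝ (b i) N = -(W i * c) := fun i => by
    have := hW i
    rw [inner_add_left, real_inner_smul_left, real_inner_comm N ν, ← hc] at this
    linarith
  have h2 : N = c • (ν - ∑ j, W j • b j) := by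
    conv_lhs => rw [eq_sum_frame hb hν hbν N, ← hc]
    simp only [h1, smul_sub, Finset.smul_sum, neg_smul, Finset.sum_neg_distrib, smul_smul,
      mul_comm c]
    abel
  have h3 : c * areaElement W = 1 := by
    have hn : inner ℝ (c • (ν - ∑ j, W j • b j)) N = (1 : ℝ) := by
      rw [← h2, real_inner_self_eq_norm_sq, hN, one_pow]
    rw [real_inner_smul_left, inner_sub_left, sum_inner] at hn
    simp only [real_inner_smul_left, h1] at hn
    rw [real_inner_comm N ν, ← hc] at hn
    have h4 : c * (c - ∑ i, W i * -(W i * c)) = (c * areaElement W) ^ 2 := by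
      rw [mul_pow, areaElement_sq]
      have : ∑ i, W i * -(W i * c) = -(c * ∑ i, W i ^ 2) := by
        rw [Finset.mul_sum, ← Finset.sum_neg_distrib]
        exact Finset.sum_congr rfl fun i _ => by ring
      rw [this]; ring
    rw [h4] at hn
    have := mul_pos hpos (areaElement_pos W)
    exact (pow_eq_one_iff_of_nonneg this.le two_ne_zero).1 hn
  have h4 : c = (areaElement W)⁻¹ := eq_inv_of_mul_eq_one_left h3
  exact ⟨h4 ▸ h2, h4⟩

lemma inner_frame (hb : ∀ i j, inner ℝ (b i) (b j) = if i = j then (1 : ℝ) else 0)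
    (hν : ‖ν‖ = 1) (hbν : ∀ i, inner ℝ (b i) ν = (0 : ℝ)) (u v : Fin n → ℝ) (r s : ℝ) :
    inner ℝ (∑ i, u i • b i + r • ν) (∑ i, v i • b i + s • ν) = ∑ i, u i * v i + r * s := by
  have hνb : ∀ i, inner ℝ ν (b i) = (0 : ℝ) := fun i => by rw [real_inner_comm]; exact hbν i
  have hνν : inner ℝ ν ν = (1 : ℝ) := by rw [real_inner_self_eq_norm_sq, hν, one_pow]
  simp only [inner_add_left, inner_add_right, sum_inner, inner_sum, real_inner_smul_left,
    inner_smul_right, hb, hbν, hνb, hνν]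
  simp [mul_comm]

lemma dd_spatial (w : EuclideanSpace ℝ (Fin n) × ℝ → ℝ) (z : EuclideanSpace ℝ (Fin n) × ℝ)
    (u : EuclideanSpace ℝ (Fin n)) : dd (u, (0 : ℝ)) w z = ∑ i, u i * grad w z i := by
  have hu : (u, (0 : ℝ)) = ∑ i, u i • xDir i := by
    refine Prod.ext ?_ ?_
    · rw [Prod.fst_sum]
      ext j
      simp [xDir, Finset.sum_apply, Pi.single_apply]
    · rw [Prod.snd_sum]; simp
  simp only [grad, dd]
  rw [hu, map_sum]
  simp

lemma dd_dd_spatial {w : EuclideanSpace ℝ (Fin n) × ℝ → ℝ} (hw : ContDiff ℝ 4 w)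
    (z : EuclideanSpace ℝ (Fin n) × ℝ) (u v : EuclideanSpace ℝ (Fin n)) :
    dd (u, (0 : ℝ)) (dd (v, (0 : ℝ)) w) z = ∑ i, ∑ j, u i * v j * hess w z i j := by
  rw [dd_spatial]
  refine Finset.sum_congr rfl fun i _ => ?_
  have h : dd (v, (0 : ℝ)) w = fun z => ∑ j, v j * dd (xDir j) w z :=
    funext fun z => dd_spatial w z v
  have hd : ∀ j, DifferentiableAt ℝ (dd (xDir j) w) z := fun j =>
    ((contDiff_dd (m := 3) _ hw (by norm_num)).differentiable (by simp)) z
  rw [grad, h, dd, fderiv_fun_sum fun j _ => (hd j).const_mul _, sum_apply, Finset.mul_sum]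
  refine Finset.sum_congr rfl fun j _ => ?_
  rw [fderiv_const_mul (hd j)]
  simp only [hess, dd, smul_apply, smul_eq_mul]
  ring

lemma dd_graphPoint {V : Type*} [NormedAddCommGroup V] [InnerProductSpace ℝ V] (b : Fin n → V)
    (ν : V) {w : EuclideanSpace ℝ (Fin n) × ℝ → ℝ} {z : EuclideanSpace ℝ (Fin n) × ℝ}
    (hw : DifferentiableAt ℝ w z) (c : V) (v : EuclideanSpace ℝ (Fin n) × ℝ) :
    dd v (fun z => c + graphPoint b ν w z) z = ∑ j, v.1 j • b j + dd v w z • ν := by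
  have h1 : ∀ j, HasFDerivAt (fun z : EuclideanSpace ℝ (Fin n) × ℝ => z.1 j • b j)
      (((EuclideanSpace.proj j).comp (ContinuousLinearMap.fst ℝ _ ℝ)).smulRight (b j)) z :=
    fun j => ((EuclideanSpace.proj j).comp
      (ContinuousLinearMap.fst ℝ (EuclideanSpace ℝ (Fin n)) ℝ)).hasFDerivAt.smul_const (b j)
  have h2 := ((HasFDerivAt.fun_sum fun j (_ : j ∈ Finset.univ) => h1 j).add
    (hw.hasFDerivAt.smul_const ν)).const_add c
  have h3 : fderiv ℝ (fun z => c + graphPoint b ν w z) z = _ := h2.fderiv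
  rw [dd, h3]
  simp [dd]

end LocalGraph

/-! ### Writing an evolving hypersurface as an evolving graph -/

section LocalGraphExistence

/-- F is recovered from Ψ ∘ F by a local inverse of Ψ; continuity of F keeps its values in the
neighbourhood where that inverse is valid. -/
lemma contDiffAt_of_comp_left {W : Type*} [NormedAddCommGroup W] [NormedSpace ℝ W] {Ψ : ℝ → ℝ}
    {F : W → ℝ} {p : W} (hΨ : ContDiffAt ℝ 2 Ψ (F p)) (h0 : deriv Ψ (F p) ≠ 0)
    (hF : ContinuousAt F p) (h : ContDiffAt ℝ 2 (fun z => Ψ (F z)) p) : ContDiffAt ℝ 2 F p := by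
  have hd := (hΨ.differentiableAt (by simp)).hasDerivAt.hasFDerivAt_equiv h0
  have hinv := (hΨ.hasStrictFDerivAt' hd (by simp)).eventually_left_inverse
  have hg := hΨ.to_localInverse hd (by simp)
  have : (hΨ.localInverse hd (by simp)) ∘ (fun z => Ψ (F z)) =ᶠ[𝓝 p] F :=
    hF.eventually hinv
  exact (ContDiffAt.comp p hg h).congr_of_eventuallyEq this.symm

variable {n : ℕ} {b : Fin n → EuclideanSpace ℝ (Fin (n + 1))} {ν : EuclideanSpace ℝ (Fin (n + 1))}

/-- Inverse function theorem for the map sending c to the tangential coordinates of G(c) - G(c₀) and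
the time. Its derivative is injective because spatial derivatives of G at c₀ have no normal
component. -/
lemma exists_graph_coordinates
    {G : EuclideanSpace ℝ (Fin n) × ℝ → EuclideanSpace ℝ (Fin (n + 1))}
    {c₀ : EuclideanSpace ℝ (Fin n) × ℝ} (hG : ContDiffAt ℝ 4 G c₀)
    (hb : ∀ i j, inner ℝ (b i) (b j) = if i = j then (1 : ℝ) else 0)
    (hν : ‖ν‖ = 1) (hbν : ∀ i, inner ℝ (b i) ν = (0 : ℝ))
    (hperp : ∀ u : EuclideanSpace ℝ (Fin n), inner ℝ (fderiv ℝ G c₀ (u, 0)) ν = (0 : ℝ))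
    (hinj : ∀ u : EuclideanSpace ℝ (Fin n), fderiv ℝ G c₀ (u, 0) = 0 → u = 0) :
    ∃ S : EuclideanSpace ℝ (Fin n) × ℝ → EuclideanSpace ℝ (Fin n) × ℝ,
      ContDiffAt ℝ 4 S (0, c₀.2) ∧ S (0, c₀.2) = c₀ ∧
      ∀ᶠ z in 𝓝 ((0 : EuclideanSpace ℝ (Fin n)), c₀.2), (S z).2 = z.2 ∧
        ∀ i, inner ℝ (b i) (G (S z) - G c₀) = z.1 i := by
  set Φ : EuclideanSpace ℝ (Fin n) × ℝ → EuclideanSpace ℝ (Fin n) × ℝ :=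
    fun c => (WithLp.toLp 2 fun i => (inner ℝ (b i) (G c - G c₀) : ℝ), c.2) with hΦ
  have hΦc : ContDiffAt ℝ 4 Φ c₀ :=
    (contDiffAt_euclidean.2 fun i => contDiffAt_const.inner ℝ (hG.sub contDiffAt_const)).prodMk
      contDiffAt_snd
  have hΦ0 : Φ c₀ = (0, c₀.2) := by
    refine Prod.ext ?_ rfl
    ext i
    simp [hΦ]
  have hL := (hΦc.differentiableAt (by simp)).hasFDerivAt
  set L := fderiv ℝ Φ c₀
  have hL2 : ∀ v, (L v).2 = v.2 := fun v =>
    DFunLike.congr_fun (hL.snd.unique (hasFDerivAt_snd (p := c₀))) v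
  have hL1 : ∀ v i, (L v).1 i = inner ℝ (b i) (fderiv ℝ G c₀ v) := fun v i => by
    have h1 : HasFDerivAt (fun c => (Φ c).1 i) ((EuclideanSpace.proj i).comp
        ((ContinuousLinearMap.fst ℝ _ _).comp L)) c₀ :=
      (EuclideanSpace.proj (𝕜 := ℝ) i).hasFDerivAt.comp c₀ hL.fst
    have h2 : HasFDerivAt (fun c => (Φ c).1 i) ((innerSL ℝ (b i)).comp (fderiv ℝ G c₀)) c₀ :=
      (innerSL ℝ (b i)).hasFDerivAt.comp c₀
        ((hG.differentiableAt (by simp)).hasFDerivAt.sub_const (G c₀))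
    exact DFunLike.congr_fun (h1.unique h2) v
  have hLinj : Function.Injective L := by
    rw [injective_iff_map_eq_zero]
    rintro ⟨u, s⟩ h
    have hs : s = 0 := by
      have := hL2 (u, s)
      rw [h] at this
      exact this.symm
    subst hs
    have hu : u = 0 := by
      refine hinj u ?_
      rw [eq_sum_frame hb hν hbν (fderiv ℝ G c₀ (u, 0)), hperp]
      simp only [← hL1, h]
      simp
    rw [hu]; rfl
  set e : (EuclideanSpace ℝ (Fin n) × ℝ) ≃L[ℝ] EuclideanSpace ℝ (Fin n) × ℝ :=
    (LinearEquiv.ofInjectiveEndo L.toLinearMap hLinj).toContinuousLinearEquiv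
  have hLe : HasFDerivAt Φ (e : _ →L[ℝ] _) c₀ := hL
  have hright := (hΦc.hasStrictFDerivAt' hLe (by simp)).eventually_right_inverse
  rw [hΦ0] at hright
  refine ⟨hΦc.localInverse hLe (by simp), ?_, ?_, ?_⟩
  · rw [← hΦ0]; exact hΦc.to_localInverse hLe (by simp)
  · rw [← hΦ0]; exact hΦc.localInverse_apply_image hLe (by simp)
  · filter_upwards [hright] with z hz
    have hz' : Φ (hΦc.localInverse hLe (by simp) z) = z := hz
    have h2 := congrArg Prod.snd hz'
    have h1 := fun i => congrArg (fun c => c.1 i) hz'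
    exact ⟨h2, h1⟩

/-- An evolving hypersurface is, near each of its points, an evolving graph over its tangent
hyperplane. -/
lemma exists_graph {G N : EuclideanSpace ℝ (Fin n) × ℝ → EuclideanSpace ℝ (Fin (n + 1))}
    {φ : EuclideanSpace ℝ (Fin n) × ℝ → ℝ} {Ψ : ℝ → ℝ} {c₀ : EuclideanSpace ℝ (Fin n) × ℝ}
    (hG : ContDiffAt ℝ 4 G c₀) (hN : ContDiffAt ℝ 4 N c₀) (hφ : ContinuousAt φ c₀)
    (hΨ : ContDiffAt ℝ 2 Ψ (φ c₀)) (hΨ' : deriv Ψ (φ c₀) ≠ 0)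
    (hperp : ∀ᶠ c in 𝓝 c₀, ∀ u : EuclideanSpace ℝ (Fin n),
      inner ℝ (fderiv ℝ G c (u, 0)) (N c) = (0 : ℝ))
    (ht : ∀ᶠ c in 𝓝 c₀, fderiv ℝ G c (tDir n) = -Ψ (φ c) • N c)
    (hN1 : ∀ᶠ c in 𝓝 c₀, ‖N c‖ = 1)
    (hinj : ∀ u : EuclideanSpace ℝ (Fin n), fderiv ℝ G c₀ (u, 0) = 0 → u = 0)
    (hb : ∀ i j, inner ℝ (b i) (b j) = if i = j then (1 : ℝ) else 0)
    (hbν : ∀ i, inner ℝ (b i) (N c₀) = (0 : ℝ)) :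
    ∃ (S : EuclideanSpace ℝ (Fin n) × ℝ → EuclideanSpace ℝ (Fin n) × ℝ)
      (w F : EuclideanSpace ℝ (Fin n) × ℝ → ℝ), ContDiff ℝ 4 w ∧ ContDiff ℝ 2 F ∧
      S (0, c₀.2) = c₀ ∧ ContinuousAt S (0, c₀.2) ∧
      ∀ᶠ z in 𝓝 ((0 : EuclideanSpace ℝ (Fin n)), c₀.2), (S z).2 = z.2 ∧
        G (S z) = G c₀ + graphPoint b (N c₀) w z ∧ N (S z) = graphNormal b (N c₀) w z ∧
        φ (S z) = F z ∧ dd (tDir n) w z = -Ψ (F z) * areaElement (grad w z) ∧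
        ∃ A : EuclideanSpace ℝ (Fin n) → EuclideanSpace ℝ (Fin n),
          (∀ u, fderiv ℝ G (S z) (A u, 0)
            = ∑ i, u i • b i + (∑ i, u i * grad w z i) • N c₀) ∧
          ∀ u v, inner ℝ (fderiv ℝ N (S z) (A u, 0)) (fderiv ℝ G (S z) (A v, 0))
            = -(∑ i, ∑ j, u i * v j * hess w z i j) * (areaElement (grad w z))⁻¹ := by
  set ν := N c₀ with hν
  have hν1 : ‖ν‖ = 1 := hN1.self_of_nhds
  obtain ⟨S, hS, hS0, hSz⟩ := exists_graph_coordinates hG hb hν1 hbν hperp.self_of_nhds hinj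
  set p : EuclideanSpace ℝ (Fin n) × ℝ := (0, c₀.2) with hp
  have hSc : Tendsto S (𝓝 p) (𝓝 c₀) := by
    have := hS.continuousAt
    rwa [ContinuousAt, hS0] at this
  have hGS : ContDiffAt ℝ 4 (G ∘ S) p := ContDiffAt.comp p (by rwa [hS0]) hS
  have hNS : ContDiffAt ℝ 4 (N ∘ S) p := ContDiffAt.comp p (by rwa [hS0]) hS
  have hw0 : ContDiffAt ℝ (4 : ℕ) (fun z => (inner ℝ (G (S z) - G c₀) ν : ℝ)) p :=
    (hGS.sub contDiffAt_const).inner ℝ contDiffAt_const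
  obtain ⟨w, hw, hww⟩ := exists_contDiff_eventuallyEq hw0
  replace hw : ContDiff ℝ 4 w := hw
  have hwd : Differentiable ℝ w := hw.differentiable (by simp)
  have hpos : ∀ᶠ z in 𝓝 p, G (S z) = G c₀ + graphPoint b ν w z := by
    filter_upwards [hww, hSz] with z hz hz'
    have := eq_sum_frame hb hν1 hbν (G (S z) - G c₀)
    simp only [hz'.2, ← hz] at this
    rw [graphPoint, ← this, add_sub_cancel]
  have hdpos : ∀ᶠ z in 𝓝 p, ∀ v, fderiv ℝ (G ∘ S) z v = ∑ j, v.1 j • b j + dd v w z • ν := by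
    filter_upwards [eventually_eventually_nhds.2 hpos] with z hz v
    have h1 : G ∘ S =ᶠ[𝓝 z] fun z => G c₀ + graphPoint b ν w z := hz
    rw [← dd_graphPoint b ν (hwd z) (G c₀) v, dd, h1.fderiv_eq]
  have hSd : ∀ᶠ z in 𝓝 p, DifferentiableAt ℝ S z := by
    filter_upwards [hS.eventually (by simp)] with z hz using hz.differentiableAt (by simp)
  have hGd : ∀ᶠ z in 𝓝 p, DifferentiableAt ℝ G (S z) := by
    filter_upwards [hSc.eventually (hG.eventually (by simp))] with z hz
      using hz.differentiableAt (by simp)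
  have hNd : ∀ᶠ z in 𝓝 p, DifferentiableAt ℝ N (S z) := by
    filter_upwards [hSc.eventually (hN.eventually (by simp))] with z hz
      using hz.differentiableAt (by simp)
  have hS2 : ∀ᶠ z in 𝓝 p, ∀ v, (fderiv ℝ S z v).2 = v.2 := by
    filter_upwards [eventually_eventually_nhds.2 (hSz.mono fun z hz => hz.1), hSd] with z hz hd v
    have h1 : HasFDerivAt (fun z => (S z).2) _ z := hd.hasFDerivAt.snd
    have h2 : HasFDerivAt (fun z => (S z).2) (ContinuousLinearMap.snd ℝ _ ℝ) z :=
      hasFDerivAt_snd.congr_of_eventuallyEq hz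
    exact DFunLike.congr_fun (h1.unique h2) v
  have hchain : ∀ᶠ z in 𝓝 p, ∀ v, fderiv ℝ G (S z) (fderiv ℝ S z v)
      = ∑ j, v.1 j • b j + dd v w z • ν := by
    filter_upwards [hdpos, hSd, hGd] with z h1 h2 h3 v
    rw [← h1, fderiv_comp z h3 h2]; rfl
  have hsp : ∀ᶠ z in 𝓝 p, ∀ u : EuclideanSpace ℝ (Fin n),
      fderiv ℝ S z (u, 0) = ((fderiv ℝ S z (u, 0)).1, 0) := by
    filter_upwards [hS2] with z hz u
    exact Prod.ext rfl (hz _)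
  have htan : ∀ᶠ z in 𝓝 p, ∀ u : EuclideanSpace ℝ (Fin n),
      inner ℝ (∑ j, u j • b j + dd (u, (0 : ℝ)) w z • ν) (N (S z)) = (0 : ℝ) := by
    filter_upwards [hchain, hsp, hSc.eventually hperp] with z h1 h2 h3 u
    have h4 := h3 (fderiv ℝ S z (u, 0)).1
    rw [← h2, h1] at h4
    exact h4
  have hNpos : ∀ᶠ z in 𝓝 p, 0 < (inner ℝ (N (S z)) ν : ℝ) := by
    have h1 : ContinuousAt (fun z => (inner ℝ (N (S z)) ν : ℝ)) p :=
      hNS.continuousAt.inner continuousAt_const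
    refine h1.eventually (lt_mem_nhds ?_)
    beta_reduce
    rw [hS0, ← hν, real_inner_self_eq_norm_sq, hν1]
    norm_num
  have hnor : ∀ᶠ z in 𝓝 p, N (S z) = graphNormal b ν w z ∧
      inner ℝ (N (S z)) ν = (areaElement (grad w z))⁻¹ := by
    filter_upwards [htan, hNpos, hSc.eventually hN1] with z h1 h2 h3
    refine eq_normal_of_inner_eq_zero hb hν1 hbν h3 (fun i => ?_) h2
    have h4 := h1 (EuclideanSpace.single i 1)
    have h5 : ∑ j, (EuclideanSpace.single i (1 : ℝ)) j • b j = b i := by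
      rw [Finset.sum_eq_single i (fun j _ hj => by simp [hj]) (by simp)]
      rw [PiLp.single_apply, if_pos rfl, one_smul]
    rw [h5] at h4
    exact h4
  -- At fixed z the material point S z drifts with time; pairing with N removes this tangential
  -- drift and leaves w_t/J = -Ψ.
  have hflow : ∀ᶠ z in 𝓝 p, dd (tDir n) w z = -Ψ (φ (S z)) * areaElement (grad w z) := by
    filter_upwards [hchain, hS2, hSc.eventually hperp, hSc.eventually ht, hSc.eventually hN1, hnor]
      with z h1 h2 h3 h4 h5 h6
    have h7 : fderiv ℝ S z (tDir n) = ((fderiv ℝ S z (tDir n)).1, 0) + tDir n := by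
      refine Prod.ext ?_ ?_
      · simp
      · rw [h2]; simp
    have h8 := congrArg (fun y => (inner ℝ y (N (S z)) : ℝ)) (h1 (tDir n))
    simp only [tDir_fst, PiLp.zero_apply, zero_smul, Finset.sum_const_zero, zero_add] at h8
    rw [h7, map_add, inner_add_left, h3, h4, real_inner_smul_left, real_inner_self_eq_norm_sq, h5,
      real_inner_smul_left, real_inner_comm, h6.2] at h8
    have := areaElement_pos (grad w z)
    field_simp at h8
    linarith
  have hcφ : ContinuousAt (fun z => φ (S z)) p := by
    have : ContinuousAt φ (S p) := by rwa [hS0]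
    exact ContinuousAt.comp this hS.continuousAt
  have hgrad : ∀ i, ContDiff ℝ 3 fun z => grad w z i := fun i => contDiff_dd _ hw (by norm_num)
  -- Ψ(F) = -w_t/J is C², so F is C² by inversion of Ψ.
  have hF0 : ContDiffAt ℝ (2 : ℕ) (fun z => φ (S z)) p := by
    refine contDiffAt_of_comp_left (Ψ := Ψ) (by rwa [hS0]) (by rwa [hS0]) hcφ ?_
    have h1 : ContDiff ℝ 2 fun z => areaElement (grad w z) :=
      (contDiff_const.add (ContDiff.sum fun j _ => ((hgrad j).of_le (by norm_num)).pow 2)).sqrt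
        fun z => by positivity
    have h2 : ContDiff ℝ 2 fun z => -dd (tDir n) w z / areaElement (grad w z) :=
      (contDiff_dd (m := 2) _ hw (by norm_num)).neg.div h1 fun z => (areaElement_pos _).ne'
    refine h2.contDiffAt.congr_of_eventuallyEq ?_
    filter_upwards [hflow] with z hz
    rw [hz, eq_div_iff (areaElement_pos _).ne']
    ring
  obtain ⟨F, hF, hFF⟩ := exists_contDiff_eventuallyEq hF0
  refine ⟨S, w, F, hw, hF, hS0, hS.continuousAt, ?_⟩
  filter_upwards [hSz, hpos, hnor, hFF, hflow, hchain, hsp, hSd, hNd,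
    eventually_eventually_nhds.2 htan, hNS.eventually (by simp)]
    with z h1 h2 h3 h4 h5 h6 h7 h8 h9 h10 h11
  refine ⟨h1.1, h2, h3.1, h4.symm, by rw [h5, h4], fun u => (fderiv ℝ S z (u, 0)).1,
    fun u => by rw [← h7, h6, dd_spatial], fun u v => ?_⟩
  rw [← h7, ← h7, h6, dd_spatial]
  have e2 : fderiv ℝ N (S z) (fderiv ℝ S z (u, 0)) = fderiv ℝ (N ∘ S) z (u, 0) := by
    rw [fderiv_comp z h9 h8]; rfl
  have hdw : DifferentiableAt ℝ (dd (v, (0 : ℝ)) w) z :=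
    ((contDiff_dd (m := 3) _ hw (by norm_num)).differentiable (by simp)) z
  -- The tangency relation is differentiated along the graph; this converts ⟨dN, dG⟩ into the
  -- Hessian of w divided by the area element.
  have h12 : fderiv ℝ (fun z => (inner ℝ (∑ j, v j • b j + dd (v, (0 : ℝ)) w z • ν)
      ((N ∘ S) z) : ℝ)) z (u, 0) = 0 := by
    have : (fun z => (inner ℝ (∑ j, v j • b j + dd (v, (0 : ℝ)) w z • ν) ((N ∘ S) z) : ℝ))
        =ᶠ[𝓝 z] fun _ => 0 := by filter_upwards [h10] with y hy using hy v
    rw [this.fderiv_eq]; simp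
  have h13 : HasFDerivAt (fun z => ∑ j, v j • b j + dd (v, (0 : ℝ)) w z • ν)
      ((fderiv ℝ (dd (v, (0 : ℝ)) w) z).smulRight ν) z :=
    (hdw.hasFDerivAt.smul_const ν).const_add _
  rw [fderiv_inner_apply ℝ h13.differentiableAt (h11.differentiableAt (by simp)), h13.fderiv] at h12
  have h14 : fderiv ℝ (dd (v, (0 : ℝ)) w) z (u, 0) = ∑ i, ∑ j, u i * v j * hess w z i j :=
    dd_dd_spatial hw z u v
  rw [ContinuousLinearMap.smulRight_apply, h14, real_inner_smul_left,
    real_inner_comm, Function.comp_apply, real_inner_comm (N (S z)), h3.2, dd_spatial] at h12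
  rw [e2]
  linarith

end LocalGraphExistence

/-! ### Local graphs of the geometric flow -/

section LocalGraphOfFlow

variable {n : ℕ} {M : Type*} [TopologicalSpace M] [ChartedSpace (EuclideanSpace ℝ (Fin n)) M]
  {Γ : Set (Fin n → ℝ)} {f : (Fin n → ℝ) → ℝ} {Ψ : ℝ → ℝ} {T : EReal}
  {X ν : ℝ → M → EuclideanSpace ℝ (Fin (n + 1))} {t₀ : ℝ} {x₀ : M}
  {b : Fin n → EuclideanSpace ℝ (Fin (n + 1))}
  {ξ : EuclideanSpace ℝ (Fin n) × ℝ → M} {w F : EuclideanSpace ℝ (Fin n) × ℝ → ℝ}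

/-- Near time `t₀` and near `x₀` the evolving hypersurface is the graph of `w` over the hyperplane
through `X(x₀,t₀)` spanned by the frame `b`; the point over `z` is `ξ z`. -/
structure IsLocalGraph (f : (Fin n → ℝ) → ℝ) (Ψ : ℝ → ℝ)
    (X ν : ℝ → M → EuclideanSpace ℝ (Fin (n + 1))) (t₀ : ℝ) (x₀ : M)
    (b : Fin n → EuclideanSpace ℝ (Fin (n + 1))) (ξ : EuclideanSpace ℝ (Fin n) × ℝ → M)
    (w F : EuclideanSpace ℝ (Fin n) × ℝ → ℝ) : Prop where
  orthonormal : ∀ i j, inner ℝ (b i) (b j) = if i = j then (1 : ℝ) else 0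
  orthogonal : ∀ i, inner ℝ (b i) (ν t₀ x₀) = (0 : ℝ)
  contDiff_w : ContDiff ℝ 4 w
  contDiff_F : ContDiff ℝ 2 F
  base : ξ (0, t₀) = x₀
  position : ∀ᶠ z in 𝓝 (0, t₀), X z.2 (ξ z) = X t₀ x₀ + graphPoint b (ν t₀ x₀) w z
  normal : ∀ᶠ z in 𝓝 (0, t₀), ν z.2 (ξ z) = graphNormal b (ν t₀ x₀) w z
  speed_eq : ∀ᶠ z in 𝓝 (0, t₀), speed f X ν z.2 (ξ z) = F z
  flow : ∀ᶠ z in 𝓝 (0, t₀), dd (tDir n) w z = -Ψ (F z) * areaElement (grad w z)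
  tangent : ∀ᶠ z in 𝓝 (0, t₀), ∃ A : EuclideanSpace ℝ (Fin n) → EuclideanSpace ℝ (Fin n),
    (∀ u, differential (X z.2) (ξ z) (A u)
      = ∑ i, u i • b i + (∑ i, u i * grad w z i) • ν t₀ x₀) ∧
    ∀ u v, inner ℝ (differential (ν z.2) (ξ z) (A u)) (differential (X z.2) (ξ z) (A v))
      = -(∑ i, ∑ j, u i * v j * hess w z i j) * (areaElement (grad w z))⁻¹

namespace IsEmbeddedSolution

variable [IsManifold (𝓡 n) ∞ M]

lemma exists_localGraph (hX : IsEmbeddedSolution Γ f Ψ T X ν) (hf : IsAdmissibleSpeed Γ f)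
    (hΨ : ContDiffOn ℝ 2 Ψ (Ioi 0)) (hΨ' : ∀ s : ℝ, 0 < s → 0 < deriv Ψ s) (hT : 0 < T)
    (ht₀ : t₀ ∈ timeInterval T) (h0 : 0 < t₀) (x₀ : M)
    (hb : ∀ i j, inner ℝ (b i) (b j) = if i = j then (1 : ℝ) else 0)
    (hbν : ∀ i, inner ℝ (b i) (ν t₀ x₀) = (0 : ℝ)) :
    ∃ ξ w F, IsLocalGraph f Ψ X ν t₀ x₀ b ξ w F := by
  have hmono : StrictMonoOn Ψ (Ioi 0) := strictMonoOn_of_deriv_pos (convex_Ioi 0) hΨ.continuousOn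
    fun s hs => hΨ' s (by simpa using hs)
  set ψ := extChartAt (𝓡 n) x₀ with hψ
  set c₀ : EuclideanSpace ℝ (Fin n) × ℝ := (ψ x₀, t₀) with hc₀
  set D := ψ.target ×ˢ timeInterval T with hD
  have hDc : D ∈ 𝓝 c₀ := prod_mem_nhds ((isOpen_extChartAt_target x₀).mem_nhds
    (mem_extChartAt_target x₀)) (timeInterval_mem_nhds ht₀ h0)
  have hDe : ∀ᶠ c in 𝓝 c₀, D ∈ 𝓝 c := eventually_mem_nhds_iff.2 hDc
  have hG := contDiffOn_chartRep hX.smooth x₀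
  have hN := contDiffOn_chartRep hX.smooth_normal x₀
  have e0 : ψ.symm (ψ x₀) = x₀ := extChartAt_to_inv x₀
  have hFpos := hX.speed_pos hf ht₀ x₀
  have hspatial : ∀ {Y : ℝ → M → EuclideanSpace ℝ (Fin (n + 1))},
      ContDiffOn ℝ ∞ (chartRep x₀ Y) D → (∀ t ∈ timeInterval T, ∀ x,
        MDifferentiableAt (𝓡 n) (𝓡 (n + 1)) (Y t) x) → ∀ c, D ∈ 𝓝 c →
      ∀ u : EuclideanSpace ℝ (Fin n), fderiv ℝ (chartRep x₀ Y) c (u, 0)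
        = differential (Y c.2) (ψ.symm c.1)
          (mfderiv 𝓘(ℝ, EuclideanSpace ℝ (Fin n)) (𝓡 n) ψ.symm c.1 u) := by
    intro Y hY hYd c hc u
    have hcD : c ∈ D := mem_of_mem_nhds hc
    have hd : MDifferentiableAt 𝓘(ℝ, EuclideanSpace ℝ (Fin n)) (𝓡 n) ψ.symm c.1 :=
      ((contMDiffOn_extChartAt_symm (n := ∞) x₀).contMDiffAt
        ((isOpen_extChartAt_target x₀).mem_nhds hcD.1)).mdifferentiableAt (by simp)
    rw [← fderiv_comp_differential (hYd c.2 hcD.2 _) hd]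
    have h1 : HasFDerivAt (chartRep x₀ Y) (fderiv ℝ (chartRep x₀ Y) c) (c.1, c.2) :=
      ((hY.contDiffAt hc).differentiableAt (by simp)).hasFDerivAt
    have h2 := HasFDerivAt.comp (f := fun p => (p, c.2)) c.1 h1 (hasFDerivAt_prodMk_left c.1 c.2)
    exact (DFunLike.congr_fun h2.fderiv u).symm
  have hGs := hspatial hG fun t ht x => hX.mdifferentiableAt ht x
  have hNs := hspatial hN fun t ht x => hX.mdifferentiableAt_normal ht x
  have eφ : chartRep x₀ (speed f X ν) c₀ = speed f X ν t₀ x₀ := congrArg (speed f X ν t₀) e0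
  have eN : chartRep x₀ ν c₀ = ν t₀ x₀ := congrArg (ν t₀) e0
  have eG : chartRep x₀ X c₀ = X t₀ x₀ := congrArg (X t₀) e0
  obtain ⟨S, w, F, hw, hF, hS0, hSc, hS⟩ := exists_graph (b := b) (Ψ := Ψ) (c₀ := c₀)
    ((hG.contDiffAt hDc).of_le (by norm_cast)) ((hN.contDiffAt hDc).of_le (by norm_cast))
    ((hX.continuousOn_chartRep_speed hf hmono hT x₀).continuousAt hDc)
    (by rw [eφ]; exact hΨ.contDiffAt (Ioi_mem_nhds hFpos))
    (by rw [eφ]; exact (hΨ' _ hFpos).ne')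
    (by
      filter_upwards [hDe] with c hc u
      rw [hGs c hc]
      exact (hX.outward_normal c.2 (mem_of_mem_nhds hc).2).normal _ _)
    (by
      filter_upwards [hDe] with c hc
      rw [← fderivWithin_of_mem_nhds hc]
      exact hX.fderivWithin_time hT x₀ (mem_of_mem_nhds hc))
    (by
      filter_upwards [hDe] with c hc
      exact hX.norm_chartRep_normal x₀ (mem_of_mem_nhds hc).2)
    (by
      intro u hu
      have h1 : HasFDerivAt (chartRep x₀ X) (fderiv ℝ (chartRep x₀ X) c₀) (c₀.1, c₀.2) :=
        ((hG.contDiffAt hDc).differentiableAt (by simp)).hasFDerivAt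
      have h2 := (HasFDerivAt.comp (f := fun p => (p, c₀.2)) c₀.1 h1
        (hasFDerivAt_prodMk_left c₀.1 c₀.2)).fderiv
      have h3 : fderiv ℝ (fun p => chartRep x₀ X (p, t₀)) (ψ x₀) u = 0 :=
        (DFunLike.congr_fun h2 u).trans hu
      rw [fderiv_chartRep_center (hX.mdifferentiableAt ht₀ x₀)] at h3
      exact hX.differential_injective ht₀ x₀ (h3.trans (map_zero _).symm))
    hb (by rw [eN]; exact hbν)
  have hSt : Tendsto S (𝓝 (0, t₀)) (𝓝 c₀) := by
    have := hSc.tendsto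
    rwa [hS0] at this
  rw [eN, eG] at hS
  refine ⟨fun z => ψ.symm (S z).1, w, F, hb, hbν, hw, hF, ?_, ?_, ?_, ?_, ?_, ?_⟩
  · rw [hS0, e0]
  · filter_upwards [hS] with z hz
    rw [← hz.1]; exact hz.2.1
  · filter_upwards [hS] with z hz
    rw [← hz.1]; exact hz.2.2.1
  · filter_upwards [hS] with z hz
    rw [← hz.1]; exact hz.2.2.2.1
  · filter_upwards [hS] with z hz using hz.2.2.2.2.1
  · filter_upwards [hS, hSt.eventually hDe] with z hz hD
    obtain ⟨A, hA1, hA2⟩ := hz.2.2.2.2.2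
    refine ⟨fun u => mfderiv 𝓘(ℝ, EuclideanSpace ℝ (Fin n)) (𝓡 n) ψ.symm (S z).1 (A u),
      fun u => ?_, fun u v => ?_⟩
    · rw [← hA1, hGs _ hD, hz.1]
    · rw [← hA2, hGs _ hD, hNs _ hD, hz.1]

end IsEmbeddedSolution

namespace IsLocalGraph

lemma w_eq_zero (h : IsLocalGraph f Ψ X ν t₀ x₀ b ξ w F) (hν : ‖ν t₀ x₀‖ = 1) :
    w (0, t₀) = 0 := by
  have h1 := h.position.self_of_nhds
  simp only [h.base, graphPoint, PiLp.zero_apply, zero_smul, Finset.sum_const_zero, zero_add,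
    left_eq_add, smul_eq_zero] at h1
  exact h1.resolve_right fun h => by simp [h] at hν

lemma grad_eq_zero (h : IsLocalGraph f Ψ X ν t₀ x₀ b ξ w F) (i : Fin n) :
    grad w (0, t₀) i = 0 := by
  have h1 := congrArg (fun y => (inner ℝ (b i) y : ℝ)) h.normal.self_of_nhds
  simp only [h.base, graphNormal, h.orthogonal, inner_smul_right, inner_sub_right, inner_sum,
    h.orthonormal] at h1
  simpa [(areaElement_pos _).ne'] using h1

lemma tangent_base (h : IsLocalGraph f Ψ X ν t₀ x₀ b ξ w F) :
    ∃ A : EuclideanSpace ℝ (Fin n) → EuclideanSpace ℝ (Fin n),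
      (∀ u, differential (X t₀) x₀ (A u) = ∑ i, u i • b i) ∧
      ∀ u v, inner ℝ (differential (ν t₀) x₀ (A u)) (differential (X t₀) x₀ (A v))
        = -∑ i, ∑ j, u i * v j * hess w (0, t₀) i j := by
  obtain ⟨A, h1, h2⟩ := h.tangent.self_of_nhds
  simp only [h.base, h.grad_eq_zero, areaElement_of_eq_zero h.grad_eq_zero] at h1 h2
  exact ⟨A, by simpa using h1, by simpa using h2⟩

variable [IsManifold (𝓡 n) ∞ M]

/-- The graph frame lifts to an orthonormal frame of the hypersurface at ξ z, so the Schur-Horn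
inequality at that point applies with the fixed weights a. -/
lemma support (h : IsLocalGraph f Ψ X ν t₀ x₀ b ξ w F) (hX : IsEmbeddedSolution Γ f Ψ T X ν)
    (hf : IsAdmissibleSpeed Γ f) (hc : ConvexOn ℝ Γ f) (ht₀ : t₀ ∈ timeInterval T) (h0 : 0 < t₀)
    {a : Fin n → ℝ} (ha : ∀ l ∈ Γ, ∑ i, a i * l i ≤ f l) :
    ∀ᶠ z in 𝓝 (0, t₀), weightedTrace a (grad w z) (hess w z) ≤ F z := by
  have hI : ∀ᶠ z in 𝓝 ((0 : EuclideanSpace ℝ (Fin n)), t₀), z.2 ∈ timeInterval T :=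
    continuous_snd.continuousAt.eventually (timeInterval_mem_nhds ht₀ h0)
  filter_upwards [h.tangent, h.speed_eq, hI] with z ⟨A, hA1, hA2⟩ hs hz
  obtain ⟨e, he⟩ := hX.exists_principalFrame hz (ξ z)
  rw [← hs]
  refine le_trans (le_of_eq ?_) (he.weighted_trace_le hf hc (hX.curvatures_mem _ hz _) ha
    (u := fun i => A (WithLp.toLp 2 (graphFrame (grad w z) i))) fun i j => ?_)
  · refine Finset.sum_congr rfl fun i _ => ?_
    rw [ContinuousLinearMap.coe_coe, ContinuousLinearMap.coe_coe, hA2]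
  · rw [ContinuousLinearMap.coe_coe, hA1, hA1, inner_frame h.orthonormal
      ((hX.outward_normal _ ht₀).norm_eq_one _) h.orthogonal]
    exact graphFrame_orthonormal _ i j

lemma isGraphFlow (h : IsLocalGraph f Ψ X ν t₀ x₀ b ξ w F) (hX : IsEmbeddedSolution Γ f Ψ T X ν)
    (hf : IsAdmissibleSpeed Γ f) (hc : ConvexOn ℝ Γ f) (ht₀ : t₀ ∈ timeInterval T) (h0 : 0 < t₀)
    {e : Fin n → EuclideanSpace ℝ (Fin n)} {κ : Fin n → ℝ}
    (he : IsPrincipalFrame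
      (differential (X t₀) x₀ : EuclideanSpace ℝ (Fin n) →ₗ[ℝ] EuclideanSpace ℝ (Fin (n + 1)))
      (differential (ν t₀) x₀ : EuclideanSpace ℝ (Fin n) →ₗ[ℝ] EuclideanSpace ℝ (Fin (n + 1))) κ e)
    (hbe : ∀ i, b i = differential (X t₀) x₀ (e i)) {a : Fin n → ℝ}
    (ha : ∀ l ∈ Γ, ∑ i, a i * l i ≤ f l) (haκ : speed f X ν t₀ x₀ = ∑ i, a i * κ i) :
    IsGraphFlow a κ Ψ w F (0, t₀) where
  contDiff_w := h.contDiff_w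
  contDiff_F := h.contDiff_F
  F_pos := by
    rw [← h.speed_eq.self_of_nhds, h.base]
    exact hX.speed_pos hf ht₀ x₀
  w_eq_zero := h.w_eq_zero ((hX.outward_normal _ ht₀).norm_eq_one _)
  grad_eq_zero := h.grad_eq_zero
  hess_eq i j := by
    obtain ⟨A, hA1, hA2⟩ := h.tangent_base
    -- The coordinate directions of the graph lift to the principal directions, which diagonalise
    -- the Hessian at the base point.
    have hAe : ∀ i, A (EuclideanSpace.single i 1) = e i := fun i => by
      refine hX.differential_injective ht₀ x₀ ?_
      rw [hA1, ← hbe, Finset.sum_eq_single i (fun j _ hj => by simp [hj]) (by simp),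
        PiLp.single_apply, if_pos rfl, one_smul]
    have h1 := hA2 (EuclideanSpace.single i 1) (EuclideanSpace.single j 1)
    have h2 := he.eigen i
    have h3 := he.orthonormal i j
    simp only [ContinuousLinearMap.coe_coe] at h2 h3
    rw [hAe, hAe, h2, real_inner_smul_left, h3] at h1
    have h4 : ∑ k, ∑ l, (EuclideanSpace.single i (1 : ℝ)) k * (EuclideanSpace.single j (1 : ℝ)) l
        * hess w (0, t₀) k l = hess w (0, t₀) i j := by
      simp [ite_mul]
    rw [h4] at h1
    rw [← neg_eq_iff_eq_neg.2 h1]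
    split_ifs <;> simp
  F_eq := by rw [← h.speed_eq.self_of_nhds, h.base, haκ]
  flow := h.flow
  support := h.support hX hf hc ht₀ h0 ha

end IsLocalGraph

end LocalGraphOfFlow

/-! ### Excluding both kinds of touching -/

section Noncollapsing

/-- The tangent line inequality for the convex function Ψ. -/
lemma deriv_mul_sub_le {Ψ : ℝ → ℝ} (hΨ : ContDiffOn ℝ 2 Ψ (Ioi 0))
    (hΨ'' : ∀ s : ℝ, 0 < s → 0 ≤ deriv (deriv Ψ) s) {r s : ℝ} (hr : 0 < r) (hs : 0 < s) :
    deriv Ψ r * (s - r) ≤ Ψ s - Ψ r := by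
  have hd : ∀ x ∈ Ioi (0 : ℝ), DifferentiableAt ℝ Ψ x := fun x hx =>
    (hΨ.contDiffAt (Ioi_mem_nhds hx)).differentiableAt (by simp)
  have hd' : ContDiffOn ℝ 1 (deriv Ψ) (Ioi 0) := by
    rw [show (2 : WithTop ℕ∞) = 1 + 1 by norm_num, contDiffOn_succ_iff_deriv_of_isOpen isOpen_Ioi]
      at hΨ
    exact hΨ.2.2
  have hc : ConvexOn ℝ (Ioi 0) Ψ := convexOn_of_deriv2_nonneg' (convex_Ioi 0)
    (fun x hx => (hd x hx).differentiableWithinAt) (hd'.differentiableOn (by simp))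
    fun x hx => hΨ'' x hx
  rcases lt_trichotomy r s with h | rfl | h
  · have := hc.deriv_le_slope hr hs h (hd r hr)
    rwa [slope_def_field, le_div_iff₀ (by linarith)] at this
  · simp
  · have := hc.slope_le_deriv hs hr h (hd r hr)
    rw [slope_def_field, div_le_iff₀ (by linarith)] at this
    linarith

variable {n : ℕ} {M : Type*} [TopologicalSpace M] [ChartedSpace (EuclideanSpace ℝ (Fin n)) M]
  {Γ : Set (Fin n → ℝ)} {f : (Fin n → ℝ) → ℝ} {Ψ : ℝ → ℝ} {T : EReal}
  {X ν : ℝ → M → EuclideanSpace ℝ (Fin (n + 1))} {t₀ : ℝ} {θ : ℝ → ℝ}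

lemma diagForm_frame {x : M} {κ : Fin n → ℝ} {e : Fin n → EuclideanSpace ℝ (Fin n)}
    (h : IsPrincipalFrame
      (differential (X t₀) x : EuclideanSpace ℝ (Fin n) →ₗ[ℝ] EuclideanSpace ℝ (Fin (n + 1)))
      (differential (ν t₀) x : EuclideanSpace ℝ (Fin n) →ₗ[ℝ] EuclideanSpace ℝ (Fin (n + 1))) κ e)
    (i : Fin n) : diagForm θ f X ν t₀ x (e i) = κ i + θ t₀ * speed f X ν t₀ x := by
  have h1 := h.eigen i
  have h2 := h.orthonormal i i
  simp only [ContinuousLinearMap.coe_coe, if_pos] at h1 h2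
  rw [diagForm, h1, real_inner_smul_left, ← real_inner_self_eq_norm_sq, h2]
  ring

/-- A ball which contains no point of the hypersurface and touches it at `x` from outside also
lies outside at every other point where it touches. -/
lemma IsOutwardUnitNormal.ne_neg_of_touching {Y N : M → EuclideanSpace ℝ (Fin (n + 1))}
    (h : IsOutwardUnitNormal Y N) {φ : ℝ} (hφ : 0 < φ) {x y : M}
    (hxz : ∀ z, 0 ≤ twoPoint φ (Y x - Y z) (N x)) (hy : N x + φ • (Y x - Y y) = -N y) : False := by
  obtain ⟨Ω, hΩ, -, hfr, hout⟩ := h.outward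
  -- Centre of the exterior ball of curvature φ at x. Under the hypothesis on N y, it lies in the
  -- inward direction from Y y.
  set c := Y x + φ⁻¹ • N x with hc
  have hcx : c - Y x = φ⁻¹ • N x := by rw [hc, add_sub_cancel_left]
  have hcy : c - Y y = φ⁻¹ • -N y := by
    rw [← hy, smul_add, smul_smul, inv_mul_cancel₀ hφ.ne', one_smul, hc]
    abel
  have hball : ∀ z, Y z ∉ Metric.ball c φ⁻¹ := by
    intro z hz
    rw [mem_ball_iff_norm'] at hz
    have h1 : ‖c - Y z‖ ^ 2 < φ⁻¹ ^ 2 := pow_lt_pow_left₀ hz (norm_nonneg _) two_ne_zero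
    have h2 : c - Y z = (Y x - Y z) + φ⁻¹ • N x := by rw [hc]; abel
    rw [h2, norm_add_sq_real, inner_smul_right, norm_smul, h.norm_eq_one, mul_one,
      Real.norm_eq_abs, sq_abs] at h1
    have h3 := hxz z
    rw [twoPoint] at h3
    have h4 : φ * (‖Y x - Y z‖ ^ 2 + 2 * (φ⁻¹ * inner ℝ (Y x - Y z) (N x))) < 0 :=
      mul_neg_of_pos_of_neg hφ (by linarith)
    have h5 : φ * (‖Y x - Y z‖ ^ 2 + 2 * (φ⁻¹ * inner ℝ (Y x - Y z) (N x)))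
        = 2 * inner ℝ (Y x - Y z) (N x) + φ * ‖Y x - Y z‖ ^ 2 := by field_simp; ring
    linarith
  have hmem : ∀ (z v : EuclideanSpace ℝ (Fin (n + 1))), ‖v‖ = 1 → c - z = φ⁻¹ • v →
      ∀ᶠ s in 𝓝[>] (0 : ℝ), z + s • v ∈ Metric.ball c φ⁻¹ := by
    intro z v hv hz
    filter_upwards [Ioo_mem_nhdsGT (inv_pos.2 hφ)] with s hs
    rw [mem_ball_iff_norm', ← sub_sub, hz, ← sub_smul, norm_smul, hv, mul_one, Real.norm_eq_abs,
      abs_of_pos (by linarith [hs.2])]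
    linarith [hs.1]
  obtain ⟨s, hs1, hs2⟩ := ((hmem _ _ (h.norm_eq_one x) hcx).and (hout x)).exists
  obtain ⟨r, hr1, hr2⟩ :=
    ((hmem _ (-N y) (by rw [norm_neg, h.norm_eq_one]) hcy).and (hout y)).exists
  -- The ball is connected, misses the boundary of Ω and enters Ω near y, so it lies in Ω; near x,
  -- however, it contains points outside Ω.
  have hsub : Metric.ball c φ⁻¹ ⊆ Ω := by
    refine (convex_ball c φ⁻¹).isPreconnected.subset_of_closure_inter_subset hΩ
      ⟨_, hr1, by rw [smul_neg, ← sub_eq_add_neg]; exact hr2.1⟩ ?_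
    rintro z ⟨hz1, hz2⟩
    by_contra hz
    have : z ∈ frontier Ω := by rw [hΩ.frontier_eq]; exact ⟨hz1, hz⟩
    rw [hfr] at this
    obtain ⟨z, rfl⟩ := this
    exact hball z hz2
  exact hs2.2 (hsub hs1)

namespace IsEmbeddedSolution

variable [IsManifold (𝓡 n) ∞ M]

/-- At an off-diagonal zero of a nonnegative two-point function the two normals are reflections of
each other. -/
lemma normal_eq_of_touching (hX : IsEmbeddedSolution Γ f Ψ T X ν) (hf : IsAdmissibleSpeed Γ f)
    (ht₀ : t₀ ∈ timeInterval T) (hθ : 0 < θ t₀) (hnn : ∀ x y, 0 ≤ pairFn θ f X ν t₀ x y)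
    {x y : M} (hxy : pairFn θ f X ν t₀ x y = 0) :
    ν t₀ y = ν t₀ x + (θ t₀ * speed f X ν t₀ x) • (X t₀ x - X t₀ y) := by
  have hφ : 0 < θ t₀ * speed f X ν t₀ x := mul_pos hθ (hX.speed_pos hf ht₀ x)
  set φ := θ t₀ * speed f X ν t₀ x with hφ'
  set D := X t₀ x - X t₀ y with hD
  have hn := hX.outward_normal t₀ ht₀
  have hZ : 2 * inner ℝ D (ν t₀ x) + φ * ‖D‖ ^ 2 = 0 := hxy
  set N := ν t₀ x + φ • D with hN
  have hN1 : ‖N‖ ^ 2 = 1 := by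
    rw [hN, norm_add_sq_real, inner_smul_right, real_inner_comm, norm_smul, mul_pow,
      hn.norm_eq_one, Real.norm_eq_abs, sq_abs]
    linear_combination φ * hZ
  -- First variation in y at a minimum of the two-point function.
  have hperp : ∀ u, inner ℝ (differential (X t₀) y u) N = (0 : ℝ) := by
    intro u
    set q := extChartAt (𝓡 n) y y with hq
    have h1 : HasFDerivAt (fun p => chartRep y X (p, t₀)) (differential (X t₀) y) q := by
      rw [← fderiv_chartRep_center (hX.mdifferentiableAt ht₀ y)]
      exact (((contDiffAt_chartRep hX.smooth ht₀ y).contDiffAt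
        ((isOpen_extChartAt_target y).mem_nhds (mem_extChartAt_target y))).differentiableAt
        (by simp)).hasFDerivAt
    have h2 : HasDerivAt (fun s : ℝ => q + s • u) u 0 := by
      simpa using ((hasDerivAt_id (0 : ℝ)).smul_const u).const_add q
    have h3 : HasDerivAt (fun s : ℝ => chartRep y X (q + s • u, t₀)) (differential (X t₀) y u) 0 :=
      HasFDerivAt.comp_hasDerivAt (f := fun s : ℝ => q + s • u)
        (l := fun p => chartRep y X (p, t₀)) 0 (by simpa using h1) h2
    have hq0 : chartRep y X (q, t₀) = X t₀ y := congrArg (X t₀) (extChartAt_to_inv y)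
    have h4 := hasDerivAt_twoPoint (hasDerivAt_const (0 : ℝ) φ) (h3.const_sub (X t₀ x))
      (hasDerivAt_const (0 : ℝ) (ν t₀ x)) rfl (D0 := D) (by simp [hq0, hD]) rfl
    have hmin : IsLocalMin (fun s : ℝ => twoPoint φ (X t₀ x - chartRep y X (q + s • u, t₀))
        (ν t₀ x)) 0 := by
      refine Eventually.of_forall fun s => ?_
      have e0 : twoPoint φ (X t₀ x - chartRep y X (q + (0 : ℝ) • u, t₀)) (ν t₀ x) = 0 := by
        rw [zero_smul, add_zero, hq0]; exact hxy
      beta_reduce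
      rw [e0]
      exact hnn x _
    have h5 := hmin.hasDerivAt_eq_zero h4
    rw [inner_zero_right, inner_neg_left, inner_neg_right] at h5
    rw [hN, inner_add_right, inner_smul_right, real_inner_comm D]
    linarith
  have hNν : N = (inner ℝ N (ν t₀ y) : ℝ) • ν t₀ y := by
    have h1 : inner ℝ (N - (inner ℝ N (ν t₀ y) : ℝ) • ν t₀ y) (ν t₀ y) = (0 : ℝ) := by
      rw [inner_sub_left, real_inner_smul_left, real_inner_self_eq_norm_sq, hn.norm_eq_one]
      ring
    obtain ⟨v, hv⟩ := hX.mem_range_differential ht₀ y h1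
    rw [ContinuousLinearMap.coe_coe] at hv
    rw [← sub_eq_zero, ← inner_self_eq_zero (𝕜 := ℝ)]
    conv_lhs => rw [← hv]
    rw [hv, inner_sub_right, inner_smul_right, h1, mul_zero, sub_zero, ← hv]
    exact hperp v
  set c : ℝ := inner ℝ N (ν t₀ y) with hc
  have hc1 : c ^ 2 = 1 := by
    rw [hNν, norm_smul, hn.norm_eq_one, mul_one, Real.norm_eq_abs, sq_abs] at hN1
    exact hN1
  rcases (sq_eq_sq_iff_eq_or_eq_neg.1 (hc1.trans (one_pow 2).symm)) with h | h
  · rw [hNν, h, one_smul]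
  · exact (hn.ne_neg_of_touching hφ (x := x) (y := y) (fun z => hnn x z)
      (by rw [← hD, ← hN, hNν, h, neg_smul, one_smul])).elim

variable {β ε : ℝ}

lemma not_diagonal_touching (hX : IsEmbeddedSolution Γ f Ψ T X ν) (hf : IsAdmissibleSpeed Γ f)
    (hc : ConvexOn ℝ Γ f) (hΨ : ContDiffOn ℝ 2 Ψ (Ioi 0)) (hΨ' : ∀ s : ℝ, 0 < s → 0 < deriv Ψ s)
    (hΨ1 : ∀ s : ℝ, 0 < s → deriv Ψ s * s - Ψ s ≤ 0)
    (hΨ2 : ∀ s : ℝ, 0 < s → 0 ≤ deriv (deriv Ψ) s) (hT : 0 < T)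
    (ht₀ : t₀ ∈ timeInterval T) (h0 : 0 < t₀) (hβ : 0 < β) (hε : 0 < ε)
    (hnn : ∀ t ∈ timeInterval T, t ≤ t₀ → ∀ x y,
      0 ≤ pairFn (fun s => β + ε * (1 + s)) f X ν t x y)
    {x : M} {v : EuclideanSpace ℝ (Fin n)} (hv : v ≠ 0)
    (hneg : diagForm (fun s => β + ε * (1 + s)) f X ν t₀ x v ≤ 0) : False := by
  have hmono : StrictMonoOn Ψ (Ioi 0) := strictMonoOn_of_deriv_pos (convex_Ioi 0) hΨ.continuousOn
    fun s hs => hΨ' s (by simpa using hs)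
  have hθ : Continuous fun s : ℝ => β + ε * (1 + s) := by fun_prop
  have hQ : ∀ t ∈ timeInterval T, t ≤ t₀ → ∀ x v,
      0 ≤ diagForm (fun s => β + ε * (1 + s)) f X ν t x v := fun t ht htt =>
    hX.diagForm_nonneg hf hmono hT hθ ht (hnn t ht htt)
  have hFpos := hX.speed_pos hf ht₀ x
  obtain ⟨e, he⟩ := hX.exists_principalFrame ht₀ x
  set κ := principalCurvatures (X t₀) (ν t₀) x with hκ
  obtain ⟨a, ha0, haκ, ha⟩ := hf.exists_weights hc (hX.curvatures_mem t₀ ht₀ x)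
  obtain ⟨ξ, w, F, hG⟩ := hX.exists_localGraph hf hΨ hΨ' hT ht₀ h0 x
    (b := fun i => differential (X t₀) x (e i)) he.orthonormal
    fun i => (hX.outward_normal t₀ ht₀).normal x (e i)
  have hGF := hG.isGraphFlow hX hf hc ht₀ h0 he (fun i => rfl) ha haκ
  have hF : F (0, t₀) = speed f X ν t₀ x := by rw [← hG.speed_eq.self_of_nhds, hG.base]
  have hsum := diagForm_eq_sum (θ := fun s => β + ε * (1 + s)) (f := f) he v
  have hnonneg : ∀ j, 0 ≤ κ j + (β + ε * (1 + t₀)) * speed f X ν t₀ x := fun j => by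
    have := hQ t₀ ht₀ le_rfl x (e j)
    rwa [diagForm_frame he] at this
  -- The form is diagonal with nonnegative coefficients and is not positive at v, so the coefficient
  -- vanishes in every principal direction m along which v has a component: κ_m = -φ.
  obtain ⟨m, hm⟩ : ∃ m, inner ℝ (differential (X t₀) x (e m)) (differential (X t₀) x v)
      ≠ (0 : ℝ) := by
    by_contra! h
    refine hv ?_
    have h1 := he.eq_sum v
    simp only [ContinuousLinearMap.coe_coe, h, zero_smul, Finset.sum_const_zero] at h1
    exact h1
  have hterm : ∀ j ∈ Finset.univ, 0 ≤ (κ j + (β + ε * (1 + t₀)) * speed f X ν t₀ x)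
      * inner ℝ (differential (X t₀) x (e j)) (differential (X t₀) x v) ^ 2 := fun j _ =>
    mul_nonneg (hnonneg j) (sq_nonneg _)
  have hzero := (Finset.sum_eq_zero_iff_of_nonneg hterm).1
    (le_antisymm (hsum ▸ hneg) (Finset.sum_nonneg hterm)) m (Finset.mem_univ m)
  have hκm : κ m = -barrier β ε F (0, t₀) := by
    have := (mul_eq_zero.1 hzero).resolve_right (pow_ne_zero 2 hm)
    rw [barrier, hF]
    linarith
  refine hGF.not_touching_diagonal hΨ ha0 (hΨ' _ hGF.F_pos) (by linarith [hΨ1 _ hGF.F_pos])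
    (hΨ2 _ hGF.F_pos) hε (by positivity) ?_ hκm
  have hI : ∀ᶠ z in 𝓝 ((0 : EuclideanSpace ℝ (Fin n)), t₀), z.2 ∈ timeInterval T :=
    continuous_snd.continuousAt.eventually (timeInterval_mem_nhds ht₀ h0)
  filter_upwards [hG.tangent, hG.speed_eq, hI] with z ⟨A, hA1, hA2⟩ hs hz hzt m
  have h1 := hQ z.2 hz hzt (ξ z) (A (EuclideanSpace.single m 1))
  have h2 := hA2 (EuclideanSpace.single m 1) (EuclideanSpace.single m 1)
  have h3 : ∑ k, ∑ l, (EuclideanSpace.single m (1 : ℝ)) k * (EuclideanSpace.single m (1 : ℝ)) l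
      * hess w z k l = hess w z m m := by
    simp [ite_mul]
  have h4 : ∑ k, (EuclideanSpace.single m (1 : ℝ)) k * grad w z k = grad w z m := by
    simp [ite_mul]
  have h5 : ∑ k, (EuclideanSpace.single m (1 : ℝ)) k * (EuclideanSpace.single m (1 : ℝ)) k
      = 1 := by
    simp
  have h6 := inner_frame hG.orthonormal ((hX.outward_normal t₀ ht₀).norm_eq_one x) hG.orthogonal
    (EuclideanSpace.single m (1 : ℝ)) (EuclideanSpace.single m (1 : ℝ))
    (∑ k, (EuclideanSpace.single m (1 : ℝ)) k * grad w z k)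
    (∑ k, (EuclideanSpace.single m (1 : ℝ)) k * grad w z k)
  rw [← hA1, real_inner_self_eq_norm_sq, h5, h4] at h6
  rw [diagForm, h2, h3, h6, hs] at h1
  rw [barrier, sq]
  exact h1

lemma not_offDiagonal_touching (hX : IsEmbeddedSolution Γ f Ψ T X ν) (hf : IsAdmissibleSpeed Γ f)
    (hc : ConvexOn ℝ Γ f) (hΨ : ContDiffOn ℝ 2 Ψ (Ioi 0)) (hΨ' : ∀ s : ℝ, 0 < s → 0 < deriv Ψ s)
    (hΨ1 : ∀ s : ℝ, 0 < s → deriv Ψ s * s - Ψ s ≤ 0)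
    (hΨ2 : ∀ s : ℝ, 0 < s → 0 ≤ deriv (deriv Ψ) s) (hT : 0 < T)
    (ht₀ : t₀ ∈ timeInterval T) (h0 : 0 < t₀) (hβ : 0 < β) (hε : 0 < ε)
    (hnn : ∀ t ∈ timeInterval T, t ≤ t₀ → ∀ x y,
      0 ≤ pairFn (fun s => β + ε * (1 + s)) f X ν t x y)
    {x y : M} (hxy : x ≠ y) (hzero : pairFn (fun s => β + ε * (1 + s)) f X ν t₀ x y = 0) :
    False := by
  have hmono : StrictMonoOn Ψ (Ioi 0) := strictMonoOn_of_deriv_pos (convex_Ioi 0) hΨ.continuousOn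
    fun s hs => hΨ' s (by simpa using hs)
  have hθ : Continuous fun s : ℝ => β + ε * (1 + s) := by fun_prop
  have hθ0 : 0 < β + ε * (1 + t₀) := by positivity
  have hFpos := hX.speed_pos hf ht₀ x
  have hn := hX.outward_normal t₀ ht₀
  obtain ⟨e, he⟩ := hX.exists_principalFrame ht₀ x
  obtain ⟨a, ha0, haκ, ha⟩ := hf.exists_weights hc (hX.curvatures_mem t₀ ht₀ x)
  set b : Fin n → EuclideanSpace ℝ (Fin (n + 1)) := fun i => differential (X t₀) x (e i) with hb
  have hbν : ∀ i, inner ℝ (b i) (ν t₀ x) = (0 : ℝ) := fun i => hn.normal x (e i)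
  obtain ⟨ξ, w, F, hG⟩ := hX.exists_localGraph hf hΨ hΨ' hT ht₀ h0 x (b := b) he.orthonormal hbν
  have hGF := hG.isGraphFlow hX hf hc ht₀ h0 he (fun i => rfl) ha haκ
  have hF : F (0, t₀) = speed f X ν t₀ x := by rw [← hG.speed_eq.self_of_nhds, hG.base]
  have hφ : barrier β ε F (0, t₀) = (β + ε * (1 + t₀)) * speed f X ν t₀ x := by rw [barrier, hF]
  set D := X t₀ x - X t₀ y with hD
  have hd : 0 < ‖D‖ := hX.norm_sub_pos ht₀ hxy
  have hDD : inner ℝ D D = ‖D‖ ^ 2 := real_inner_self_eq_norm_sq D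
  have hνy : ν t₀ y = ν t₀ x + barrier β ε F (0, t₀) • D := by
    rw [hφ]
    exact hX.normal_eq_of_touching hf ht₀ (θ := fun s => β + ε * (1 + s)) hθ0
      (hnn t₀ ht₀ le_rfl) hzero
  have hZ0 : twoPoint (barrier β ε F (0, t₀)) D (ν t₀ x) = 0 := by rw [hφ]; exact hzero
  -- Reflection in the hyperplane orthogonal to D. Since 2⟨D,ν⟩ = -φ|D|², it sends the normal at x
  -- to the normal at y, and hence tangent frames to tangent frames.
  set b' : Fin n → EuclideanSpace ℝ (Fin (n + 1)) :=
    fun i => b i - (2 * inner ℝ D (b i) / ‖D‖ ^ 2) • D with hb'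
  have hb'o : ∀ i j, inner ℝ (b' i) (b' j) = if i = j then (1 : ℝ) else 0 := by
    intro i j
    rw [← he.orthonormal i j]
    change inner ℝ (b' i) (b' j) = (inner ℝ (b i) (b j) : ℝ)
    simp only [hb', inner_sub_left, inner_sub_right, real_inner_smul_left, inner_smul_right, hDD,
      real_inner_comm D (b i)]
    field_simp
    ring
  have hb'ν : ∀ i, inner ℝ (b' i) (ν t₀ y) = (0 : ℝ) := by
    intro i
    have h1 := hZ0
    rw [twoPoint] at h1
    simp only [hb', hνy, inner_sub_left, inner_add_right, real_inner_smul_left, inner_smul_right,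
      hDD, hbν, real_inner_comm D (b i)]
    field_simp
    linear_combination -(inner ℝ D (b i)) * h1
  obtain ⟨ξ', w', F', hG'⟩ := hX.exists_localGraph hf hΨ hΨ' hT ht₀ h0 y (b := b') hb'o hb'ν
  have hF' : F' (0, t₀) = speed f X ν t₀ y := by rw [← hG'.speed_eq.self_of_nhds, hG'.base]
  have hJ' := areaElement_of_eq_zero hG'.grad_eq_zero
  refine hGF.not_touching_offDiagonal rfl hΨ ha0 (hΨ' _ hGF.F_pos)
    (by linarith [hΨ1 _ hGF.F_pos]) (hΨ2 _ hGF.F_pos) hε hθ0 hbν (hn.norm_eq_one x)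
    (norm_pos_iff.1 hd) hνy (fun i => rfl) hG'.contDiff_w (hG'.w_eq_zero (hn.norm_eq_one y))
    hG'.grad_eq_zero (F' := F' (0, t₀)) ?_ ?_ ?_ ?_ hZ0 ?_
  -- The weights chosen at x are used at y, where the frame b' need not be principal; the support
  -- inequality holds in any orthonormal frame.
  · have h1 := (hG'.support hX hf hc ht₀ h0 ha).self_of_nhds
    refine le_trans (le_of_eq ?_) h1
    simp [weightedTrace, graphFrame, hG'.grad_eq_zero, hJ', ite_mul]
  · have h1 := hG'.flow.self_of_nhds
    rw [hJ', mul_one] at h1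
    exact h1
  · exact deriv_mul_sub_le hΨ hΨ2 hGF.F_pos (hF' ▸ hX.speed_pos hf ht₀ y)
  · intro i
    have h1 := hX.diagForm_nonneg hf hmono hT hθ ht₀ (hnn t₀ ht₀ le_rfl) x (e i)
    rw [diagForm_frame he, ← hφ] at h1
    linarith
  · have hI : ∀ᶠ z in 𝓝 ((0 : EuclideanSpace ℝ (Fin n)), t₀), z.2 ∈ timeInterval T :=
      continuous_snd.continuousAt.eventually (timeInterval_mem_nhds ht₀ h0)
    have h1 := (hG.position.and (hG.normal.and (hG.speed_eq.and hI))).prod_inl_nhds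
      ((0 : EuclideanSpace ℝ (Fin n)), t₀)
    have h2 := hG'.position.prod_inr_nhds ((0 : EuclideanSpace ℝ (Fin n)), t₀)
    filter_upwards [h1, h2] with q h3 h4 hq hqt
    have h5 := hnn q.1.2 h3.2.2.2 hqt (ξ q.1) (ξ' q.2)
    rw [pairFn, h3.1, hq, h4, ← hq, h3.2.1, h3.2.2.1] at h5
    have h6 : X t₀ x + graphPoint b (ν t₀ x) w q.1 - (X t₀ y + graphPoint b' (ν t₀ y) w' q.2)
        = D + graphPoint b (ν t₀ x) w q.1 - graphPoint b' (ν t₀ y) w' q.2 := by rw [hD]; abel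
    rw [h6] at h5
    exact h5

end IsEmbeddedSolution

end Noncollapsing

end CurvatureFlow

end

/-! ### The noncollapsing theorem -/

theorem mainTheorem1 {n : ℕ} {M : Type*} [TopologicalSpace M]
    [ChartedSpace (EuclideanSpace ℝ (Fin n)) M] [IsManifold (𝓡 n) ∞ M]
    [CompactSpace M] [T2Space M]
    (Γ : Set (Fin n → ℝ)) (f : (Fin n → ℝ) → ℝ) (Ψ : ℝ → ℝ)
    (hf : CurvatureFlow.IsAdmissibleSpeed Γ f)
    (hconvex : ConvexOn ℝ Γ f)
    (hΨ : ContDiffOn ℝ 2 Ψ (Ioi 0))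
    (hΨ_i : ∀ s : ℝ, 0 < s → 0 < deriv Ψ s)
    (hΨ_iia : ∀ s : ℝ, 0 < s → deriv Ψ s * s - Ψ s ≤ 0)
    (hΨ_iiia : ∀ s : ℝ, 0 < s → 0 ≤ deriv (deriv Ψ) s)
    (T : EReal) (hT : 0 < T)
    (X ν : ℝ → M → EuclideanSpace ℝ (Fin (n + 1)))
    (hX : CurvatureFlow.IsEmbeddedSolution Γ f Ψ T X ν) :
    (∃ β : ℝ, 0 < β ∧ ∀ x : M,
      ((-β * CurvatureFlow.speed f X ν 0 x : ℝ) : EReal) ≤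
        CurvatureFlow.exscribedCurvature (X 0) (ν 0) x) ∧
    ∀ β : ℝ, 0 < β →
      (∀ x : M, ((-β * CurvatureFlow.speed f X ν 0 x : ℝ) : EReal) ≤
        CurvatureFlow.exscribedCurvature (X 0) (ν 0) x) →
      ∀ t ∈ CurvatureFlow.timeInterval T, ∀ x : M,
        ((-β * CurvatureFlow.speed f X ν t x : ℝ) : EReal) ≤
          CurvatureFlow.exscribedCurvature (X t) (ν t) x := by
  have h0 := CurvatureFlow.zero_mem_timeInterval hT
  have hmono : StrictMonoOn Ψ (Ioi 0) := strictMonoOn_of_deriv_pos (convex_Ioi 0) hΨ.continuousOn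
    fun s hs => hΨ_i s (by simpa using hs)
  refine ⟨?_, fun β hβ hinit t₁ ht₁ x₁ => ?_⟩
  · obtain ⟨b, hb, h⟩ := hX.exists_pairFn_nonneg hf hmono hT
    exact ⟨b, hb, fun x => (hX.le_exscribedCurvature_iff h0 b x).2 (h x)⟩
  rw [hX.le_exscribedCurvature_iff ht₁]
  intro y₁
  replace hinit : ∀ x y, 0 ≤ CurvatureFlow.pairFn (fun _ => β) f X ν 0 x y := fun x =>
    (hX.le_exscribedCurvature_iff h0 β x).1 (hinit x)
  by_contra! hneg
  have hF := hX.speed_pos hf ht₁ x₁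
  have ht₁0 : 0 ≤ t₁ := ht₁.1
  set P := CurvatureFlow.pairFn (fun _ => β) f X ν t₁ x₁ y₁ with hP
  set c := (1 + t₁) * CurvatureFlow.speed f X ν t₁ x₁ * ‖X t₁ x₁ - X t₁ y₁‖ ^ 2 with hc
  have hc0 : 0 ≤ c := by positivity
  -- With this ε the perturbed two-point function at (x₁,y₁,t₁) equals P + εc = -ε, still negative.
  set ε := -P / (c + 1) with hε
  have hε0 : 0 < ε := div_pos (by linarith) (by linarith)
  have hεc : ε * (c + 1) = -P := div_mul_cancel₀ _ (by linarith)
  have hneg' : CurvatureFlow.pairFn (fun s => β + ε * (1 + s)) f X ν t₁ x₁ y₁ < 0 := by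
    rw [CurvatureFlow.pairFn_add (θ := fun _ => β) fun s => ε * (1 + s), ← hP,
      show ε * (1 + t₁) * CurvatureFlow.speed f X ν t₁ x₁ * ‖X t₁ x₁ - X t₁ y₁‖ ^ 2 = ε * c by
        rw [hc]; ring]
    linarith
  obtain ⟨t₀, ht₀, hpos, hnn, h⟩ := hX.exists_first_touching hf hmono hT
    (θ := fun s => β + ε * (1 + s)) (by fun_prop) ht₁
    (fun x y hxy => by
      rw [CurvatureFlow.pairFn_add (θ := fun _ => β) fun s => ε * (1 + s)]
      have h1 := hX.speed_pos hf h0 x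
      have h2 := hX.norm_sub_pos h0 hxy
      have h3 : 0 < ε * (1 + 0) * CurvatureFlow.speed f X ν 0 x * ‖X 0 x - X 0 y‖ ^ 2 := by
        positivity
      linarith [hinit x y])
    (fun x v hv => by
      rw [CurvatureFlow.diagForm_add (θ := fun _ => β) fun s => ε * (1 + s)]
      have h1 := hX.speed_pos hf h0 x
      have h2 : 0 < ‖CurvatureFlow.differential (X 0) x v‖ := norm_pos_iff.2 fun h =>
        hv (hX.differential_injective h0 x (h.trans (map_zero _).symm))
      have h3 : 0 < ε * (1 + 0) * CurvatureFlow.speed f X ν 0 x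
          * ‖CurvatureFlow.differential (X 0) x v‖ ^ 2 := by positivity
      linarith [hX.diagForm_nonneg hf hmono hT continuous_const h0 hinit x v])
    hneg'
  rcases h with ⟨x, y, hxy, h⟩ | ⟨x, v, hv, h⟩
  · exact hX.not_offDiagonal_touching hf hconvex hΨ hΨ_i hΨ_iia hΨ_iiia hT ht₀ hpos hβ hε0 hnn hxy h
  · exact hX.not_diagonal_touching hf hconvex hΨ hΨ_i hΨ_iia hΨ_iiia hT ht₀ hpos hβ hε0 hnn hv h
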